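/- For real $a,b\ge 0$ let $J(n,a,b)$ be the Jacobi unitary ensemble on complex Hermitian $n\times n$ matrices, i.e. the probability measure proportional to $\det(1-M)^{a}\det(1+M)^{b}\,1_{-1\le M\le 1}\,dM$, where $dM$ is Lebesgue measure on Hermitian matrices. Let $b\ge 0$ be a fixed integer, let $(a_n)$ be a sequence of nonnegative reals, put $\alpha_n=a_n/n$, and assume $0\le\liminf_n\alpha_n<\infty$. For every $n$ let $\lambda_1\le\lambda_2\le\dots\le\lambda_n$ be the eigenvalues, in nondecreasing order, of a random matrix with law $J(n,a_n,b)$. Then, as $n\to\infty$, the random sequences $$\left((\lambda_1+1)n^2(1+\alpha_n),\,(\lambda_2+1)n^2(1+\alpha_n),\,\dots,\,(\lambda_n+1)n^2(1+\alpha_n),\,0,0,\dots\right)$$ converge in distribution in $\mathbb{R}^{\mathbb{N}}$ with the product topology to some probability measure on $\mathbb{R}^{\mathbb{N}}$; equivalently, for every $k$ the joint law of the first $k$ coordinates converges weakly to a probability measure on $\mathbb{R}^k$. -/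

import Mathlib

open MeasureTheory ProbabilityTheory Filter Topology
open scoped ENNReal ComplexOrder

/-- The space of complex Hermitian `n × n` matrices. -/
abbrev HermMatrix (n : ℕ) : Type :=
  {M : Matrix (Fin n) (Fin n) ℂ // M.IsHermitian}

/-- Hermitian matrices carry the Borel σ-algebra of the entrywise topology. -/
noncomputable instance instMeasurableSpaceHermMatrix (n : ℕ) : MeasurableSpace (HermMatrix n) :=
  borel (HermMatrix n)

instance instBorelSpaceHermMatrix (n : ℕ) : BorelSpace (HermMatrix n) := ⟨rfl⟩

/-- The `n²` real coordinates of a Hermitian matrix `M`: `t i i = M i i`, and, for `i < j`,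
`t i j = Re (M i j)` and `t j i = Im (M i j)`. -/
noncomputable def hermOfCoords (n : ℕ) (t : Fin n → Fin n → ℝ) : HermMatrix n :=
  ⟨Matrix.of fun i j =>
      if i < j then (⟨t i j, t j i⟩ : ℂ) else if j < i then ⟨t j i, -t i j⟩ else ⟨t i i, 0⟩, by
    ext i j
    rcases lt_trichotomy i j with h | h | h
    · simp [Matrix.conjTranspose_apply, h, h.not_gt, Complex.ext_iff]
    · subst h
      simp [Matrix.conjTranspose_apply, Complex.ext_iff]
    · simp [Matrix.conjTranspose_apply, h, h.not_gt, Complex.ext_iff]⟩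

/-- Lebesgue measure `dM = ∏ i, dM i i * ∏ i < j, d(Re M i j) d(Im M i j)` on Hermitian
matrices. -/
noncomputable def hermLebesgue (n : ℕ) : Measure (HermMatrix n) :=
  (volume : Measure (Fin n → Fin n → ℝ)).map (hermOfCoords n)

open Classical in
/-- The unnormalized density `det (1 - M) ^ a * det (1 + M) ^ b * 1_{-1 ≤ M ≤ 1}`; the two
determinants are nonnegative reals where the indicator does not vanish. -/
noncomputable def jacobiWeight (n : ℕ) (a b : ℝ) (M : HermMatrix n) : ℝ≥0∞ :=
  if (1 - M.1).PosSemidef ∧ (1 + M.1).PosSemidef then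
    ENNReal.ofReal ((1 - M.1).det.re ^ a * (1 + M.1).det.re ^ b)
  else 0

/-- The Jacobi unitary ensemble of parameter `(n, a, b)` on Hermitian matrices with spectrum in
`[-1, 1]`: the law with density proportional to `det (1 - M) ^ a * det (1 + M) ^ b` there. -/
noncomputable def jacobiUnitaryEnsemble (n : ℕ) (a b : ℝ) : Measure (HermMatrix n) :=
  (∫⁻ M, jacobiWeight n a b M ∂hermLebesgue n)⁻¹ •
    (hermLebesgue n).withDensity (jacobiWeight n a b)

/-- The eigenvalues of a Hermitian matrix, with multiplicity, in nondecreasing order: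
`hermEigenvalue M 0` is the smallest one. -/
noncomputable def hermEigenvalue {n : ℕ} (M : HermMatrix n) (i : Fin n) : ℝ :=
  M.2.eigenvalues₀ (Fin.cast (Fintype.card_fin n).symm (Fin.rev i))

/-- The vector `((λ i + 1) * n² * (1 + a / n))_i` of eigenvalues rescaled at the edge `-1`,
indexed from `i = 0` and completed by zeros to an infinite sequence. -/
noncomputable def hardEdgeVector (n : ℕ) (a : ℝ) (M : HermMatrix n) : ℕ → ℝ :=
  fun i => if h : i < n then (hermEigenvalue M ⟨i, h⟩ + 1) * (n : ℝ) ^ 2 * (1 + a / n) else 0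

/-!
The limit exists because the expectations `E ∏ f (y i)` over the rescaled eigenvalues
`y i = (λ i + 1) * n * (n + a n)` converge for every continuous `f` with values in `[0, 1]` that
equals `1` near `+∞`, and because these expectations determine the law of a nondecreasing sequence.
The argument has four layers.

*Eigenvalue density.* For a Gaussian Hermitian matrix, integration by parts yields the loop
equations for the mixed moments of the traces `tr M ^ k`. The density `Δ ^ 2 * exp (-∑ x i ^ 2 / 2)`
on `ℝ ^ n` satisfies the same equations, and they have only one solution up to normalization
(`LoopEquations.unique`). Hence the symmetric polynomial moments agree, and, Gaussian tails making
the moment problem determinate, so do the symmetrized laws. Dividing out the Gaussian factor gives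
the Weyl integration formula `exists_weyl_constant`, without any differential geometry of the map
`(U, D) ↦ U * D * U⁻¹`.

*Determinants.* By Andréief's identity, `E ∏ f (y i)` is a ratio of Hankel determinants of the
weight `y ^ b * (1 - y / X) ^ a` on `[0, X]`, `X = 2 * n * (n + a)`
(`integral_prod_jacobiUnitaryEnsemble`). The Jacobi polynomials of this weight are explicit: they
are eigenvectors of the Dirichlet form `∫ p' q' y ^ (b + 1) * (1 - y / X) ^ (a + 1)`, which gives
their orthogonality and, by a recursion that raises both parameters by one, their norms. In their
basis the ratio for `f = 1 + g` becomes the finite Fredholm determinant `det (1 + Q * H)`, where `Q`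
holds the coefficients of the reproducing kernel and `H` is the Hankel matrix of `g`
(`jacobiHankel_ratio_eq_det`). If `1 + g ≥ 0`, the ratio is the determinant of a positive
semidefinite matrix, so it is at most the exponential of the mean of `∑ g (y i)`
(`jacobiHankel_ratio_le`).

*Limits at the hard edge.* The operator with eigenvectors the Jacobi polynomials has the
eigenvalues `θ j = j * (j + a + b + 1)`, and `θ n / X` tends to `1 / 2` whatever the sequence `a n`
of nonnegative reals. The coefficients of the `j`-th polynomial are polynomials in `θ j / X` up to
negligible terms, and its inverse squared norm is a polynomial in `θ j / X` times the increment
`(2 * j + a + b + 1) / X` of that quantity. So every coefficient of the kernel is a Riemann sum and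
converges (`exists_tendsto_jacobiKernel`). Since `b` is an integer, only polynomials occur. The
coefficients of index `(p, q)` are `O (R ^ (p + q) / (p! * q!))` uniformly in `n`, so the Fredholm
determinants, expanded in principal minors, converge by domination
(`exists_tendsto_det_one_add`, `exists_tendsto_hankel_ratio`). The mean number of points in a
bounded interval stays bounded (`exists_jacobiMean_le`), and it diverges logarithmically with the
length of the interval (`exists_le_jacobiMean`).

*From functionals to laws.* The two mean bounds and exponential Chebyshev inequalities give
tightness of each coordinate and `P (y k ≤ T) ≤ C * 2 ^ (-k)` uniformly in `n`. By the second bound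
the infinite products pass to weak limits. By Prokhorov's theorem subsequential limits exist; they
are concentrated on nondecreasing sequences and have the same product functionals, which determine
them because these functionals are closed under multiplication and recover the sequence
(`ext_of_integral_edgeProduct`). Hence the whole sequence converges
(`exists_tendsto_of_edgeProduct`).
-/

/-! ### Gaussian integrals of polynomials -/

/-- The one-dimensional Gaussian moment `∫ x ^ k * exp (-c x ^ 2) dx`, as a complex number. -/
noncomputable def gaussMoment (c : ℝ) (k : ℕ) : ℂ :=
  ∫ x : ℝ, (x : ℂ) ^ k * (Real.exp (-c * x ^ 2) : ℂ)

theorem integrable_pow_mul_exp_neg_mul_sq {c : ℝ} (hc : 0 < c) (k : ℕ) :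
    Integrable fun x : ℝ => x ^ k * Real.exp (-c * x ^ 2) := by
  have h := integrable_rpow_mul_exp_neg_mul_sq hc (s := k) (by linarith [Nat.cast_nonneg (α := ℝ) k])
  simpa [Real.rpow_natCast] using h

theorem integrable_pow_mul_exp_complex {c : ℝ} (hc : 0 < c) (k : ℕ) :
    Integrable fun x : ℝ => (x : ℂ) ^ k * (Real.exp (-c * x ^ 2) : ℂ) := by
  have h := (integrable_pow_mul_exp_neg_mul_sq hc k).ofReal (𝕜 := ℂ)
  refine h.congr (Eventually.of_forall fun x => ?_)
  simp

theorem gaussMoment_eq_ofReal (c : ℝ) (k : ℕ) :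
    gaussMoment c k = ((∫ x : ℝ, x ^ k * Real.exp (-c * x ^ 2) : ℝ) : ℂ) := by
  rw [gaussMoment, ← integral_complex_ofReal]
  congr 1; ext x; simp

theorem gaussMoment_succ {c : ℝ} (hc : 0 < c) (k : ℕ) :
    gaussMoment c (k + 1) = (1 / (2 * c) : ℝ) * (k * gaussMoment c (k - 1)) := by
  have hreal : (∫ x : ℝ, x ^ (k + 1) * Real.exp (-c * x ^ 2)) =
      1 / (2 * c) * (k * ∫ x : ℝ, x ^ (k - 1) * Real.exp (-c * x ^ 2)) := by
    have h1 := integrable_pow_mul_exp_neg_mul_sq hc (k + 1)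
    have h2 := integrable_pow_mul_exp_neg_mul_sq hc (k - 1)
    have h0 := integrable_pow_mul_exp_neg_mul_sq hc k
    have key : ∫ x : ℝ, (k * (x ^ (k - 1) * Real.exp (-c * x ^ 2)) -
        2 * c * (x ^ (k + 1) * Real.exp (-c * x ^ 2))) = 0 := by
      refine integral_eq_zero_of_hasDerivAt_of_integrable
        (f := fun x : ℝ => x ^ k * Real.exp (-c * x ^ 2)) (fun x => ?_)
        ((h2.const_mul _).sub (h1.const_mul _)) h0
      have hd : HasDerivAt (fun x : ℝ => -c * x ^ 2) (-c * (2 * x)) x := by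
        simpa using (hasDerivAt_pow 2 x).const_mul (-c)
      convert! (hasDerivAt_pow k x).mul hd.exp using 1
      ring
    rw [integral_sub (h2.const_mul _) (h1.const_mul _), integral_const_mul,
      integral_const_mul] at key
    rw [div_mul_eq_mul_div, one_mul, eq_div_iff (by positivity)]
    linarith
  rw [gaussMoment_eq_ofReal, hreal, gaussMoment_eq_ofReal]
  push_cast; ring

section Gaussian

variable {ι : Type*} [Fintype ι]

/-- The Gaussian weight `exp (-∑ c i * t i ^ 2)`. -/
noncomputable def gaussWeight (c : ι → ℝ) (t : ι → ℝ) : ℝ := Real.exp (∑ i, -c i * t i ^ 2)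

/-- The integral of a complex polynomial in real variables against the Gaussian weight. -/
noncomputable def gaussIntegral (c : ι → ℝ) (p : MvPolynomial ι ℂ) : ℂ :=
  ∫ t : ι → ℝ, MvPolynomial.eval (fun i => (t i : ℂ)) p * (gaussWeight c t : ℂ)

theorem eval_monomial_mul_gaussWeight (c : ι → ℝ) (s : ι →₀ ℕ) (z : ℂ) (t : ι → ℝ) :
    MvPolynomial.eval (fun i => (t i : ℂ)) (MvPolynomial.monomial s z) * (gaussWeight c t : ℂ) =
      z * ∏ i, ((t i : ℂ) ^ s i * (Real.exp (-c i * t i ^ 2) : ℂ)) := by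
  rw [MvPolynomial.eval_monomial, gaussWeight, Real.exp_sum, Finset.prod_mul_distrib,
    Finsupp.prod_fintype _ _ (by simp), mul_assoc]
  push_cast
  rfl

theorem integrable_eval_mul_gaussWeight {c : ι → ℝ} (hc : ∀ i, 0 < c i) (p : MvPolynomial ι ℂ) :
    Integrable fun t : ι → ℝ =>
      MvPolynomial.eval (fun i => (t i : ℂ)) p * (gaussWeight c t : ℂ) := by
  induction p using MvPolynomial.induction_on' with
  | monomial s z =>
    simp_rw [eval_monomial_mul_gaussWeight]
    exact (Integrable.fintype_prod
      (fun i => integrable_pow_mul_exp_complex (hc i) (s i))).const_mul z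
  | add p q hp hq =>
    simp_rw [map_add, add_mul]
    exact hp.add hq

theorem gaussIntegral_monomial (c : ι → ℝ) (s : ι →₀ ℕ) (z : ℂ) :
    gaussIntegral c (MvPolynomial.monomial s z) = z * ∏ i, gaussMoment (c i) (s i) := by
  simp_rw [gaussIntegral, eval_monomial_mul_gaussWeight, integral_const_mul]
  rw [integral_fintype_prod_volume_eq_prod
    (fun i (x : ℝ) => (x : ℂ) ^ s i * (Real.exp (-c i * x ^ 2) : ℂ))]
  rfl

theorem gaussIntegral_add {c : ι → ℝ} (hc : ∀ i, 0 < c i) (p q : MvPolynomial ι ℂ) :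
    gaussIntegral c (p + q) = gaussIntegral c p + gaussIntegral c q := by
  simp_rw [gaussIntegral, map_add, add_mul]
  exact integral_add (integrable_eval_mul_gaussWeight hc p) (integrable_eval_mul_gaussWeight hc q)

theorem gaussIntegral_C_mul (c : ι → ℝ) (z : ℂ) (p : MvPolynomial ι ℂ) :
    gaussIntegral c (MvPolynomial.C z * p) = z * gaussIntegral c p := by
  simp_rw [gaussIntegral, map_mul, MvPolynomial.eval_C, mul_assoc, integral_const_mul]

theorem gaussIntegral_zero (c : ι → ℝ) : gaussIntegral c 0 = 0 := by
  simp [gaussIntegral]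

theorem gaussIntegral_sum {c : ι → ℝ} (hc : ∀ i, 0 < c i) {κ : Type*} (s : Finset κ)
    (p : κ → MvPolynomial ι ℂ) :
    gaussIntegral c (∑ k ∈ s, p k) = ∑ k ∈ s, gaussIntegral c (p k) := by
  classical
  induction s using Finset.induction_on with
  | empty => simp [gaussIntegral_zero]
  | insert a s ha ih => rw [Finset.sum_insert ha, Finset.sum_insert ha, gaussIntegral_add hc, ih]

theorem gaussIntegral_X_mul_monomial {c : ι → ℝ} (hc : ∀ i, 0 < c i) (i : ι) (s : ι →₀ ℕ) (z : ℂ) :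
    gaussIntegral c (MvPolynomial.X i * MvPolynomial.monomial s z) =
      (1 / (2 * c i) : ℝ) * gaussIntegral c (MvPolynomial.pderiv i (MvPolynomial.monomial s z)) := by
  classical
  rw [MvPolynomial.pderiv_monomial, MvPolynomial.X, MvPolynomial.monomial_mul, one_mul,
    gaussIntegral_monomial, gaussIntegral_monomial,
    ← Finset.mul_prod_erase Finset.univ _ (Finset.mem_univ i),
    ← Finset.mul_prod_erase Finset.univ
      (fun k => gaussMoment (c k) ((s - Finsupp.single i 1 : ι →₀ ℕ) k)) (Finset.mem_univ i)]
  have h1 : ∏ x ∈ Finset.univ.erase i, gaussMoment (c x) ((Finsupp.single i 1 + s : ι →₀ ℕ) x) =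
      ∏ x ∈ Finset.univ.erase i, gaussMoment (c x) ((s - Finsupp.single i 1 : ι →₀ ℕ) x) := by
    refine Finset.prod_congr rfl fun x hx => ?_
    have : i ≠ x := (Finset.ne_of_mem_erase hx).symm
    simp [this]
  have h2 : (Finsupp.single i 1 + s : ι →₀ ℕ) i = s i + 1 := by simp [add_comm]
  have h3 : (s - Finsupp.single i 1 : ι →₀ ℕ) i = s i - 1 := by simp
  rw [h1, h2, h3, gaussMoment_succ (hc i)]
  ring

/-- Integration by parts against the Gaussian weight (Stein's identity). -/
theorem gaussIntegral_X_mul {c : ι → ℝ} (hc : ∀ i, 0 < c i) (i : ι) (p : MvPolynomial ι ℂ) :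
    gaussIntegral c (MvPolynomial.X i * p) =
      (1 / (2 * c i) : ℝ) * gaussIntegral c (MvPolynomial.pderiv i p) := by
  induction p using MvPolynomial.induction_on' with
  | monomial s z => exact gaussIntegral_X_mul_monomial hc i s z
  | add p q hp hq => rw [mul_add, map_add, gaussIntegral_add hc, gaussIntegral_add hc, hp, hq, mul_add]

theorem gaussWeight_pos (c : ι → ℝ) (t : ι → ℝ) : 0 < gaussWeight c t := Real.exp_pos _

theorem continuous_gaussWeight (c : ι → ℝ) : Continuous (gaussWeight c) := by
  unfold gaussWeight; fun_prop

end Gaussian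

/-! ### Loop equations -/

/-- The loop (Schwinger–Dyson) equations of the Gaussian unitary ensemble, for a functional `U`
that sends the multiset `{k₁, …, kₘ}` to the expectation of the product of power sums
`p_{k₁} ⋯ p_{kₘ}` of `n` eigenvalues. -/
structure LoopEquations (n : ℕ) (U : Multiset ℕ → ℂ) : Prop where
  zero_cons : ∀ s, U (0 ::ₘ s) = n * U s
  succ_cons : ∀ k s, U ((k + 1) ::ₘ s) =
    ∑ i ∈ Finset.range k, U (i ::ₘ (k - 1 - i) ::ₘ s) +
      (s.map fun l : ℕ => (l : ℂ) * U ((k + l - 1) ::ₘ s.erase l)).sum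

/-- The loop equations lower the total degree, so they determine the functional up to
normalization. -/
theorem LoopEquations.unique {n : ℕ} {U V : Multiset ℕ → ℂ} (hU : LoopEquations n U)
    (hV : LoopEquations n V) (s : Multiset ℕ) : U s * V 0 = V s * U 0 := by
  suffices H : ∀ d c : ℕ, ∀ s : Multiset ℕ, s.sum = d → s.card = c → U s * V 0 = V s * U 0 from
    H _ _ s rfl rfl
  intro d
  induction d using Nat.strong_induction_on with
  | _ d ihd =>
    intro c
    induction c with
    | zero =>
      intro s _ hs
      rw [Multiset.card_eq_zero.1 hs, mul_comm]
    | succ c ihc =>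
      intro s hsum hcard
      obtain ⟨a, ha⟩ := Multiset.card_pos_iff_exists_mem.1 (by omega : 0 < s.card)
      obtain ⟨s, rfl⟩ := Multiset.exists_cons_of_mem ha
      rw [Multiset.sum_cons] at hsum
      rw [Multiset.card_cons] at hcard
      rcases a with _ | k
      · rw [hU.zero_cons, hV.zero_cons, mul_assoc, mul_assoc,
          ihc s (by omega) (by omega)]
      · rw [hU.succ_cons, hV.succ_cons, add_mul, add_mul, Finset.sum_mul, Finset.sum_mul,
          ← Multiset.sum_map_mul_right, ← Multiset.sum_map_mul_right]
        congr 1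
        · refine Finset.sum_congr rfl fun i hi => ?_
          have hi := Finset.mem_range.1 hi
          refine ihd (s.sum + (k - 1)) (by omega) _ _ ?_ rfl
          simp only [Multiset.sum_cons]; omega
        · refine congrArg Multiset.sum (Multiset.map_congr rfl fun l hl => ?_)
          rcases Nat.eq_zero_or_pos l with rfl | hl0
          · simp
          have h1 := congrArg Multiset.sum (Multiset.cons_erase hl)
          rw [Multiset.sum_cons] at h1
          rw [mul_assoc, mul_assoc, ihd (k + l - 1 + (s.erase l).sum) (by omega) _ _
            (by simp only [Multiset.sum_cons]) rfl]

theorem Derivation.map_multiset_prod {R A : Type*} [CommRing R] [CommRing A] [Algebra R A]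
    (d : Derivation R A A) (p : ℕ → A) (s : Multiset ℕ) :
    d (s.map p).prod = (s.map fun l => d (p l) * ((s.erase l).map p).prod).sum := by
  induction s using Multiset.induction_on with
  | empty => simp
  | cons a s ih =>
    have h : ∀ l ∈ s, d (p l) * (((a ::ₘ s).erase l).map p).prod =
        p a * (d (p l) * ((s.erase l).map p).prod) := by
      intro l hl
      rw [Multiset.erase_cons_tail_of_mem hl, Multiset.map_cons, Multiset.prod_cons]; ring
    rw [Multiset.map_cons, Multiset.prod_cons, d.leibniz, ih, Multiset.map_cons,
      Multiset.sum_cons, Multiset.erase_cons_head, Multiset.map_congr rfl h,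
      Multiset.sum_map_mul_left]
    simp only [smul_eq_mul]; ring

/-- A Gaussian functional satisfies the loop equations as soon as each `p (k + 1)` can be
integrated by parts along a derivation `D k` that maps `p l` to `l * p (k + l - 1)`. -/
theorem LoopEquations.of_integration_by_parts {ι : Type*} [Fintype ι] {c : ι → ℝ}
    (hc : ∀ i, 0 < c i) {n : ℕ} (p : ℕ → MvPolynomial ι ℂ) (w : MvPolynomial ι ℂ)
    (D : ℕ → Derivation ℂ (MvPolynomial ι ℂ) (MvPolynomial ι ℂ)) (hp : p 0 = n)
    (hD : ∀ k l, D k (p l) = l * p (k + l - 1))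
    (hE : ∀ k q, gaussIntegral c (p (k + 1) * (q * w)) =
      gaussIntegral c ((∑ i ∈ Finset.range k, p i * p (k - 1 - i)) * (q * w) + D k q * w)) :
    LoopEquations n fun s => gaussIntegral c ((s.map p).prod * w) := by
  have hsum : ∀ (g : ℕ → MvPolynomial ι ℂ) (s : Multiset ℕ),
      (s.map fun l => gaussIntegral c (g l * w)).sum = gaussIntegral c ((s.map g).sum * w) := by
    intro g s
    induction s using Multiset.induction_on with
    | empty => simp [gaussIntegral_zero]
    | cons a s ih =>
      rw [Multiset.map_cons, Multiset.sum_cons, ih, Multiset.map_cons, Multiset.sum_cons, add_mul,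
        gaussIntegral_add hc]
  constructor
  · intro s
    rw [Multiset.map_cons, Multiset.prod_cons, hp, mul_assoc, ← gaussIntegral_C_mul, map_natCast]
  · intro k s
    have h1 : ∀ l : ℕ, (l : ℂ) *
          gaussIntegral c ((((k + l - 1) ::ₘ s.erase l).map p).prod * w) =
        gaussIntegral c (D k (p l) * ((s.erase l).map p).prod * w) := by
      intro l
      rw [← gaussIntegral_C_mul, hD, Multiset.map_cons, Multiset.prod_cons, map_natCast]
      congr 1
      ring
    simp_rw [h1]
    rw [hsum, ← Derivation.map_multiset_prod, Multiset.map_cons, Multiset.prod_cons, mul_assoc, hE,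
      ← gaussIntegral_sum hc, ← gaussIntegral_add hc]
    congr 2
    rw [Finset.sum_mul]
    refine Finset.sum_congr rfl fun i _ => ?_
    rw [Multiset.map_cons, Multiset.prod_cons, Multiset.map_cons, Multiset.prod_cons]
    ring

section Eigenvalues

open MvPolynomial

variable (n : ℕ)

/-- The Vandermonde polynomial. -/
noncomputable def vandermondePoly : MvPolynomial (Fin n) ℂ :=
  ∏ i : Fin n, ∏ j ∈ Finset.Ioi i, (X j - X i)

/-- The derivation `∑ i, X i ^ k * ∂/∂ X i`. -/
noncomputable def powDerivation (k : ℕ) :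
    Derivation ℂ (MvPolynomial (Fin n) ℂ) (MvPolynomial (Fin n) ℂ) :=
  mkDerivation ℂ fun i => X i ^ k

theorem powDerivation_apply (k : ℕ) (q : MvPolynomial (Fin n) ℂ) :
    powDerivation n k q = ∑ i, X i ^ k * pderiv i q := by
  have h : powDerivation n k = ∑ i, (X i ^ k : MvPolynomial (Fin n) ℂ) • pderiv (R := ℂ) i := by
    refine derivation_ext fun j => ?_
    have hs : (∑ i, (X i ^ k : MvPolynomial (Fin n) ℂ) • pderiv (R := ℂ) i) (X j) =
        ∑ i, (X i ^ k : MvPolynomial (Fin n) ℂ) * pderiv i (X j) := by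
      rw [← Derivation.coeFnAddMonoidHom_apply, map_sum, Finset.sum_apply]
      rfl
    rw [hs, powDerivation, mkDerivation_X]
    simp [pderiv_X, Pi.single_apply]
  rw [h, ← Derivation.coeFnAddMonoidHom_apply, map_sum, Finset.sum_apply]
  rfl

theorem powDerivation_psum (k l : ℕ) :
    powDerivation n k (psum (Fin n) ℂ l) = l * psum (Fin n) ℂ (k + l - 1) := by
  rcases Nat.eq_zero_or_pos l with rfl | hl
  · simp
  simp only [psum, map_sum, Finset.mul_sum]
  refine Finset.sum_congr rfl fun i _ => ?_
  rw [Derivation.leibniz_pow, powDerivation, mkDerivation_X, nsmul_eq_mul, smul_eq_mul, ← pow_add]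
  congr 2; omega

/-- The complete homogeneous polynomial of degree `k - 1` in the variables `i`, `j`. -/
noncomputable def pairSum (k : ℕ) (i j : Fin n) : MvPolynomial (Fin n) ℂ :=
  ∑ r ∈ Finset.range k, X i ^ r * X j ^ (k - 1 - r)

theorem pairSum_comm (k : ℕ) (i j : Fin n) : pairSum n k i j = pairSum n k j i := by
  unfold pairSum
  rw [← Finset.sum_range_reflect]
  refine Finset.sum_congr rfl fun r hr => ?_
  have := Finset.mem_range.1 hr
  rw [mul_comm]
  congr 2
  omega

theorem powDerivation_vandermonde (k : ℕ) :
    powDerivation n k (vandermondePoly n) =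
      vandermondePoly n * ∑ i, ∑ j ∈ Finset.Ioi i, pairSum n k j i := by
  have hfac : ∀ i j : Fin n, powDerivation n k (X j - X i) = (X j - X i) * pairSum n k j i := by
    intro i j
    rw [map_sub, powDerivation, mkDerivation_X, mkDerivation_X, mul_comm, pairSum,
      (Commute.all _ _).geom_sum₂_mul]
  have hprod : ∀ {κ : Type} (s : Finset κ) (f g : κ → MvPolynomial (Fin n) ℂ),
      (∀ x ∈ s, powDerivation n k (f x) = f x * g x) →
      powDerivation n k (∏ x ∈ s, f x) = (∏ x ∈ s, f x) * ∑ x ∈ s, g x := by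
    classical
    intro κ s f g
    induction s using Finset.induction_on with
    | empty => simp
    | insert a s ha ih =>
      intro h
      rw [Finset.prod_insert ha, Finset.sum_insert ha, Derivation.leibniz,
        ih fun x hx => h x (Finset.mem_insert_of_mem hx), h a (Finset.mem_insert_self a s)]
      simp only [smul_eq_mul]; ring
  exact hprod _ _ _ fun i _ => hprod _ _ _ fun j _ => hfac i j

theorem two_mul_sum_pairSum (k : ℕ) :
    2 * ∑ i, ∑ j ∈ Finset.Ioi i, pairSum n k j i =
      ∑ r ∈ Finset.range k, psum (Fin n) ℂ r * psum (Fin n) ℂ (k - 1 - r) -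
        k * psum (Fin n) ℂ (k - 1) := by
  have h1 : ∑ i : Fin n, ∑ j, pairSum n k j i =
      ∑ r ∈ Finset.range k, psum (Fin n) ℂ r * psum (Fin n) ℂ (k - 1 - r) := by
    simp only [psum, Finset.sum_mul_sum, pairSum]
    rw [Finset.sum_comm' (t' := Finset.univ) (s' := fun _ => Finset.univ) (by simp)]
    simp_rw [Finset.sum_comm (s := Finset.univ) (t := Finset.range k)]
  have h2 : ∑ i : Fin n, pairSum n k i i = k * psum (Fin n) ℂ (k - 1) := by
    simp only [psum, pairSum, Finset.mul_sum]
    refine Finset.sum_congr rfl fun i _ => ?_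
    rw [Finset.sum_congr rfl (g := fun _ => (X i ^ (k - 1) : MvPolynomial (Fin n) ℂ))]
    · simp
    · intro r hr
      have := Finset.mem_range.1 hr
      rw [← pow_add]; congr 1; omega
  have h3 : ∀ i : Fin n, ∑ j, pairSum n k j i = ∑ j ∈ Finset.Ioi i, pairSum n k j i +
      ∑ j ∈ Finset.Iio i, pairSum n k j i + pairSum n k i i := by
    intro i
    have hu : (Finset.univ : Finset (Fin n)) = Finset.Ioi i ∪ (Finset.Iio i ∪ {i}) := by
      ext j
      simp only [Finset.mem_univ, Finset.mem_union, Finset.mem_Ioi, Finset.mem_Iio,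
        Finset.mem_singleton, true_iff]
      omega
    rw [hu, Finset.sum_union, Finset.sum_union, Finset.sum_singleton, add_assoc]
    · simp
    · rw [Finset.disjoint_left]
      intro j hj hj'
      simp only [Finset.mem_Ioi, Finset.mem_union, Finset.mem_Iio, Finset.mem_singleton] at hj hj'
      omega
  have h4 : ∑ i : Fin n, ∑ j ∈ Finset.Iio i, pairSum n k j i =
      ∑ i : Fin n, ∑ j ∈ Finset.Ioi i, pairSum n k j i := by
    rw [Finset.sum_comm' (t' := Finset.univ) (s' := fun j => Finset.Ioi j) (by simp)]
    refine Finset.sum_congr rfl fun i _ => Finset.sum_congr rfl fun j _ => pairSum_comm n k _ _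
  rw [← h1, ← h2, Finset.sum_congr rfl fun i _ => h3 i, Finset.sum_add_distrib,
    Finset.sum_add_distrib, h4]
  ring

/-- The density `Δ(λ) ^ 2 * exp (-∑ λ i ^ 2 / 2)` satisfies the loop equations. -/
theorem loopEquations_eigenvalues :
    LoopEquations n fun s => gaussIntegral (fun _ : Fin n => (1 / 2 : ℝ))
      ((s.map (psum (Fin n) ℂ)).prod * vandermondePoly n ^ 2) := by
  have hc : ∀ _i : Fin n, (0 : ℝ) < 1 / 2 := fun _ => by norm_num
  have stein : ∀ (k : ℕ) (q : MvPolynomial (Fin n) ℂ),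
      gaussIntegral (fun _ : Fin n => (1 / 2 : ℝ)) (psum (Fin n) ℂ (k + 1) * q) =
      gaussIntegral (fun _ : Fin n => (1 / 2 : ℝ))
        ((k : MvPolynomial (Fin n) ℂ) * psum (Fin n) ℂ (k - 1) * q + powDerivation n k q) := by
    intro k q
    have h1 : psum (Fin n) ℂ (k + 1) * q = ∑ i, X i * (X i ^ k * q) := by
      simp only [psum, Finset.sum_mul]
      exact Finset.sum_congr rfl fun i _ => by ring
    have h2 : (k : MvPolynomial (Fin n) ℂ) * psum (Fin n) ℂ (k - 1) * q + powDerivation n k q =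
        ∑ i, pderiv i (X i ^ k * q) := by
      rw [powDerivation_apply, psum, Finset.mul_sum, Finset.sum_mul, ← Finset.sum_add_distrib]
      refine Finset.sum_congr rfl fun i _ => ?_
      rw [Derivation.leibniz, Derivation.leibniz_pow, pderiv_X_self]
      simp only [smul_eq_mul, nsmul_eq_mul]; ring
    rw [h1, h2, gaussIntegral_sum hc, gaussIntegral_sum hc]
    refine Finset.sum_congr rfl fun i _ => ?_
    rw [gaussIntegral_X_mul hc]; norm_num
  refine LoopEquations.of_integration_by_parts hc _ _ (powDerivation n)
    (by rw [psum_zero, Fintype.card_fin]) (powDerivation_psum n) fun k q => ?_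
  have h5 := two_mul_sum_pairSum n k
  rw [eq_sub_iff_add_eq] at h5
  rw [stein, ← h5, Derivation.leibniz, Derivation.leibniz_pow, powDerivation_vandermonde]
  congr 1
  simp only [smul_eq_mul, nsmul_eq_mul]
  push_cast
  ring

end Eigenvalues

/-! ### Gaussian Hermitian matrices -/

section MatrixEntries

open MvPolynomial

variable (n : ℕ)

/-- The generic Hermitian matrix: its entries are the polynomials in the `n ^ 2` real coordinates
that `hermOfCoords` evaluates. -/
noncomputable def genericHerm : Matrix (Fin n) (Fin n) (MvPolynomial (Fin n × Fin n) ℂ) :=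
  Matrix.of fun i j =>
    if i < j then X (i, j) + C Complex.I * X (j, i)
    else if j < i then X (j, i) - C Complex.I * X (i, j) else X (i, i)

/-- The coefficients of the quadratic form `tr M ^ 2 / 2` in the real coordinates. -/
noncomputable def entryRate (x : Fin n × Fin n) : ℝ := if x.1 = x.2 then 1 / 2 else 1

theorem entryRate_pos (x : Fin n × Fin n) : 0 < entryRate n x := by
  unfold entryRate; split_ifs <;> norm_num

/-- The derivation in the real coordinates that is dual to the matrix entry `(i, j)` for the
Gaussian weight: it maps the entry `(k, l)` to `1` if `(k, l) = (j, i)`, and to `0` otherwise. -/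
noncomputable def entryDerivation (i j : Fin n) :
    Derivation ℂ (MvPolynomial (Fin n × Fin n) ℂ) (MvPolynomial (Fin n × Fin n) ℂ) :=
  if i < j then (1 / 2 : ℂ) • pderiv (i, j) + (Complex.I / 2) • pderiv (j, i)
  else if j < i then (1 / 2 : ℂ) • pderiv (j, i) + (-(Complex.I / 2)) • pderiv (i, j)
  else pderiv (i, i)

theorem entryDerivation_genericHerm (i j k l : Fin n) :
    entryDerivation n i j (genericHerm n k l) = if i = l ∧ j = k then 1 else 0 := by
  have hadd : ∀ (u v : ℂ) (x y : Fin n × Fin n) (q : MvPolynomial (Fin n × Fin n) ℂ),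
      (u • pderiv x + v • pderiv y :
        Derivation ℂ (MvPolynomial (Fin n × Fin n) ℂ) (MvPolynomial (Fin n × Fin n) ℂ)) q =
      C u * pderiv x q + C v * pderiv y q := by
    intro u v x y q
    rw [Derivation.add_apply, Derivation.smul_apply, Derivation.smul_apply,
      MvPolynomial.smul_eq_C_mul, MvPolynomial.smul_eq_C_mul]
  have hpX : ∀ x y : Fin n × Fin n, pderiv x (X y : MvPolynomial (Fin n × Fin n) ℂ) =
      C (if y = x then 1 else 0) := by
    intro x y
    rw [pderiv_X, Pi.single_apply]
    split_ifs <;> simp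
  have hI : ∀ (x y : Fin n × Fin n),
      pderiv x (C Complex.I * X y : MvPolynomial (Fin n × Fin n) ℂ) =
      C (if y = x then Complex.I else 0) := by
    intro x y
    rw [pderiv_C_mul, hpX, ← C_mul]
    split_ifs <;> simp
  have hone : (if i = l ∧ j = k then 1 else 0 : MvPolynomial (Fin n × Fin n) ℂ) =
      C (if i = l ∧ j = k then 1 else 0) := by
    split_ifs <;> simp
  rw [hone]
  by_cases h1 : i < j <;> by_cases h2 : j < i <;> by_cases h3 : k < l <;> by_cases h4 : l < k
  all_goals first | (exfalso; omega) | skip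
  all_goals
    simp only [genericHerm, entryDerivation, Matrix.of_apply, if_true, if_false, h1, h2, h3, h4,
      hadd, map_add, map_sub, hpX, hI, Prod.mk.injEq]
    try simp only [← C_mul, ← C_add, ← C_sub]
    congr 1
    split_ifs <;> first | omega | (ring_nf; try simp; try norm_num)

theorem gaussIntegral_genericHerm_mul (i j : Fin n) (q : MvPolynomial (Fin n × Fin n) ℂ) :
    gaussIntegral (entryRate n) (genericHerm n i j * q) =
      gaussIntegral (entryRate n) (entryDerivation n i j q) := by
  have hc := entryRate_pos n
  have hCs : ∀ (z : ℂ) (x : Fin n × Fin n), gaussIntegral (entryRate n) (C z * X x * q) =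
      z * ((1 / (2 * entryRate n x) : ℝ) * gaussIntegral (entryRate n) (pderiv x q)) := by
    intro z x
    rw [mul_assoc, gaussIntegral_C_mul, gaussIntegral_X_mul hc]
  have hsm : ∀ (z : ℂ) (x : Fin n × Fin n), gaussIntegral (entryRate n) ((z • pderiv x :
      Derivation ℂ (MvPolynomial (Fin n × Fin n) ℂ) (MvPolynomial (Fin n × Fin n) ℂ)) q) =
      z * gaussIntegral (entryRate n) (pderiv x q) := by
    intro z x
    rw [Derivation.smul_apply, MvPolynomial.smul_eq_C_mul, gaussIntegral_C_mul]
  have hX : ∀ (x : Fin n × Fin n), gaussIntegral (entryRate n) (X x * q) =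
      ((1 / (2 * entryRate n x) : ℝ) * gaussIntegral (entryRate n) (pderiv x q)) :=
    fun x => gaussIntegral_X_mul hc x q
  rcases lt_trichotomy i j with h | rfl | h
  · simp only [genericHerm, entryDerivation, Matrix.of_apply, if_pos h, Derivation.add_apply]
    rw [add_mul, gaussIntegral_add hc, gaussIntegral_add hc, hCs, hX, hsm, hsm]
    simp [entryRate, h.ne, h.ne']
    ring
  · simp only [genericHerm, entryDerivation, Matrix.of_apply, lt_irrefl, if_false]
    rw [hX]
    simp [entryRate]
  · simp only [genericHerm, entryDerivation, Matrix.of_apply, if_pos h, if_neg h.not_gt]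
    rw [show (X (j, i) - C Complex.I * X (i, j)) * q =
        X (j, i) * q + C (-Complex.I) * X (i, j) * q by rw [C_neg]; ring,
      Derivation.add_apply,
      gaussIntegral_add hc, gaussIntegral_add hc, hCs, hX, hsm, hsm]
    simp [entryRate, h.ne, h.ne']
    ring

theorem entryDerivation_pow (i j a b : Fin n) (k : ℕ) :
    entryDerivation n i j ((genericHerm n ^ k) a b) = ∑ r ∈ Finset.range k,
      (genericHerm n ^ r) a j * (genericHerm n ^ (k - 1 - r)) i b := by
  induction k generalizing b with
  | zero =>
    simp only [pow_zero, Finset.range_zero, Finset.sum_empty, Matrix.one_apply]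
    split_ifs <;> simp
  | succ k ih =>
    rw [pow_succ, Matrix.mul_apply, map_sum]
    simp_rw [Derivation.leibniz, ih, entryDerivation_genericHerm, smul_eq_mul]
    rw [Finset.sum_add_distrib, Finset.sum_range_succ, add_comm]
    congr 1
    · simp_rw [Finset.mul_sum]
      rw [Finset.sum_comm]
      refine Finset.sum_congr rfl fun r hr => ?_
      have hr' : k + 1 - 1 - r = (k - 1 - r) + 1 := by have := Finset.mem_range.1 hr; omega
      rw [hr', pow_succ, Matrix.mul_apply, Finset.mul_sum]
      exact Finset.sum_congr rfl fun x _ => by ring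
    · simp only [add_tsub_cancel_right, tsub_self, pow_zero, Matrix.one_apply]
      by_cases hib : i = b
      · simp [hib]
      · simp [hib]

theorem entryDerivation_trace_pow (i j : Fin n) (l : ℕ) :
    entryDerivation n i j ((genericHerm n ^ l).trace) = l * (genericHerm n ^ (l - 1)) i j := by
  simp_rw [Matrix.trace, map_sum, Matrix.diag_apply, entryDerivation_pow]
  rw [Finset.sum_comm, Finset.sum_congr rfl
    (g := fun _ => (genericHerm n ^ (l - 1)) i j)]
  · simp
  · intro r hr
    have hr' : l - 1 = (l - 1 - r) + r := by have := Finset.mem_range.1 hr; omega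
    conv_rhs => rw [hr', pow_add, Matrix.mul_apply]
    exact Finset.sum_congr rfl fun x _ => by ring

/-- The derivation `∑ i j, (M ^ k) j i * ∂/∂ M j i` in the entries of a Hermitian matrix `M`. -/
noncomputable def matrixDerivation (k : ℕ) :
    Derivation ℂ (MvPolynomial (Fin n × Fin n) ℂ) (MvPolynomial (Fin n × Fin n) ℂ) :=
  ∑ i, ∑ j, (genericHerm n ^ k) j i • entryDerivation n i j

theorem matrixDerivation_apply (k : ℕ) (q : MvPolynomial (Fin n × Fin n) ℂ) :
    matrixDerivation n k q = ∑ i, ∑ j, (genericHerm n ^ k) j i * entryDerivation n i j q := by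
  have h : ∀ {κ : Type} (s : Finset κ)
      (d : κ → Derivation ℂ (MvPolynomial (Fin n × Fin n) ℂ) (MvPolynomial (Fin n × Fin n) ℂ)),
      (∑ x ∈ s, d x) q = ∑ x ∈ s, d x q := by
    intro κ s d
    rw [← Derivation.coeFnAddMonoidHom_apply, map_sum, Finset.sum_apply]
    rfl
  rw [matrixDerivation, h]
  refine Finset.sum_congr rfl fun i _ => ?_
  rw [h]
  rfl

/-- The Gaussian unitary ensemble satisfies the loop equations, by integration by parts in the
matrix entries. -/
theorem loopEquations_matrix :
    LoopEquations n fun s => gaussIntegral (entryRate n)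
      ((s.map fun k => (genericHerm n ^ k).trace).prod * 1) := by
  have hc := entryRate_pos n
  refine LoopEquations.of_integration_by_parts hc _ _ (matrixDerivation n) (by simp) ?_ ?_
  · intro k l
    rw [matrixDerivation_apply]
    simp_rw [entryDerivation_trace_pow]
    rcases Nat.eq_zero_or_pos l with rfl | hl
    · simp
    rw [show k + l - 1 = k + (l - 1) by omega, pow_add, Matrix.trace]
    simp_rw [Matrix.diag_apply, Matrix.mul_apply, Finset.mul_sum]
    rw [Finset.sum_comm]
    exact Finset.sum_congr rfl fun i _ => Finset.sum_congr rfl fun j _ => by ring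
  · intro k q
    simp only [mul_one]
    have h1 : (genericHerm n ^ (k + 1)).trace * q =
        ∑ i, ∑ j, genericHerm n i j * ((genericHerm n ^ k) j i * q) := by
      rw [pow_succ', Matrix.trace, Finset.sum_mul]
      refine Finset.sum_congr rfl fun i _ => ?_
      rw [Matrix.diag_apply, Matrix.mul_apply, Finset.sum_mul]
      exact Finset.sum_congr rfl fun j _ => by ring
    have h2 : (∑ r ∈ Finset.range k, (genericHerm n ^ r).trace *
          (genericHerm n ^ (k - 1 - r)).trace) * q + matrixDerivation n k q =
        ∑ i, ∑ j, entryDerivation n i j ((genericHerm n ^ k) j i * q) := by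
      simp_rw [Derivation.leibniz, Finset.sum_add_distrib, entryDerivation_pow, smul_eq_mul]
      rw [matrixDerivation_apply, add_comm]
      congr 1
      simp_rw [Matrix.trace, Finset.sum_mul_sum, Finset.sum_mul, Matrix.diag_apply, Finset.mul_sum]
      conv_rhs => rw [Finset.sum_comm]
      rw [Finset.sum_comm]
      refine Finset.sum_congr rfl fun i _ => ?_
      rw [Finset.sum_comm]
      exact Finset.sum_congr rfl fun j _ => Finset.sum_congr rfl fun r _ => by ring
    rw [h1, h2]
    simp_rw [gaussIntegral_sum hc, gaussIntegral_genericHerm_mul]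

end MatrixEntries

/-! ### Eigenvalues of Hermitian matrices -/

section Spectral

variable {n : ℕ}

theorem hermEigenvalue_monotone (M : HermMatrix n) : Monotone (hermEigenvalue M) := by
  intro i j hij
  refine M.2.eigenvalues₀_antitone ?_
  rw [Fin.le_def]
  simpa [Fin.le_def] using! Fin.rev_le_rev.2 hij

/-- The ordered eigenvalues are a reindexing of Mathlib's family of eigenvalues. -/
theorem exists_perm_hermEigenvalue (M : HermMatrix n) :
    ∃ e : Equiv.Perm (Fin n), ∀ i, hermEigenvalue M i = M.2.eigenvalues (e i) := by
  refine ⟨(Fin.revPerm.trans (finCongr (Fintype.card_fin n).symm)).trans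
    (Fintype.equivOfCardEq (Fintype.card_fin _)), fun i => ?_⟩
  simp [hermEigenvalue, Matrix.IsHermitian.eigenvalues]

/-- A Hermitian matrix is unitarily conjugate to the diagonal matrix of its ordered eigenvalues. -/
theorem exists_unitary_diagonal (M : HermMatrix n) :
    ∃ U : Matrix.unitaryGroup (Fin n) ℂ, M.1 = Unitary.conjStarAlgAut ℂ (Matrix (Fin n) (Fin n) ℂ) U
      (Matrix.diagonal fun i => (M.2.eigenvalues i : ℂ)) :=
  ⟨M.2.eigenvectorUnitary, M.2.spectral_theorem⟩

theorem trace_conjStarAlgAut (U : Matrix.unitaryGroup (Fin n) ℂ) (D : Matrix (Fin n) (Fin n) ℂ) :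
    (Unitary.conjStarAlgAut ℂ (Matrix (Fin n) (Fin n) ℂ) U D).trace = D.trace := by
  rw [Unitary.conjStarAlgAut_apply, Matrix.trace_mul_cycle, Unitary.coe_star_mul_self, one_mul]

theorem det_conjStarAlgAut (U : Matrix.unitaryGroup (Fin n) ℂ) (D : Matrix (Fin n) (Fin n) ℂ) :
    (Unitary.conjStarAlgAut ℂ (Matrix (Fin n) (Fin n) ℂ) U D).det = D.det := by
  rw [Unitary.conjStarAlgAut_apply, Matrix.det_mul_comm, ← mul_assoc, Unitary.coe_star_mul_self,
    one_mul]

theorem trace_pow_eq_sum (M : HermMatrix n) (k : ℕ) :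
    (M.1 ^ k).trace = ∑ i, (hermEigenvalue M i : ℂ) ^ k := by
  obtain ⟨e, he⟩ := exists_perm_hermEigenvalue M
  obtain ⟨U, hU⟩ := exists_unitary_diagonal M
  conv_lhs => rw [hU]
  rw [← map_pow, trace_conjStarAlgAut, Matrix.diagonal_pow, Matrix.trace_diagonal]
  simp_rw [he]
  exact (Equiv.sum_comp e fun i => (M.2.eigenvalues i : ℂ) ^ k).symm

theorem add_smul_eq_conj (M : HermMatrix n) (z : ℝ) {U : Matrix.unitaryGroup (Fin n) ℂ}
    (hU : M.1 = Unitary.conjStarAlgAut ℂ (Matrix (Fin n) (Fin n) ℂ) U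
      (Matrix.diagonal fun i => (M.2.eigenvalues i : ℂ))) :
    1 + (z : ℂ) • M.1 = Unitary.conjStarAlgAut ℂ (Matrix (Fin n) (Fin n) ℂ) U
      (Matrix.diagonal fun i => ((1 + z * M.2.eigenvalues i : ℝ) : ℂ)) := by
  have h : (Matrix.diagonal fun i => ((1 + z * M.2.eigenvalues i : ℝ) : ℂ)) =
      1 + (z : ℂ) • (Matrix.diagonal fun i => (M.2.eigenvalues i : ℂ)) := by
    ext i j
    by_cases hij : i = j
    · subst hij; simp
    · simp [hij]
  rw [h, map_add, map_one, map_smul, ← hU]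

theorem det_one_add_smul_re (M : HermMatrix n) (z : ℝ) :
    (1 + (z : ℂ) • M.1).det.re = ∏ i, (1 + z * hermEigenvalue M i) := by
  obtain ⟨e, he⟩ := exists_perm_hermEigenvalue M
  obtain ⟨U, hU⟩ := exists_unitary_diagonal M
  rw [add_smul_eq_conj M z hU, det_conjStarAlgAut, Matrix.det_diagonal, ← Complex.ofReal_prod,
    Complex.ofReal_re]
  simp_rw [he]
  exact (Equiv.prod_comp e fun i => (1 + z * M.2.eigenvalues i)).symm

theorem posSemidef_one_add_smul_iff (M : HermMatrix n) (z : ℝ) :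
    (1 + (z : ℂ) • M.1).PosSemidef ↔ ∀ i, 0 ≤ 1 + z * hermEigenvalue M i := by
  obtain ⟨e, he⟩ := exists_perm_hermEigenvalue M
  obtain ⟨U, hU⟩ := exists_unitary_diagonal M
  rw [add_smul_eq_conj M z hU, Unitary.conjStarAlgAut_apply,
    Matrix.IsUnit.posSemidef_star_right_conjugate_iff (Unitary.isUnit_coe),
    Matrix.posSemidef_diagonal_iff]
  simp_rw [he, Complex.zero_le_real]
  exact (e.forall_congr_right (q := fun i => 0 ≤ 1 + z * M.2.eigenvalues i)).symm

/-- The weight of the Jacobi ensemble in terms of the eigenvalues. -/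
theorem jacobiWeight_eq (a b : ℝ) (M : HermMatrix n) :
    jacobiWeight n a b M = ∏ i, (if -1 ≤ hermEigenvalue M i ∧ hermEigenvalue M i ≤ 1 then
      ENNReal.ofReal ((1 - hermEigenvalue M i) ^ a * (1 + hermEigenvalue M i) ^ b) else 0) := by
  have h1 := posSemidef_one_add_smul_iff M 1
  have h2 := posSemidef_one_add_smul_iff M (-1)
  have d1 := det_one_add_smul_re M 1
  have d2 := det_one_add_smul_re M (-1)
  simp only [Complex.ofReal_one, one_smul, one_mul, Complex.ofReal_neg, neg_smul, neg_mul,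
    ← sub_eq_add_neg] at h1 h2 d1 d2
  rw [jacobiWeight, h1, h2, d1, d2]
  by_cases h : ∀ i, -1 ≤ hermEigenvalue M i ∧ hermEigenvalue M i ≤ 1
  · rw [if_pos ⟨fun i => by linarith [h i], fun i => by linarith [h i]⟩,
      Finset.prod_congr rfl fun i _ => if_pos (h i), ← Real.finsetProd_rpow,
      ← Real.finsetProd_rpow, ← Finset.prod_mul_distrib, ENNReal.ofReal_prod_of_nonneg]
    · exact fun i _ => mul_nonneg (Real.rpow_nonneg (by linarith [h i]) _)
        (Real.rpow_nonneg (by linarith [h i]) _)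
    · exact fun i _ => by linarith [h i]
    · exact fun i _ => by linarith [h i]
  · rw [if_neg]
    · push Not at h
      obtain ⟨i, hi⟩ := h
      refine (Finset.prod_eq_zero (Finset.mem_univ i) (if_neg fun hh => ?_)).symm
      linarith [hi hh.1]
    · rintro ⟨ha, hb⟩
      exact h fun i => ⟨by linarith [hb i], by linarith [ha i]⟩

theorem continuous_trace_pow (k : ℕ) : Continuous fun M : HermMatrix n => (M.1 ^ k).trace.re :=
  Complex.continuous_re.comp (Continuous.matrix_trace (continuous_subtype_val.pow k))

theorem sum_pow_eq_trace_re (M : HermMatrix n) (k : ℕ) :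
    ∑ i, hermEigenvalue M i ^ k = (M.1 ^ k).trace.re := by
  rw [trace_pow_eq_sum]
  simp [← Complex.ofReal_pow]

theorem measurable_sum_eval (p : Polynomial ℝ) :
    Measurable fun M : HermMatrix n => ∑ i, p.eval (hermEigenvalue M i) := by
  have h : (fun M : HermMatrix n => ∑ i, p.eval (hermEigenvalue M i)) =
      fun M => ∑ k ∈ p.support, p.coeff k * (M.1 ^ k).trace.re := by
    funext M
    simp_rw [Polynomial.eval_eq_sum, Polynomial.sum, ← sum_pow_eq_trace_re, Finset.mul_sum]
    exact Finset.sum_comm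
  rw [h]
  exact Finset.measurable_sum _ fun k _ =>
    ((continuous_trace_pow k).measurable.const_mul _)

theorem measurable_sum_continuous {φ : ℝ → ℝ} (hφ : Continuous φ) :
    Measurable fun M : HermMatrix n => ∑ i, φ (hermEigenvalue M i) := by
  have happ : ∀ m : ℕ, ∃ p : Polynomial ℝ, ∀ x ∈ Set.Icc (-(m : ℝ)) m,
      |p.eval x - φ x| < 1 / ((m : ℝ) + 1) := fun m =>
    exists_polynomial_near_of_continuousOn _ _ φ hφ.continuousOn _ (by positivity)
  choose p hp using happ
  refine measurable_of_tendsto_metrizable (fun m => measurable_sum_eval (p m)) ?_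
  rw [tendsto_pi_nhds]
  intro M
  refine tendsto_finsetSum _ fun i _ => ?_
  rw [tendsto_iff_norm_sub_tendsto_zero]
  refine squeeze_zero' (Eventually.of_forall fun m => norm_nonneg _) ?_
    tendsto_one_div_add_atTop_nhds_zero_nat
  obtain ⟨m₀, hm₀⟩ := exists_nat_ge |hermEigenvalue M i|
  filter_upwards [eventually_ge_atTop m₀] with m hm
  have h1 : |hermEigenvalue M i| ≤ m := hm₀.trans (by exact_mod_cast hm)
  exact (hp m _ (abs_le.1 h1)).le

/-- The continuous function that decreases from `1` to `0` on `[q - 1 / j, q]`. -/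
noncomputable def ramp (q : ℝ) (j : ℕ) (x : ℝ) : ℝ := min 1 (j * max (q - x) 0)

theorem continuous_ramp (q : ℝ) (j : ℕ) : Continuous (ramp q j) := by unfold ramp; fun_prop

theorem ramp_nonneg (q : ℝ) (j : ℕ) (x : ℝ) : 0 ≤ ramp q j x := by unfold ramp; positivity

theorem ramp_le_one (q : ℝ) (j : ℕ) (x : ℝ) : ramp q j x ≤ 1 := min_le_left _ _

theorem ramp_eq_zero {q : ℝ} (j : ℕ) {x : ℝ} (h : q ≤ x) : ramp q j x = 0 := by
  rw [ramp, max_eq_right (by linarith), mul_zero, min_eq_right zero_le_one]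

theorem ramp_eq_one {q : ℝ} {j : ℕ} {x : ℝ} (h : 1 ≤ j * (q - x)) : ramp q j x = 1 := by
  refine min_eq_left (h.trans ?_)
  gcongr
  exact le_max_left _ _

theorem eventually_ramp_eq_one {q x : ℝ} (h : x < q) : ∀ᶠ j : ℕ in atTop, ramp q j x = 1 := by
  obtain ⟨j₀, hj₀⟩ := exists_nat_ge (1 / (q - x))
  filter_upwards [eventually_ge_atTop j₀] with j hj
  refine ramp_eq_one ?_
  have h1 : 1 / (q - x) ≤ j := hj₀.trans (by exact_mod_cast hj)
  rwa [div_le_iff₀ (by linarith)] at h1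

/-- The `k`-th eigenvalue lies below `t` when at least `k + 1` eigenvalues do. The number of
eigenvalues below `t` is a limit of continuous linear statistics, which by the Weierstrass theorem
are limits of traces of polynomials in the matrix. -/
theorem measurable_hermEigenvalue (k : Fin n) :
    Measurable fun M : HermMatrix n => hermEigenvalue M k := by
  refine measurable_of_Iio fun t => ?_
  have hcount : Measurable fun M : HermMatrix n =>
      ∑ i, (if hermEigenvalue M i < t then (1 : ℝ) else 0) := by
    refine measurable_of_tendsto_metrizable
      (fun j : ℕ => measurable_sum_continuous (continuous_ramp t j)) ?_
    rw [tendsto_pi_nhds]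
    intro M
    refine tendsto_finsetSum _ fun i _ => ?_
    split_ifs with h
    · exact tendsto_const_nhds.congr' ((eventually_ramp_eq_one h).mono fun j hj => hj.symm)
    · simp_rw [ramp_eq_zero _ (not_lt.1 h)]
      exact tendsto_const_nhds
  have hset : (fun M : HermMatrix n => hermEigenvalue M k) ⁻¹' Set.Iio t =
      (fun M : HermMatrix n => ∑ i, (if hermEigenvalue M i < t then (1 : ℝ) else 0)) ⁻¹'
        Set.Ici ((k : ℝ) + 1) := by
    ext M
    simp only [Set.mem_preimage, Set.mem_Iio, Set.mem_Ici, Finset.sum_boole]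
    have hmono := hermEigenvalue_monotone M
    constructor
    · intro h
      have hsub : Finset.Iic k ⊆ Finset.univ.filter fun i => hermEigenvalue M i < t := by
        intro i hi
        simp only [Finset.mem_filter, Finset.mem_univ, true_and]
        exact (hmono (Finset.mem_Iic.1 hi)).trans_lt h
      have := Finset.card_le_card hsub
      rw [Fin.card_Iic] at this
      exact_mod_cast this
    · intro h
      by_contra hk
      have hsub : (Finset.univ.filter fun i => hermEigenvalue M i < t) ⊆ Finset.Iio k := by
        intro i hi
        simp only [Finset.mem_filter, Finset.mem_univ, true_and] at hi
        rw [Finset.mem_Iio]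
        by_contra hik
        exact hk ((hmono (not_lt.1 hik)).trans_lt hi)
      have := Finset.card_le_card hsub
      rw [Fin.card_Iio] at this
      have h' : (k : ℕ) + 1 ≤ (Finset.univ.filter fun i => hermEigenvalue M i < t).card := by
        exact_mod_cast h
      omega
  rw [hset]
  exact hcount measurableSet_Ici

theorem measurable_hermOfCoords : Measurable (hermOfCoords n) := by
  refine Continuous.measurable ?_
  refine Continuous.subtype_mk (continuous_matrix fun i j => ?_) _
  simp only [Matrix.of_apply]
  have hmk : ∀ f g : (Fin n → Fin n → ℝ) → ℝ, Continuous f → Continuous g →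
      Continuous fun t => (⟨f t, g t⟩ : ℂ) := by
    intro f g hf hg
    have : (fun t => (⟨f t, g t⟩ : ℂ)) = fun t => (f t : ℂ) + g t * Complex.I := by
      funext t; exact (Complex.mk_eq_add_mul_I _ _)
    rw [this]
    fun_prop
  split_ifs
  · exact hmk _ _ (by fun_prop) (by fun_prop)
  · exact hmk _ _ (by fun_prop) (by fun_prop)
  · exact hmk _ _ (by fun_prop) (by fun_prop)

end Spectral

/-! ### Symmetric polynomials and the moment problem -/

theorem esymm_mem_adjoin_psum (n k : ℕ) :
    MvPolynomial.esymm (Fin n) ℂ k ∈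
      Algebra.adjoin ℂ (Set.range (MvPolynomial.psum (Fin n) ℂ)) := by
  induction k using Nat.strong_induction_on with
  | _ k ih =>
    rcases Nat.eq_zero_or_pos k with rfl | hk
    · rw [MvPolynomial.esymm_zero]; exact one_mem _
    have h := MvPolynomial.mul_esymm_eq_sum (Fin n) ℂ k
    have hk0 : (k : ℂ) ≠ 0 := by exact_mod_cast hk.ne'
    have h2 : MvPolynomial.esymm (Fin n) ℂ k = (k : ℂ)⁻¹ • ((-1) ^ (k + 1) *
        ∑ a ∈ Finset.HasAntidiagonal.antidiagonal k with a.1 < k,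
          (-1) ^ a.1 * MvPolynomial.esymm (Fin n) ℂ a.1 * MvPolynomial.psum (Fin n) ℂ a.2) := by
      rw [← h, MvPolynomial.smul_eq_C_mul, ← mul_assoc, ← map_natCast MvPolynomial.C k,
        ← MvPolynomial.C_mul, inv_mul_cancel₀ hk0, MvPolynomial.C_1, one_mul]
    have hneg : (-1 : MvPolynomial (Fin n) ℂ) ∈
        Algebra.adjoin ℂ (Set.range (MvPolynomial.psum (Fin n) ℂ)) := neg_mem (one_mem _)
    rw [h2]
    refine Subalgebra.smul_mem _ (mul_mem (pow_mem hneg _) (sum_mem fun a ha => ?_)) _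
    exact mul_mem (mul_mem (pow_mem hneg _) (ih _ (Finset.mem_filter.1 ha).2))
      (Algebra.subset_adjoin ⟨_, rfl⟩)

/-- Symmetric polynomials are linear combinations of products of power sums. -/
theorem MvPolynomial.IsSymmetric.mem_span_psum {n : ℕ} {q : MvPolynomial (Fin n) ℂ}
    (hq : q.IsSymmetric) :
    q ∈ Submodule.span ℂ
      (Set.range fun s : Multiset ℕ => (s.map (MvPolynomial.psum (Fin n) ℂ)).prod) := by
  have h1 : q ∈ Algebra.adjoin ℂ (Set.range (MvPolynomial.psum (Fin n) ℂ)) := by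
    obtain ⟨p, hp⟩ := MvPolynomial.esymmAlgHom_fin_surjective ℂ (le_refl n) ⟨q, hq⟩
    have hp' := congrArg Subtype.val hp
    rw [MvPolynomial.esymmAlgHom_apply] at hp'
    rw [show q = MvPolynomial.aeval (fun i : Fin n => MvPolynomial.esymm (Fin n) ℂ (i + 1)) p from
      hp'.symm]
    clear hp hp'
    induction p using MvPolynomial.induction_on with
    | C a => rw [MvPolynomial.aeval_C]; exact Subalgebra.algebraMap_mem _ a
    | add p q hp hq => rw [map_add]; exact add_mem hp hq
    | mul_X p i hp =>
      rw [map_mul, MvPolynomial.aeval_X]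
      exact mul_mem hp (esymm_mem_adjoin_psum n _)
  rw [← Subalgebra.mem_toSubmodule, Algebra.adjoin_eq_span] at h1
  refine Submodule.span_mono ?_ h1
  intro x hx
  obtain ⟨l, hl, rfl⟩ := Submonoid.exists_multiset_of_mem_closure hx
  clear h1 hx
  induction l using Multiset.induction_on with
  | empty => exact ⟨0, by simp⟩
  | cons a l ih =>
    obtain ⟨s, hs⟩ := ih fun y hy => hl y (Multiset.mem_cons_of_mem hy)
    obtain ⟨k, hk⟩ := hl a (Multiset.mem_cons_self a l)
    exact ⟨k ::ₘ s, by simp only [Multiset.map_cons, Multiset.prod_cons, hk] at hs ⊢; rw [hs]⟩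

/-- Finite measures on `ℝ ^ n` with Gaussian tails are determined by their polynomial moments:
the characteristic functions expand into power series of moments. -/
theorem Measure.ext_of_moments {n : ℕ} {μ ν : Measure (Fin n → ℝ)} [IsFiniteMeasure μ]
    [IsFiniteMeasure ν] (hμ : Integrable (fun x => Real.exp (∑ i, x i ^ 2 / 4)) μ)
    (hν : Integrable (fun x => Real.exp (∑ i, x i ^ 2 / 4)) ν)
    (h : ∀ p : MvPolynomial (Fin n) ℂ, ∫ x, MvPolynomial.eval (fun i => (x i : ℂ)) p ∂μ =
      ∫ x, MvPolynomial.eval (fun i => (x i : ℂ)) p ∂ν) : μ = ν := by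
  refine Measure.ext_of_charFunDual ?_
  funext L
  have hL : ∀ x : Fin n → ℝ, L x = ∑ i, x i * L (Pi.single i 1) := by
    intro x
    conv_lhs => rw [← Finset.univ_sum_single x, map_sum]
    refine Finset.sum_congr rfl fun i _ => ?_
    rw [show (Pi.single i (x i) : Fin n → ℝ) = x i • Pi.single i 1 by
      rw [← Pi.single_smul]; simp, map_smul, smul_eq_mul]
  set ξ : Fin n → ℝ := fun i => L (Pi.single i 1) with hξ
  have habs : ∀ x, |L x| ≤ ∑ i, ξ i ^ 2 + ∑ i, x i ^ 2 / 4 := by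
    intro x
    rw [hL, ← Finset.sum_add_distrib]
    refine (Finset.abs_sum_le_sum_abs _ _).trans (Finset.sum_le_sum fun i _ => ?_)
    rw [abs_le]
    constructor <;> nlinarith [sq_nonneg (x i / 2 + ξ i), sq_nonneg (x i / 2 - ξ i)]
  have hcont : Continuous fun x => L x := L.continuous
  have key : ∀ (m : Measure (Fin n → ℝ)) [IsFiniteMeasure m],
      Integrable (fun x => Real.exp (∑ i, x i ^ 2 / 4)) m →
      HasSum (fun k : ℕ => ∫ x, ((L x : ℂ) * Complex.I) ^ k / (k.factorial : ℂ) ∂m)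
        (charFunDual m L) := by
    intro m _ hm
    rw [charFunDual_apply]
    refine hasSum_integral_of_dominated_convergence
      (fun k x => |L x| ^ k / (k.factorial : ℝ)) (fun k => ?_) (fun k => ?_) ?_ ?_ ?_
    · refine Continuous.aestronglyMeasurable ?_
      fun_prop
    · refine Eventually.of_forall fun x => ?_
      simp
    · exact Eventually.of_forall fun x => Real.summable_pow_div_factorial _
    · have he : (fun x => ∑' k : ℕ, |L x| ^ k / (k.factorial : ℝ)) = fun x => Real.exp |L x| := by
        funext x
        rw [Real.exp_eq_exp_ℝ, NormedSpace.exp_eq_tsum_div]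
      rw [he]
      refine (hm.const_mul (Real.exp (∑ i, ξ i ^ 2))).mono' ?_ ?_
      · exact (Real.continuous_exp.comp (continuous_abs.comp hcont)).aestronglyMeasurable
      · refine Eventually.of_forall fun x => ?_
        rw [Real.norm_eq_abs, abs_of_pos (Real.exp_pos _), ← Real.exp_add]
        exact Real.exp_le_exp.2 (habs x)
    · refine Eventually.of_forall fun x => ?_
      rw [Complex.exp_eq_exp_ℂ]
      exact NormedSpace.expSeries_div_hasSum_exp _
  refine (key μ hμ).unique ?_
  convert key ν hν using 1
  funext k
  have hp := h (MvPolynomial.C ((k.factorial : ℂ)⁻¹) *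
    (MvPolynomial.C Complex.I * ∑ i, MvPolynomial.C (ξ i : ℂ) * MvPolynomial.X i) ^ k)
  have he : ∀ x : Fin n → ℝ, MvPolynomial.eval (fun i => (x i : ℂ))
      (MvPolynomial.C ((k.factorial : ℂ)⁻¹) *
        (MvPolynomial.C Complex.I * ∑ i, MvPolynomial.C (ξ i : ℂ) * MvPolynomial.X i) ^ k) =
      ((L x : ℂ) * Complex.I) ^ k / (k.factorial : ℂ) := by
    intro x
    rw [hL]
    simp only [map_mul, map_pow, map_sum, MvPolynomial.eval_C, MvPolynomial.eval_X]
    push_cast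
    rw [div_eq_inv_mul, mul_comm Complex.I]
    congr 4
    exact funext fun i => mul_comm _ _
  simp_rw [he] at hp
  exact hp

/-! ### Symmetric moments of the eigenvalues -/

section Weyl

variable {n : ℕ}

theorem measurePreserving_curry (ι κ : Type*) [Fintype ι] [Fintype κ] :
    MeasurePreserving (fun (t : ι × κ → ℝ) i j => t (i, j)) volume volume := by
  have hu : Measurable fun (t : ι → κ → ℝ) (x : ι × κ) => t x.1 x.2 := by fun_prop
  have hc : Measurable fun (t : ι × κ → ℝ) i j => t (i, j) := by fun_prop
  have h1 : (volume : Measure (ι × κ → ℝ)) =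
      (volume : Measure (ι → κ → ℝ)).map fun t (x : ι × κ) => t x.1 x.2 := by
    refine Measure.pi_eq fun s hs => ?_
    rw [Measure.map_apply hu (MeasurableSet.univ_pi hs)]
    have : (fun (t : ι → κ → ℝ) (x : ι × κ) => t x.1 x.2) ⁻¹' Set.univ.pi s =
        Set.univ.pi fun i => Set.univ.pi fun j => s (i, j) := by
      ext t; simp [Set.mem_pi, Prod.forall]
    rw [this, volume_pi_pi]
    simp_rw [volume_pi_pi, Fintype.prod_prod_type]
  refine ⟨hc, ?_⟩
  rw [h1, Measure.map_map hc hu]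
  exact Measure.map_id

/-- The Hermitian matrix with coordinates indexed by pairs. -/
noncomputable def hermOfPairs (t : Fin n × Fin n → ℝ) : HermMatrix n :=
  hermOfCoords n fun i j => t (i, j)

theorem hermLebesgue_eq_map : hermLebesgue n = volume.map (hermOfPairs (n := n)) := by
  rw [hermLebesgue, ← (measurePreserving_curry (Fin n) (Fin n)).map_eq,
    Measure.map_map measurable_hermOfCoords (measurePreserving_curry _ _).measurable]
  rfl

theorem measurable_hermOfPairs : Measurable (hermOfPairs (n := n)) :=
  measurable_hermOfCoords.comp (measurePreserving_curry _ _).measurable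

/-- The vector of ordered eigenvalues of the matrix with coordinates `t`. -/
noncomputable def pairEigenvalues (t : Fin n × Fin n → ℝ) (i : Fin n) : ℝ :=
  hermEigenvalue (hermOfPairs t) i

theorem measurable_pairEigenvalues : Measurable (pairEigenvalues (n := n)) :=
  measurable_pi_lambda _ fun i => (measurable_hermEigenvalue i).comp measurable_hermOfPairs

theorem genericHerm_map_eval (t : Fin n × Fin n → ℝ) :
    (genericHerm n).map (MvPolynomial.eval fun x => (t x : ℂ)) = (hermOfPairs t).1 := by
  ext i j
  simp only [genericHerm, hermOfPairs, hermOfCoords, Matrix.map_apply, Matrix.of_apply]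
  split_ifs <;> simp [Complex.ext_iff]

theorem eval_trace_genericHerm_pow (t : Fin n × Fin n → ℝ) (k : ℕ) :
    MvPolynomial.eval (fun x => (t x : ℂ)) ((genericHerm n ^ k).trace) =
      MvPolynomial.eval (fun i => (pairEigenvalues t i : ℂ)) (MvPolynomial.psum (Fin n) ℂ k) := by
  have h := trace_pow_eq_sum (hermOfPairs t) k
  rw [← genericHerm_map_eval, ← Matrix.map_pow] at h
  rw [MvPolynomial.psum, map_sum]
  simp only [map_pow, MvPolynomial.eval_X, pairEigenvalues]
  rw [← h, Matrix.trace, Matrix.trace, map_sum]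
  rfl

theorem sum_sq_pairEigenvalues (t : Fin n × Fin n → ℝ) :
    ∑ i, pairEigenvalues t i ^ 2 = ∑ x, 2 * entryRate n x * t x ^ 2 := by
  have h1 : ∑ i, pairEigenvalues t i ^ 2 = ((hermOfPairs t).1 ^ 2).trace.re :=
    sum_pow_eq_trace_re _ 2
  have h2 : ((hermOfPairs t).1 ^ 2).trace.re = ∑ i : Fin n, ∑ j : Fin n,
      ((if i < j then t (i, j) ^ 2 + t (j, i) ^ 2 else 0) +
        (if j < i then t (i, j) ^ 2 + t (j, i) ^ 2 else 0) + (if i = j then t (i, j) ^ 2 else 0)) := by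
    rw [pow_two, Matrix.trace, Complex.re_sum]
    refine Finset.sum_congr rfl fun i _ => ?_
    rw [Matrix.diag_apply, Matrix.mul_apply, Complex.re_sum]
    refine Finset.sum_congr rfl fun j _ => ?_
    simp only [hermOfPairs, hermOfCoords, Matrix.of_apply]
    rcases lt_trichotomy i j with h | rfl | h
    · simp [h, h.not_gt, h.ne, Complex.mul_re]; ring
    · simp [Complex.mul_re]; ring
    · simp [h, h.not_gt, h.ne', Complex.mul_re]; ring
  rw [h1, h2, Fintype.sum_prod_type]
  simp_rw [Finset.sum_add_distrib]
  rw [Finset.sum_comm (f := fun i j : Fin n =>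
    if j < i then t (i, j) ^ 2 + t (j, i) ^ 2 else (0 : ℝ))]
  have h3 : ∀ i j : Fin n, 2 * entryRate n (i, j) * t (i, j) ^ 2 =
      (if i < j then 2 * t (i, j) ^ 2 else 0) + (if j < i then 2 * t (i, j) ^ 2 else 0) +
        (if i = j then t (i, j) ^ 2 else 0) := by
    intro i j
    rcases lt_trichotomy i j with h | rfl | h
    · simp [entryRate, h, h.not_gt, h.ne]
    · simp [entryRate]
    · simp [entryRate, h, h.not_gt, h.ne']
  simp_rw [h3, Finset.sum_add_distrib]
  rw [Finset.sum_comm (f := fun i j : Fin n => if j < i then 2 * t (i, j) ^ 2 else (0 : ℝ))]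
  congr 1
  rw [← Finset.sum_add_distrib, ← Finset.sum_add_distrib]
  refine Finset.sum_congr rfl fun i _ => ?_
  rw [← Finset.sum_add_distrib, ← Finset.sum_add_distrib]
  refine Finset.sum_congr rfl fun j _ => ?_
  split_ifs <;> ring

theorem gaussWeight_entryRate (t : Fin n × Fin n → ℝ) :
    gaussWeight (entryRate n) t = Real.exp (-∑ i, pairEigenvalues t i ^ 2 / 2) := by
  rw [gaussWeight, ← Finset.sum_div, sum_sq_pairEigenvalues, Finset.sum_div, ← Finset.sum_neg_distrib]
  congr 1
  exact Finset.sum_congr rfl fun x _ => by ring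

/-- The squared Vandermonde determinant of real numbers. -/
noncomputable def vandermondeSq (x : Fin n → ℝ) : ℝ := (Matrix.vandermonde x).det ^ 2

theorem eval_vandermondePoly_sq (x : Fin n → ℝ) :
    MvPolynomial.eval (fun i => (x i : ℂ)) (vandermondePoly n ^ 2) = (vandermondeSq x : ℂ) := by
  rw [vandermondeSq, Matrix.det_vandermonde, vandermondePoly]
  simp [map_prod]

theorem continuous_vandermondeSq : Continuous (vandermondeSq (n := n)) := by
  simp_rw [funext fun x : Fin n → ℝ => show vandermondeSq x =
    (∏ i : Fin n, ∏ j ∈ Finset.Ioi i, (x j - x i)) ^ 2 by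
      rw [vandermondeSq, Matrix.det_vandermonde]]
  fun_prop

theorem vandermondeSq_nonneg (x : Fin n → ℝ) : 0 ≤ vandermondeSq x := sq_nonneg _

theorem vandermondeSq_comp_perm (x : Fin n → ℝ) (e : Equiv.Perm (Fin n)) :
    vandermondeSq (x ∘ e) = vandermondeSq x := by
  have h : Matrix.vandermonde (x ∘ e) = (Matrix.vandermonde x).submatrix e id := by
    ext i j; simp [Matrix.vandermonde_apply]
  rw [vandermondeSq, h, Matrix.det_permute, mul_pow]
  have : ((Equiv.Perm.sign e : ℤ) : ℝ) ^ 2 = 1 := by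
    rcases Int.units_eq_one_or (Equiv.Perm.sign e) with h | h <;> simp [h]
  rw [this, one_mul, vandermondeSq]

/-- The loop equations determine the integrals of symmetric polynomials: up to normalization, the
eigenvalues of a Gaussian Hermitian matrix and the density `Δ ^ 2 * exp (-∑ x i ^ 2 / 2)` give the
same symmetric moments. -/
theorem integral_symmetric_eval {q : MvPolynomial (Fin n) ℂ} (hq : q.IsSymmetric) :
    Integrable (fun t : Fin n × Fin n → ℝ =>
      MvPolynomial.eval (fun i => (pairEigenvalues t i : ℂ)) q * (gaussWeight (entryRate n) t : ℂ)) ∧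
    (∫ t : Fin n × Fin n → ℝ,
      MvPolynomial.eval (fun i => (pairEigenvalues t i : ℂ)) q * (gaussWeight (entryRate n) t : ℂ)) *
      gaussIntegral (fun _ : Fin n => (1 / 2 : ℝ)) (vandermondePoly n ^ 2) =
    gaussIntegral (fun _ : Fin n => (1 / 2 : ℝ)) (q * vandermondePoly n ^ 2) *
      gaussIntegral (entryRate n) 1 := by
  have hc : ∀ _i : Fin n, (0 : ℝ) < 1 / 2 := fun _ => by norm_num
  refine Submodule.span_induction (p := fun q _ => Integrable (fun t : Fin n × Fin n → ℝ =>
      MvPolynomial.eval (fun i => (pairEigenvalues t i : ℂ)) q * (gaussWeight (entryRate n) t : ℂ)) ∧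
    (∫ t : Fin n × Fin n → ℝ,
      MvPolynomial.eval (fun i => (pairEigenvalues t i : ℂ)) q * (gaussWeight (entryRate n) t : ℂ)) *
      gaussIntegral (fun _ : Fin n => (1 / 2 : ℝ)) (vandermondePoly n ^ 2) =
    gaussIntegral (fun _ : Fin n => (1 / 2 : ℝ)) (q * vandermondePoly n ^ 2) *
      gaussIntegral (entryRate n) 1) ?_ ?_ ?_ ?_ hq.mem_span_psum
  · rintro _ ⟨s, rfl⟩
    have he : ∀ t : Fin n × Fin n → ℝ, MvPolynomial.eval (fun i => (pairEigenvalues t i : ℂ))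
        (s.map (MvPolynomial.psum (Fin n) ℂ)).prod =
        MvPolynomial.eval (fun x => (t x : ℂ))
          ((s.map fun k => (genericHerm n ^ k).trace).prod * 1) := by
      intro t
      rw [mul_one, map_multiset_prod, map_multiset_prod, Multiset.map_map, Multiset.map_map]
      congr 1
      exact Multiset.map_congr rfl fun k _ => (eval_trace_genericHerm_pow t k).symm
    simp_rw [he]
    refine ⟨integrable_eval_mul_gaussWeight (entryRate_pos n) _, ?_⟩
    have h := (loopEquations_matrix n).unique (loopEquations_eigenvalues n) s
    simp only [Multiset.map_zero, Multiset.prod_zero, one_mul] at h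
    exact h
  · simp [gaussIntegral_zero]
  · rintro p q - - ⟨hp, hp'⟩ ⟨hq, hq'⟩
    simp_rw [map_add, add_mul]
    refine ⟨hp.add hq, ?_⟩
    rw [integral_add hp hq, gaussIntegral_add hc, add_mul, add_mul, hp', hq']
  · rintro z p - ⟨hp, hp'⟩
    simp_rw [MvPolynomial.smul_eq_C_mul, map_mul, MvPolynomial.eval_C, mul_assoc]
    refine ⟨hp.const_mul z, ?_⟩
    rw [integral_const_mul, gaussIntegral_C_mul, mul_assoc, mul_assoc, hp']

end Weyl

/-! ### The Weyl integration formula -/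

section WeylFormula

variable {n : ℕ}

/-- Polynomials are dominated by every Gaussian of positive exponent. -/
theorem norm_eval_le_exp (p : MvPolynomial (Fin n) ℂ) {ε : ℝ} (hε : 0 < ε) :
    ∃ K : ℝ, 0 ≤ K ∧ ∀ x : Fin n → ℝ,
      ‖MvPolynomial.eval (fun i => (x i : ℂ)) p‖ ≤ K * Real.exp (ε * ∑ i, x i ^ 2) := by
  have hone : ∀ x : Fin n → ℝ, 1 ≤ Real.exp (∑ i, x i ^ 2) := fun x =>
    Real.one_le_exp (Finset.sum_nonneg fun i _ => sq_nonneg _)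
  induction p using MvPolynomial.induction_on generalizing ε with
  | C a =>
    refine ⟨‖a‖, norm_nonneg _, fun x => ?_⟩
    rw [MvPolynomial.eval_C]
    refine le_mul_of_one_le_right (norm_nonneg _) (Real.one_le_exp ?_)
    exact mul_nonneg hε.le (Finset.sum_nonneg fun i _ => sq_nonneg _)
  | add p q hp hq =>
    obtain ⟨K, hK, h⟩ := hp hε
    obtain ⟨L, hL, h'⟩ := hq hε
    refine ⟨K + L, add_nonneg hK hL, fun x => ?_⟩
    rw [map_add, add_mul]
    exact (norm_add_le _ _).trans (add_le_add (h x) (h' x))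
  | mul_X p i hp =>
    obtain ⟨K, hK, h⟩ := hp (half_pos hε)
    refine ⟨K * (1 / ε + 1), by positivity, fun x => ?_⟩
    have h1 : |x i| ≤ (1 / ε + 1) * Real.exp (ε / 2 * ∑ i, x i ^ 2) := by
      have h2 : ε / 2 * x i ^ 2 + 1 ≤ Real.exp (ε / 2 * ∑ i, x i ^ 2) := by
        refine (Real.add_one_le_exp _).trans (Real.exp_le_exp.2 ?_)
        gcongr
        exact Finset.single_le_sum (f := fun i => x i ^ 2) (fun i _ => sq_nonneg _)
          (Finset.mem_univ i)
      have h3 : |x i| ≤ (1 / ε + 1) * (ε / 2 * x i ^ 2 + 1) := by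
        have h4 : (1 / ε + 1) * (ε / 2 * x i ^ 2 + 1) =
            x i ^ 2 / 2 + 1 + (1 / ε + ε / 2 * x i ^ 2) := by field_simp; ring
        rw [h4, ← sq_abs]
        have h5 : 0 ≤ 1 / ε + ε / 2 * |x i| ^ 2 := by positivity
        nlinarith [sq_nonneg (|x i| - 1)]
      exact h3.trans (mul_le_mul_of_nonneg_left h2 (by positivity))
    rw [map_mul, MvPolynomial.eval_X, norm_mul, Complex.norm_real, Real.norm_eq_abs]
    calc _ ≤ (K * Real.exp (ε / 2 * ∑ i, x i ^ 2)) *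
          ((1 / ε + 1) * Real.exp (ε / 2 * ∑ i, x i ^ 2)) :=
        mul_le_mul (h x) h1 (abs_nonneg _) (by positivity)
      _ = K * (1 / ε + 1) * (Real.exp (ε / 2 * ∑ i, x i ^ 2) * Real.exp (ε / 2 * ∑ i, x i ^ 2)) := by
        ring
      _ = _ := by rw [← Real.exp_add]; ring_nf

theorem integrable_gaussWeight {ι : Type*} [Fintype ι] {c : ι → ℝ} (hc : ∀ i, 0 < c i) :
    Integrable (gaussWeight c) := by
  have h := (integrable_eval_mul_gaussWeight hc 1).re
  refine h.congr (Eventually.of_forall fun t => ?_)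
  simp

theorem gaussIntegral_one {ι : Type*} [Fintype ι] (c : ι → ℝ) :
    gaussIntegral c 1 = ((∫ t, gaussWeight c t : ℝ) : ℂ) := by
  rw [gaussIntegral, ← integral_complex_ofReal]
  simp

theorem integral_gaussWeight_pos {ι : Type*} [Fintype ι] {c : ι → ℝ} (hc : ∀ i, 0 < c i) :
    0 < ∫ t, gaussWeight c t := by
  rw [integral_pos_iff_support_of_nonneg (fun t => (gaussWeight_pos c t).le)
    (integrable_gaussWeight hc)]
  have : Function.support (gaussWeight c) = Set.univ :=
    Set.eq_univ_of_forall fun t => (gaussWeight_pos c t).ne'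
  rw [this]
  exact isOpen_univ.measure_pos _ Set.univ_nonempty

/-- The density of the eigenvalues of the Gaussian unitary ensemble, up to normalization. -/
noncomputable def gaussianEigenDensity (x : Fin n → ℝ) : ℝ :=
  vandermondeSq x * gaussWeight (fun _ => 1 / 2) x

theorem gaussianEigenDensity_nonneg (x : Fin n → ℝ) : 0 ≤ gaussianEigenDensity x :=
  mul_nonneg (vandermondeSq_nonneg x) (gaussWeight_pos _ x).le

theorem continuous_gaussianEigenDensity : Continuous (gaussianEigenDensity (n := n)) :=
  continuous_vandermondeSq.mul (continuous_gaussWeight _)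

theorem gaussIntegral_mul_vandermondePoly (q : MvPolynomial (Fin n) ℂ) :
    gaussIntegral (fun _ : Fin n => (1 / 2 : ℝ)) (q * vandermondePoly n ^ 2) =
      ∫ x : Fin n → ℝ, MvPolynomial.eval (fun i => (x i : ℂ)) q * (gaussianEigenDensity x : ℂ) := by
  rw [gaussIntegral]
  congr 1; funext x
  rw [map_mul, eval_vandermondePoly_sq, gaussianEigenDensity]
  push_cast; ring

theorem integrable_exp_mul_gaussianEigenDensity :
    Integrable fun x : Fin n → ℝ => Real.exp (∑ i, x i ^ 2 / 4) * gaussianEigenDensity x := by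
  have h := (integrable_eval_mul_gaussWeight (c := fun _ : Fin n => (1 / 4 : ℝ))
    (fun _ => by norm_num) (vandermondePoly n ^ 2)).re
  refine h.congr (Eventually.of_forall fun x => ?_)
  simp only [eval_vandermondePoly_sq, gaussianEigenDensity]
  rw [← Complex.ofReal_mul]
  simp only [RCLike.re_to_complex, Complex.ofReal_re]
  rw [mul_left_comm, gaussWeight, gaussWeight, ← Real.exp_add, ← Finset.sum_add_distrib]
  congr 2
  exact Finset.sum_congr rfl fun i _ => by ring

theorem integrable_gaussianEigenDensity : Integrable (gaussianEigenDensity (n := n)) := by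
  refine integrable_exp_mul_gaussianEigenDensity.mono'
    continuous_gaussianEigenDensity.aestronglyMeasurable (Eventually.of_forall fun x => ?_)
  rw [Real.norm_eq_abs, abs_of_nonneg (gaussianEigenDensity_nonneg x)]
  refine le_mul_of_one_le_left (gaussianEigenDensity_nonneg x) (Real.one_le_exp ?_)
  positivity

theorem integral_gaussianEigenDensity_pos : 0 < ∫ x : Fin n → ℝ, gaussianEigenDensity x := by
  rw [integral_pos_iff_support_of_nonneg gaussianEigenDensity_nonneg integrable_gaussianEigenDensity]
  refine (continuous_gaussianEigenDensity.isOpen_support).measure_pos _ ⟨fun i => (i : ℝ), ?_⟩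
  refine mul_ne_zero (pow_ne_zero 2 ?_) (gaussWeight_pos _ _).ne'
  rw [Matrix.det_vandermonde_ne_zero_iff]
  intro i j hij
  have hij' : ((i : ℕ) : ℝ) = ((j : ℕ) : ℝ) := hij
  exact Fin.ext (by exact_mod_cast hij')

theorem exp_mul_gaussWeight_entryRate (t : Fin n × Fin n → ℝ) :
    Real.exp (∑ i, pairEigenvalues t i ^ 2 / 4) * gaussWeight (entryRate n) t =
      gaussWeight (fun x => entryRate n x / 2) t := by
  have h := sum_sq_pairEigenvalues t
  rw [← Finset.sum_div, h, gaussWeight, gaussWeight, ← Real.exp_add, Finset.sum_div,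
    ← Finset.sum_add_distrib]
  congr 1
  exact Finset.sum_congr rfl fun x _ => by ring

/-- The sum over all permutations of the laws of the permuted eigenvalues of a Gaussian matrix. -/
noncomputable def symmetrizedEigenLaw (n : ℕ) : Measure (Fin n → ℝ) :=
  ∑ e : Equiv.Perm (Fin n), ((volume : Measure (Fin n × Fin n → ℝ)).withDensity
    fun t => ENNReal.ofReal (gaussWeight (entryRate n) t)).map fun t => pairEigenvalues t ∘ e

theorem measurable_pairEigenvalues_comp (e : Equiv.Perm (Fin n)) :
    Measurable fun t : Fin n × Fin n → ℝ => pairEigenvalues t ∘ e :=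
  measurable_pi_lambda _ fun i => (measurable_pi_apply (e i)).comp measurable_pairEigenvalues

theorem measurable_ofReal_gaussWeight {ι : Type*} [Fintype ι] (c : ι → ℝ) :
    Measurable fun t => ENNReal.ofReal (gaussWeight c t) :=
  (continuous_gaussWeight c).measurable.ennreal_ofReal

theorem integrable_withDensity_gaussWeight {E : Type*} [NormedAddCommGroup E] [NormedSpace ℝ E]
    {g : (Fin n × Fin n → ℝ) → E} :
    Integrable g ((volume : Measure (Fin n × Fin n → ℝ)).withDensity
      fun t => ENNReal.ofReal (gaussWeight (entryRate n) t)) ↔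
    Integrable fun t => gaussWeight (entryRate n) t • g t := by
  rw [integrable_withDensity_iff_integrable_smul' (measurable_ofReal_gaussWeight _)
    (Eventually.of_forall fun _ => ENNReal.ofReal_lt_top)]
  simp_rw [ENNReal.toReal_ofReal (gaussWeight_pos _ _).le]

theorem integrable_exp_pairEigenvalues (e : Equiv.Perm (Fin n)) :
    Integrable (fun x : Fin n → ℝ => Real.exp (∑ i, x i ^ 2 / 4))
      (((volume : Measure (Fin n × Fin n → ℝ)).withDensity
        fun t => ENNReal.ofReal (gaussWeight (entryRate n) t)).map
          fun t => pairEigenvalues t ∘ e) := by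
  have hcont : Continuous fun x : Fin n → ℝ => Real.exp (∑ i, x i ^ 2 / 4) := by fun_prop
  rw [integrable_map_measure hcont.aestronglyMeasurable
    (measurable_pairEigenvalues_comp e).aemeasurable, integrable_withDensity_gaussWeight]
  refine (integrable_gaussWeight (c := fun x => entryRate n x / 2)
    fun x => half_pos (entryRate_pos n x)).congr (Eventually.of_forall fun t => ?_)
  simp only [Function.comp_apply, smul_eq_mul]
  rw [Equiv.sum_comp e fun i => pairEigenvalues t i ^ 2 / 4, mul_comm,
    exp_mul_gaussWeight_entryRate]

theorem integrable_exp_symmetrizedEigenLaw :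
    Integrable (fun x : Fin n → ℝ => Real.exp (∑ i, x i ^ 2 / 4)) (symmetrizedEigenLaw n) := by
  rw [symmetrizedEigenLaw, integrable_finsetSum_measure]
  exact fun e _ => integrable_exp_pairEigenvalues e

theorem integrable_eval_of_exp {μ : Measure (Fin n → ℝ)}
    (hμ : Integrable (fun x => Real.exp (∑ i, x i ^ 2 / 4)) μ) (p : MvPolynomial (Fin n) ℂ) :
    Integrable (fun x : Fin n → ℝ => MvPolynomial.eval (fun i => (x i : ℂ)) p) μ := by
  obtain ⟨K, hK, h⟩ := norm_eval_le_exp p (show (0 : ℝ) < 1 / 4 by norm_num)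
  refine (hμ.const_mul K).mono' ?_ (Eventually.of_forall fun x => ?_)
  · refine Continuous.aestronglyMeasurable ?_
    exact (MvPolynomial.continuous_eval p).comp (by fun_prop)
  · refine (h x).trans_eq ?_
    rw [Finset.mul_sum]
    congr 2
    exact Finset.sum_congr rfl fun i _ => by ring

theorem integral_symmetrizedEigenLaw (p : MvPolynomial (Fin n) ℂ) :
    ∫ x, MvPolynomial.eval (fun i => (x i : ℂ)) p ∂symmetrizedEigenLaw n =
      ∫ t : Fin n × Fin n → ℝ, MvPolynomial.eval (fun i => (pairEigenvalues t i : ℂ))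
        (∑ e : Equiv.Perm (Fin n), MvPolynomial.rename e p) * (gaussWeight (entryRate n) t : ℂ) := by
  have hint := fun e : Equiv.Perm (Fin n) =>
    integrable_eval_of_exp (integrable_exp_pairEigenvalues e) p
  have hcont : Continuous fun x : Fin n → ℝ => MvPolynomial.eval (fun i => (x i : ℂ)) p :=
    (MvPolynomial.continuous_eval p).comp (by fun_prop)
  rw [symmetrizedEigenLaw, integral_finsetSum_measure fun e _ => hint e]
  have h1 : ∀ e : Equiv.Perm (Fin n), Integrable fun t : Fin n × Fin n → ℝ =>
      MvPolynomial.eval (fun i => (pairEigenvalues t i : ℂ)) (MvPolynomial.rename e p) *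
        (gaussWeight (entryRate n) t : ℂ) := by
    intro e
    have h := hint e
    rw [integrable_map_measure hcont.aestronglyMeasurable
      (measurable_pairEigenvalues_comp e).aemeasurable, integrable_withDensity_gaussWeight] at h
    refine h.congr (Eventually.of_forall fun t => ?_)
    simp only [Function.comp_apply, MvPolynomial.eval_rename]
    rw [Complex.real_smul, mul_comm]
    rfl
  simp_rw [map_sum, Finset.sum_mul]
  rw [integral_finsetSum _ fun e _ => h1 e]
  refine Finset.sum_congr rfl fun e _ => ?_
  rw [integral_map (measurable_pairEigenvalues_comp e).aemeasurable hcont.aestronglyMeasurable,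
    integral_withDensity_eq_integral_toReal_smul (measurable_ofReal_gaussWeight _)
      (Eventually.of_forall fun _ => ENNReal.ofReal_lt_top)]
  congr 1; funext t
  rw [ENNReal.toReal_ofReal (gaussWeight_pos _ _).le, MvPolynomial.eval_rename, Complex.real_smul,
    mul_comm]
  rfl

theorem integral_rename_mul_gaussianEigenDensity (p : MvPolynomial (Fin n) ℂ)
    (e : Equiv.Perm (Fin n)) :
    ∫ x : Fin n → ℝ, MvPolynomial.eval (fun i => (x i : ℂ)) (MvPolynomial.rename e p) *
        (gaussianEigenDensity x : ℂ) =
      ∫ x : Fin n → ℝ, MvPolynomial.eval (fun i => (x i : ℂ)) p * (gaussianEigenDensity x : ℂ) := by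
  have hmp := volume_measurePreserving_piCongrLeft (fun _ : Fin n => ℝ) e.symm
  rw [← hmp.integral_comp' (g := fun x : Fin n → ℝ => MvPolynomial.eval (fun i => (x i : ℂ)) p *
    (gaussianEigenDensity x : ℂ))]
  congr 1; funext x
  have hx : (MeasurableEquiv.piCongrLeft (fun _ : Fin n => ℝ) e.symm) x = x ∘ e := by
    funext i
    have := Equiv.piCongrLeft_apply_apply (fun _ : Fin n => ℝ) e.symm x (e i)
    simpa using! this
  rw [hx, MvPolynomial.eval_rename]
  congr 2
  rw [gaussianEigenDensity, gaussianEigenDensity, vandermondeSq_comp_perm, gaussWeight, gaussWeight]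
  congr 2
  exact (Equiv.sum_comp e fun i => -(1 / 2) * x i ^ 2).symm

/-- Up to normalization, the symmetrized law of the eigenvalues of a Gaussian Hermitian matrix has
the density `Δ ^ 2 * exp (-∑ x i ^ 2 / 2)`. -/
theorem symmetrizedEigenLaw_eq :
    ENNReal.ofReal (∫ x : Fin n → ℝ, gaussianEigenDensity x) • symmetrizedEigenLaw n =
      ENNReal.ofReal (n.factorial * ∫ t, gaussWeight (entryRate n) t) •
        (volume : Measure (Fin n → ℝ)).withDensity
          fun x => ENNReal.ofReal (gaussianEigenDensity x) := by
  have hpos := integral_gaussianEigenDensity_pos (n := n)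
  have hposM := integral_gaussWeight_pos (entryRate_pos n)
  have hmeas : Measurable fun x : Fin n → ℝ => ENNReal.ofReal (gaussianEigenDensity x) :=
    continuous_gaussianEigenDensity.measurable.ennreal_ofReal
  have hexpV : Integrable (fun x : Fin n → ℝ => Real.exp (∑ i, x i ^ 2 / 4))
      ((volume : Measure (Fin n → ℝ)).withDensity
          fun x => ENNReal.ofReal (gaussianEigenDensity x)) := by
    rw [integrable_withDensity_iff_integrable_smul' hmeas
      (Eventually.of_forall fun _ => ENNReal.ofReal_lt_top)]
    refine integrable_exp_mul_gaussianEigenDensity.congr (Eventually.of_forall fun x => ?_)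
    simp only [smul_eq_mul]
    rw [ENNReal.toReal_ofReal (gaussianEigenDensity_nonneg x), mul_comm]
  have hfinV : IsFiniteMeasure ((volume : Measure (Fin n → ℝ)).withDensity
      fun x => ENNReal.ofReal (gaussianEigenDensity x)) :=
    isFiniteMeasure_withDensity_ofReal integrable_gaussianEigenDensity.2
  have hfin0 : IsFiniteMeasure ((volume : Measure (Fin n × Fin n → ℝ)).withDensity
      fun t => ENNReal.ofReal (gaussWeight (entryRate n) t)) :=
    isFiniteMeasure_withDensity_ofReal (integrable_gaussWeight (entryRate_pos n)).2
  have hfinM : IsFiniteMeasure (symmetrizedEigenLaw n) := by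
    unfold symmetrizedEigenLaw; infer_instance
  have hf1 := Measure.smul_finite (symmetrizedEigenLaw n)
    (ENNReal.ofReal_ne_top (r := ∫ x : Fin n → ℝ, gaussianEigenDensity x))
  have hf2 := Measure.smul_finite ((volume : Measure (Fin n → ℝ)).withDensity
      fun x => ENNReal.ofReal (gaussianEigenDensity x))
    (ENNReal.ofReal_ne_top (r := n.factorial * ∫ t, gaussWeight (entryRate n) t))
  refine Measure.ext_of_moments
    (integrable_exp_symmetrizedEigenLaw.smul_measure ENNReal.ofReal_ne_top)
    (hexpV.smul_measure ENNReal.ofReal_ne_top) fun p => ?_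
  rw [integral_smul_measure, integral_smul_measure, ENNReal.toReal_ofReal hpos.le,
    ENNReal.toReal_ofReal (by positivity), integral_symmetrizedEigenLaw,
    integral_withDensity_eq_integral_toReal_smul hmeas
      (Eventually.of_forall fun _ => ENNReal.ofReal_lt_top)]
  have hsym : (∑ e : Equiv.Perm (Fin n), MvPolynomial.rename e p).IsSymmetric := by
    intro e
    rw [map_sum]
    simp_rw [MvPolynomial.rename_rename]
    exact Equiv.sum_comp (Equiv.mulLeft e)
      fun e' : Equiv.Perm (Fin n) => MvPolynomial.rename e' p
  have h := (integral_symmetric_eval hsym).2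
  rw [gaussIntegral_mul_vandermondePoly, gaussIntegral_one] at h
  have hV1 : gaussIntegral (fun _ : Fin n => (1 / 2 : ℝ)) (vandermondePoly n ^ 2) =
      ((∫ x : Fin n → ℝ, gaussianEigenDensity x : ℝ) : ℂ) := by
    have h1 := gaussIntegral_mul_vandermondePoly (n := n) 1
    rw [one_mul] at h1
    rw [h1, ← integral_complex_ofReal]
    simp
  have hsum : ∫ x : Fin n → ℝ, MvPolynomial.eval (fun i => (x i : ℂ))
        (∑ e : Equiv.Perm (Fin n), MvPolynomial.rename e p) * (gaussianEigenDensity x : ℂ) =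
      n.factorial * ∫ x : Fin n → ℝ, MvPolynomial.eval (fun i => (x i : ℂ)) p *
        (gaussianEigenDensity x : ℂ) := by
    simp_rw [map_sum, Finset.sum_mul]
    rw [integral_finsetSum]
    · simp_rw [integral_rename_mul_gaussianEigenDensity]
      simp [Fintype.card_perm]
    · intro e _
      have h2 := integrable_eval_of_exp hexpV (MvPolynomial.rename e p)
      rw [integrable_withDensity_iff_integrable_smul' hmeas
        (Eventually.of_forall fun _ => ENNReal.ofReal_lt_top)] at h2
      refine h2.congr (Eventually.of_forall fun x => ?_)
      simp only []
      rw [ENNReal.toReal_ofReal (gaussianEigenDensity_nonneg x), Complex.real_smul, mul_comm]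
  rw [hV1, hsum] at h
  rw [Complex.real_smul, mul_comm, h, Complex.real_smul]
  have hc : (fun x : Fin n → ℝ => (ENNReal.ofReal (gaussianEigenDensity x)).toReal •
      MvPolynomial.eval (fun i => (x i : ℂ)) p) = fun x =>
      MvPolynomial.eval (fun i => (x i : ℂ)) p * (gaussianEigenDensity x : ℂ) := by
    funext x
    rw [ENNReal.toReal_ofReal (gaussianEigenDensity_nonneg x), Complex.real_smul, mul_comm]
  rw [hc]
  push_cast
  ring

/-- **Weyl integration formula** for symmetric functions of the eigenvalues. -/
theorem exists_weyl_constant (n : ℕ) : ∃ K : ℝ≥0∞, K ≠ 0 ∧ K ≠ ∞ ∧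
    ∀ F : (Fin n → ℝ) → ℝ≥0∞, Measurable F → (∀ x (e : Equiv.Perm (Fin n)), F (x ∘ e) = F x) →
      ∫⁻ M, F (hermEigenvalue M) ∂hermLebesgue n =
        K * ∫⁻ x, F x * ENNReal.ofReal (vandermondeSq x) := by
  have hpos := integral_gaussianEigenDensity_pos (n := n)
  have hposM := integral_gaussWeight_pos (entryRate_pos n)
  set zV := ∫ x : Fin n → ℝ, gaussianEigenDensity x
  set zM := ∫ t, gaussWeight (entryRate n) t
  refine ⟨ENNReal.ofReal (zM / zV), ?_, ENNReal.ofReal_ne_top, fun F hF hsym => ?_⟩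
  · rw [Ne, ENNReal.ofReal_eq_zero, not_le]; positivity
  set G : (Fin n → ℝ) → ℝ≥0∞ := fun x => F x * ENNReal.ofReal (Real.exp (∑ i, x i ^ 2 / 2)) with hG
  have hGm : Measurable G := by
    refine hF.mul (Measurable.ennreal_ofReal ?_)
    exact (by fun_prop : Continuous fun x : Fin n → ℝ => Real.exp (∑ i, x i ^ 2 / 2)).measurable
  have hmeas : Measurable fun x : Fin n → ℝ => ENNReal.ofReal (gaussianEigenDensity x) :=
    continuous_gaussianEigenDensity.measurable.ennreal_ofReal
  have hGs : ∀ x (e : Equiv.Perm (Fin n)), G (x ∘ e) = G x := by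
    intro x e
    simp only [hG, hsym, Function.comp_apply]
    rw [Equiv.sum_comp e fun i => x i ^ 2 / 2]
  have key := congrArg (fun μ : Measure (Fin n → ℝ) => ∫⁻ x, G x ∂μ) (symmetrizedEigenLaw_eq (n := n))
  simp only [lintegral_smul_measure, smul_eq_mul] at key
  have hM : ∫⁻ x, G x ∂symmetrizedEigenLaw n =
      n.factorial * ∫⁻ M, F (hermEigenvalue M) ∂hermLebesgue n := by
    rw [symmetrizedEigenLaw, lintegral_finsetSum_measure]
    have h1 : ∀ e : Equiv.Perm (Fin n),
        ∫⁻ x, G x ∂(((volume : Measure (Fin n × Fin n → ℝ)).withDensity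
          fun t => ENNReal.ofReal (gaussWeight (entryRate n) t)).map
            fun t => pairEigenvalues t ∘ e) = ∫⁻ M, F (hermEigenvalue M) ∂hermLebesgue n := by
      intro e
      rw [lintegral_map hGm (measurable_pairEigenvalues_comp e)]
      simp_rw [hGs]
      rw [lintegral_withDensity_eq_lintegral_mul _ (measurable_ofReal_gaussWeight _)
        (g := fun t => G (pairEigenvalues t)) (hGm.comp measurable_pairEigenvalues),
        hermLebesgue_eq_map, lintegral_map (f := fun M => F (hermEigenvalue M))
          (hF.comp (measurable_pi_lambda _ measurable_hermEigenvalue))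
          measurable_hermOfPairs]
      congr 1; funext t
      simp only [Pi.mul_apply, hG]
      rw [gaussWeight_entryRate, mul_left_comm, ← ENNReal.ofReal_mul (Real.exp_pos _).le,
        ← Real.exp_add, neg_add_cancel, Real.exp_zero, ENNReal.ofReal_one, mul_one]
      rfl
    simp_rw [h1]
    simp [Fintype.card_perm]
  have hV : ∫⁻ x, G x ∂((volume : Measure (Fin n → ℝ)).withDensity
      fun x => ENNReal.ofReal (gaussianEigenDensity x)) =
      ∫⁻ x, F x * ENNReal.ofReal (vandermondeSq x) := by
    rw [lintegral_withDensity_eq_lintegral_mul _ hmeas hGm]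
    congr 1; funext x
    simp only [Pi.mul_apply, hG, gaussianEigenDensity]
    rw [mul_left_comm, ← ENNReal.ofReal_mul
      (mul_nonneg (vandermondeSq_nonneg x) (gaussWeight_pos _ x).le), mul_assoc, gaussWeight,
      ← Real.exp_add, ← Finset.sum_add_distrib]
    congr 2
    rw [Finset.sum_eq_zero fun i _ => by ring, Real.exp_zero, mul_one]
  rw [hM, hV, ENNReal.ofReal_mul (by positivity), ENNReal.ofReal_natCast] at key
  have hn0 : (n.factorial : ℝ≥0∞) ≠ 0 := by exact_mod_cast n.factorial_ne_zero
  have hn1 : (n.factorial : ℝ≥0∞) ≠ ∞ := ENNReal.natCast_ne_top _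
  rw [mul_left_comm, mul_assoc, ENNReal.mul_right_inj hn0 hn1] at key
  rw [ENNReal.ofReal_div_of_pos hpos, ENNReal.div_eq_inv_mul, mul_assoc, ← key, ← mul_assoc,
    ENNReal.inv_mul_cancel, one_mul]
  · rw [Ne, ENNReal.ofReal_eq_zero, not_le]; exact hpos
  · exact ENNReal.ofReal_ne_top

end WeylFormula

/-! ### Product expectations as Hankel determinants -/

/-- **Andréief's identity**: the integral of a squared determinant of functions of one variable
is a determinant of integrals. -/
theorem integral_prod_mul_det_sq {n : ℕ} (w : ℝ → ℝ) (φ : Fin n → ℝ → ℝ)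
    (h : ∀ i j, Integrable fun x => φ i x * φ j x * w x) :
    Integrable (fun x : Fin n → ℝ =>
      (∏ i, w (x i)) * (Matrix.of fun i j => φ j (x i)).det ^ 2) ∧
    ∫ x : Fin n → ℝ, (∏ i, w (x i)) * (Matrix.of fun i j => φ j (x i)).det ^ 2 =
      n.factorial * (Matrix.of fun i j => ∫ x, φ i x * φ j x * w x).det := by
  have hexp : ∀ x : Fin n → ℝ, (∏ i, w (x i)) * (Matrix.of fun i j => φ j (x i)).det ^ 2 =
      ∑ σ : Equiv.Perm (Fin n), ∑ τ : Equiv.Perm (Fin n),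
        ((Equiv.Perm.sign σ : ℤ) : ℝ) * ((Equiv.Perm.sign τ : ℤ) : ℝ) *
          ∏ i, (φ (σ i) (x i) * φ (τ i) (x i) * w (x i)) := by
    intro x
    rw [← Matrix.det_transpose, Matrix.det_apply', pow_two, Finset.sum_mul_sum, Finset.mul_sum]
    refine Finset.sum_congr rfl fun σ _ => ?_
    rw [Finset.mul_sum]
    refine Finset.sum_congr rfl fun τ _ => ?_
    simp only [Matrix.transpose_apply, Matrix.of_apply, Finset.prod_mul_distrib]
    ring
  have hint : ∀ σ τ : Equiv.Perm (Fin n), Integrable fun x : Fin n → ℝ =>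
      ((Equiv.Perm.sign σ : ℤ) : ℝ) * ((Equiv.Perm.sign τ : ℤ) : ℝ) *
        ∏ i, (φ (σ i) (x i) * φ (τ i) (x i) * w (x i)) := fun σ τ =>
    (Integrable.fintype_prod (f := fun i x => φ (σ i) x * φ (τ i) x * w x)
      fun i => h (σ i) (τ i)).const_mul _
  simp_rw [hexp]
  refine ⟨integrable_finsetSum _ fun σ _ => integrable_finsetSum _ fun τ _ => hint σ τ, ?_⟩
  rw [integral_finsetSum _ fun σ _ => integrable_finsetSum _ fun τ _ => hint σ τ]
  set A : Matrix (Fin n) (Fin n) ℝ := Matrix.of fun i j => ∫ x, φ i x * φ j x * w x with hA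
  have hσ : ∀ σ : Equiv.Perm (Fin n), ∫ x : Fin n → ℝ, ∑ τ : Equiv.Perm (Fin n),
        ((Equiv.Perm.sign σ : ℤ) : ℝ) * ((Equiv.Perm.sign τ : ℤ) : ℝ) *
          ∏ i, (φ (σ i) (x i) * φ (τ i) (x i) * w (x i)) = A.det := by
    intro σ
    rw [integral_finsetSum _ fun τ _ => hint σ τ]
    have h1 : ∀ τ : Equiv.Perm (Fin n), ∫ x : Fin n → ℝ,
        ((Equiv.Perm.sign σ : ℤ) : ℝ) * ((Equiv.Perm.sign τ : ℤ) : ℝ) *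
          ∏ i, (φ (σ i) (x i) * φ (τ i) (x i) * w (x i)) =
        ((Equiv.Perm.sign σ : ℤ) : ℝ) * (((Equiv.Perm.sign τ : ℤ) : ℝ) * ∏ i, A (σ i) (τ i)) := by
      intro τ
      rw [integral_const_mul, mul_assoc, integral_fintype_prod_volume_eq_prod
        (fun i x => φ (σ i) x * φ (τ i) x * w x)]
      rfl
    simp_rw [h1]
    rw [← Finset.mul_sum]
    have h2 : ∑ τ : Equiv.Perm (Fin n), ((Equiv.Perm.sign τ : ℤ) : ℝ) * ∏ i, A (σ i) (τ i) =
        (A.submatrix σ id).det := by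
      rw [← Matrix.det_transpose, Matrix.det_apply']
      rfl
    rw [h2, Matrix.det_permute, ← mul_assoc]
    have : ((Equiv.Perm.sign σ : ℤ) : ℝ) * ((Equiv.Perm.sign σ : ℤ) : ℝ) = 1 := by
      rcases Int.units_eq_one_or (Equiv.Perm.sign σ) with h | h <;> simp [h]
    rw [this, one_mul]
  simp_rw [hσ]
  simp [Fintype.card_perm]

/-- Integration against the rescaled Jacobi weight `y ^ b * (1 - y / X) ^ a` on `[0, X]`. -/
noncomputable def jacobiFunctional (a : ℝ) (b : ℕ) (X : ℝ) (g : ℝ → ℝ) : ℝ :=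
  ∫ y in (0 : ℝ)..X, y ^ b * (1 - y / X) ^ a * g y

/-- The `n × n` Hankel matrix of the rescaled Jacobi weight multiplied by `f`. -/
noncomputable def jacobiHankel (n : ℕ) (a : ℝ) (b : ℕ) (X : ℝ) (f : ℝ → ℝ) :
    Matrix (Fin n) (Fin n) ℝ :=
  Matrix.of fun i j => jacobiFunctional a b X fun y => y ^ (i + j : ℕ) * f y

/-- The one-variable Jacobi weight `(1 - x) ^ a * (1 + x) ^ b` on `[-1, 1]`, multiplied by a test
function of the rescaled variable `(x + 1) * N`. -/
noncomputable def jacobiDensity (a : ℝ) (b : ℕ) (N : ℝ) (f : ℝ → ℝ) (x : ℝ) : ℝ :=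
  (Set.Icc (-1 : ℝ) 1).indicator (fun x => (1 - x) ^ a * (1 + x) ^ b * f ((x + 1) * N)) x

theorem jacobiDensity_nonneg {a : ℝ} {b : ℕ} {N : ℝ} {f : ℝ → ℝ} (hf : ∀ y, 0 ≤ f y) (x : ℝ) :
    0 ≤ jacobiDensity a b N f x := by
  refine Set.indicator_nonneg (fun x hx => ?_) x
  have h1 : 0 ≤ 1 - x := by linarith [hx.2]
  have h2 : 0 ≤ 1 + x := by linarith [hx.1]
  exact mul_nonneg (mul_nonneg (Real.rpow_nonneg h1 _) (pow_nonneg h2 _)) (hf _)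

theorem continuous_jacobiDensity_aux {a : ℝ} (ha : 0 ≤ a) (b : ℕ) (N : ℝ) {f : ℝ → ℝ}
    (hf : Continuous f) : Continuous fun x : ℝ => (1 - x) ^ a * (1 + x) ^ b * f ((x + 1) * N) := by
  have h : Continuous fun x : ℝ => (1 - x) ^ a :=
    (continuous_const.sub continuous_id).rpow_const fun x => Or.inr ha
  fun_prop

theorem measurable_jacobiDensity {a : ℝ} (ha : 0 ≤ a) (b : ℕ) (N : ℝ) {f : ℝ → ℝ}
    (hf : Continuous f) : Measurable (jacobiDensity a b N f) :=
  (continuous_jacobiDensity_aux ha b N hf).measurable.indicator measurableSet_Icc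

theorem integrable_pow_mul_jacobiDensity {a : ℝ} (ha : 0 ≤ a) (b : ℕ) (N : ℝ) {f : ℝ → ℝ}
    (hf : Continuous f) {φ : ℝ → ℝ} (hφ : Continuous φ) :
    Integrable fun x => φ x * jacobiDensity a b N f x := by
  have h : (fun x => φ x * jacobiDensity a b N f x) = (Set.Icc (-1 : ℝ) 1).indicator
      fun x => φ x * ((1 - x) ^ a * (1 + x) ^ b * f ((x + 1) * N)) := by
    funext x
    simp only [jacobiDensity, Set.indicator_apply]
    split_ifs <;> simp
  rw [h, integrable_indicator_iff measurableSet_Icc]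
  exact (hφ.mul (continuous_jacobiDensity_aux ha b N hf)).continuousOn.integrableOn_Icc

theorem integral_pow_mul_jacobiDensity {a : ℝ} (b : ℕ) {N : ℝ} (hN : 0 < N) (f : ℝ → ℝ)
    (k : ℕ) :
    ∫ x, ((x + 1) * N) ^ k * jacobiDensity a b N f x =
      (2 ^ a / N ^ (b + 1)) * jacobiFunctional a b (2 * N) fun y => y ^ k * f y := by
  have h : (fun x => ((x + 1) * N) ^ k * jacobiDensity a b N f x) =
      (Set.Icc (-1 : ℝ) 1).indicator
        fun x => ((x + 1) * N) ^ k * ((1 - x) ^ a * (1 + x) ^ b * f ((x + 1) * N)) := by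
    funext x
    simp only [jacobiDensity, Set.indicator_apply]
    split_ifs <;> simp
  rw [h, integral_indicator measurableSet_Icc, integral_Icc_eq_integral_Ioc,
    ← intervalIntegral.integral_of_le (by norm_num), jacobiFunctional,
    ← intervalIntegral.integral_const_mul]
  have hsub := intervalIntegral.integral_comp_mul_add (a := -1) (b := 1)
    (fun y => 2 ^ a / N ^ (b + 1) * (y ^ b * (1 - y / (2 * N)) ^ a * (y ^ k * f y))) hN.ne' N
  rw [show N * -1 + N = 0 by ring, show N * 1 + N = 2 * N by ring, smul_eq_mul] at hsub
  rw [← mul_inv_cancel_left₀ hN.ne' (∫ y in (0 : ℝ)..2 * N, _), ← hsub,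
    ← intervalIntegral.integral_const_mul]
  refine intervalIntegral.integral_congr fun x hx => ?_
  rw [Set.uIcc_of_le (by norm_num)] at hx
  have h1 : 1 - (N * x + N) / (2 * N) = (1 - x) / 2 := by field_simp; ring
  have h2 : (x + 1) * N = N * x + N := by ring
  rw [h1, h2, Real.div_rpow (by linarith [hx.2]) (by norm_num),
    show N * x + N = N * (1 + x) by ring, mul_pow N, pow_succ]
  have h3 : (2 : ℝ) ^ a ≠ 0 := (Real.rpow_pos_of_pos two_pos a).ne'
  field_simp
  rw [mul_pow]
  ring

/-- An affine change of variables multiplies the squared Vandermonde determinant by a constant. -/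
theorem vandermondeSq_affine {n : ℕ} (N : ℝ) : ∃ κ : ℝ, (0 < N → 0 < κ) ∧
    ∀ x : Fin n → ℝ, (Matrix.of fun i j : Fin n => ((x i + 1) * N) ^ (j : ℕ)).det ^ 2 =
      κ * vandermondeSq x := by
  refine ⟨(∏ i : Fin n, ∏ _j ∈ Finset.Ioi i, N) ^ 2, fun hN => ?_, fun x => ?_⟩
  · exact pow_pos (Finset.prod_pos fun i _ => Finset.prod_pos fun j _ => hN) 2
  · have h : (Matrix.of fun i j : Fin n => ((x i + 1) * N) ^ (j : ℕ)) =
        Matrix.vandermonde fun i => (x i + 1) * N := rfl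
    rw [h, Matrix.det_vandermonde, vandermondeSq, Matrix.det_vandermonde, ← mul_pow,
      ← Finset.prod_mul_distrib]
    congr 1
    refine Finset.prod_congr rfl fun i _ => ?_
    rw [← Finset.prod_mul_distrib]
    exact Finset.prod_congr rfl fun j _ => by ring

/-- The unnormalized expectation of a product over the eigenvalues is a Hankel determinant, with a
constant that does not depend on the test function. -/
theorem exists_lintegral_prod_eq_det (n : ℕ) {a : ℝ} (ha : 0 ≤ a) (b : ℕ) {N : ℝ} (hN : 0 < N) :
    ∃ K : ℝ≥0∞, K ≠ 0 ∧ K ≠ ∞ ∧ ∀ f : ℝ → ℝ, Continuous f → (∀ y, 0 ≤ f y) →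
      ∫⁻ M, (∏ i, ENNReal.ofReal (f ((hermEigenvalue M i + 1) * N))) * jacobiWeight n a b M
          ∂hermLebesgue n = K * ENNReal.ofReal (jacobiHankel n a b (2 * N) f).det ∧
      0 ≤ (jacobiHankel n a b (2 * N) f).det := by
  obtain ⟨Kw, hKw0, hKw1, hweyl⟩ := exists_weyl_constant n
  obtain ⟨κ, hκ, hvan⟩ := vandermondeSq_affine (n := n) N
  have hκ := hκ hN
  set c : ℝ := 2 ^ a / N ^ (b + 1) with hc
  have hc0 : 0 < c := div_pos (Real.rpow_pos_of_pos two_pos a) (by positivity)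
  have hr : 0 < n.factorial * c ^ n / κ := by positivity
  refine ⟨Kw * ENNReal.ofReal (n.factorial * c ^ n / κ), ?_, ?_, fun f hf hf0 => ?_⟩
  · refine mul_ne_zero hKw0 ?_
    rwa [Ne, ENNReal.ofReal_eq_zero, not_le]
  · exact ENNReal.mul_ne_top hKw1 ENNReal.ofReal_ne_top
  set F : (Fin n → ℝ) → ℝ≥0∞ := fun x => ∏ i, ENNReal.ofReal (jacobiDensity a b N f (x i)) with hF
  have hFm : Measurable F := Finset.measurable_fun_prod _ fun i _ =>
    ((measurable_jacobiDensity ha b N hf).comp (measurable_pi_apply i)).ennreal_ofReal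
  have hFs : ∀ x (e : Equiv.Perm (Fin n)), F (x ∘ e) = F x := fun x e =>
    Equiv.prod_comp e fun i => ENNReal.ofReal (jacobiDensity a b N f (x i))
  have hFM : ∀ M : HermMatrix n, (∏ i, ENNReal.ofReal (f ((hermEigenvalue M i + 1) * N))) *
      jacobiWeight n a b M = F (hermEigenvalue M) := by
    intro M
    rw [jacobiWeight_eq, ← Finset.prod_mul_distrib]
    refine Finset.prod_congr rfl fun i _ => ?_
    simp only [jacobiDensity, Set.indicator_apply, Set.mem_Icc]
    split_ifs with h
    · rw [← ENNReal.ofReal_mul (hf0 _), Real.rpow_natCast, mul_comm]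
    · simp
  have hdet : ∀ x : Fin n → ℝ, (∏ i, jacobiDensity a b N f (x i)) * vandermondeSq x =
      κ⁻¹ * ((∏ i, jacobiDensity a b N f (x i)) *
        (Matrix.of fun i j : Fin n => ((x i + 1) * N) ^ (j : ℕ)).det ^ 2) := by
    intro x
    rw [hvan]
    field_simp
  have hand := integral_prod_mul_det_sq (n := n) (jacobiDensity a b N f)
    (fun j x => ((x + 1) * N) ^ (j : ℕ)) fun i j =>
      integrable_pow_mul_jacobiDensity ha b N hf (by fun_prop)
  have hval : ∫ x : Fin n → ℝ, (∏ i, jacobiDensity a b N f (x i)) * vandermondeSq x =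
      n.factorial * c ^ n / κ * (jacobiHankel n a b (2 * N) f).det := by
    simp_rw [hdet]
    rw [integral_const_mul, hand.2]
    have hmat : (Matrix.of fun i j : Fin n => ∫ x, ((x + 1) * N) ^ (i : ℕ) *
        ((x + 1) * N) ^ (j : ℕ) * jacobiDensity a b N f x) = c • jacobiHankel n a b (2 * N) f := by
      ext i j
      simp_rw [Matrix.of_apply, ← pow_add]
      rw [integral_pow_mul_jacobiDensity b hN f]
      rfl
    rw [hmat, Matrix.det_smul, Fintype.card_fin]
    field_simp
  have hnn : ∀ x : Fin n → ℝ, 0 ≤ (∏ i, jacobiDensity a b N f (x i)) * vandermondeSq x := fun x =>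
    mul_nonneg (Finset.prod_nonneg fun i _ => jacobiDensity_nonneg hf0 _) (vandermondeSq_nonneg x)
  have hint : Integrable fun x : Fin n → ℝ =>
      (∏ i, jacobiDensity a b N f (x i)) * vandermondeSq x := by
    simp_rw [hdet]
    exact hand.1.const_mul _
  have hdet0 : 0 ≤ (jacobiHankel n a b (2 * N) f).det := by
    have := hval ▸ integral_nonneg hnn
    exact nonneg_of_mul_nonneg_right this hr
  refine ⟨?_, hdet0⟩
  simp_rw [hFM]
  rw [hweyl F hFm hFs, mul_assoc, ← ENNReal.ofReal_mul hr.le, ← hval,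
    ofReal_integral_eq_lintegral_ofReal hint (Eventually.of_forall hnn)]
  congr 1
  refine lintegral_congr fun x => ?_
  rw [hF, ENNReal.ofReal_mul (Finset.prod_nonneg fun i _ => jacobiDensity_nonneg hf0 _),
    ENNReal.ofReal_prod_of_nonneg fun i _ => jacobiDensity_nonneg hf0 _]

theorem measurable_jacobiWeight (n : ℕ) {a : ℝ} (ha : 0 ≤ a) (b : ℕ) :
    Measurable (jacobiWeight n a b) := by
  have h : jacobiWeight n a b = fun M : HermMatrix n =>
      ∏ i, ENNReal.ofReal (jacobiDensity a b 1 (fun _ => 1) (hermEigenvalue M i)) := by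
    funext M
    rw [jacobiWeight_eq]
    refine Finset.prod_congr rfl fun i _ => ?_
    simp only [jacobiDensity, Set.indicator_apply, Set.mem_Icc]
    split_ifs
    · rw [Real.rpow_natCast, mul_one]
    · simp
  rw [h]
  exact Finset.measurable_fun_prod _ fun i _ =>
    ((measurable_jacobiDensity ha b 1 continuous_const).comp
      (measurable_hermEigenvalue i)).ennreal_ofReal

/-- The expectation of a product over the rescaled eigenvalues of the Jacobi ensemble is a ratio of
Hankel determinants. -/
theorem integral_prod_jacobiUnitaryEnsemble (n : ℕ) {a : ℝ} (ha : 0 ≤ a) (b : ℕ) {N : ℝ}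
    (hN : 0 < N) [hP : IsProbabilityMeasure (jacobiUnitaryEnsemble n a b)] :
    0 < (jacobiHankel n a b (2 * N) fun _ => 1).det ∧
    ∀ f : ℝ → ℝ, Continuous f → (∀ y, 0 ≤ f y) →
      ∫ M, ∏ i, f ((hermEigenvalue M i + 1) * N) ∂jacobiUnitaryEnsemble n a b =
        (jacobiHankel n a b (2 * N) f).det / (jacobiHankel n a b (2 * N) fun _ => 1).det := by
  obtain ⟨K, hK0, hK1, hK⟩ := exists_lintegral_prod_eq_det n ha b hN
  have hone := hK (fun _ => 1) continuous_const fun _ => zero_le_one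
  simp only [ENNReal.ofReal_one, Finset.prod_const_one, one_mul] at hone
  have hW := measurable_jacobiWeight n ha b
  have hZ : ∫⁻ M, jacobiWeight n a b M ∂hermLebesgue n ≠ 0 := by
    intro h0
    have h1 : (hermLebesgue n).withDensity (jacobiWeight n a b) = 0 := by
      rw [withDensity_eq_zero_iff hW.aemeasurable]
      exact (lintegral_eq_zero_iff hW).1 h0
    have h2 : jacobiUnitaryEnsemble n a b = 0 := by rw [jacobiUnitaryEnsemble, h1, smul_zero]
    exact IsProbabilityMeasure.ne_zero _ h2
  have hpos : 0 < (jacobiHankel n a b (2 * N) fun _ => 1).det := by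
    refine lt_of_le_of_ne hone.2 fun h0 => hZ ?_
    rw [hone.1, ← h0]; simp
  refine ⟨hpos, fun f hf hf0 => ?_⟩
  have hfK := hK f hf hf0
  have hnn : ∀ M : HermMatrix n, 0 ≤ ∏ i, f ((hermEigenvalue M i + 1) * N) := fun M =>
    Finset.prod_nonneg fun i _ => hf0 _
  have hmf : Measurable fun M : HermMatrix n => ∏ i, f ((hermEigenvalue M i + 1) * N) :=
    Finset.measurable_fun_prod _ fun i _ => hf.measurable.comp
      (((measurable_hermEigenvalue i).add_const 1).mul_const N)
  rw [integral_eq_lintegral_of_nonneg_ae (Eventually.of_forall hnn) hmf.aestronglyMeasurable,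
    jacobiUnitaryEnsemble, lintegral_smul_measure,
    lintegral_withDensity_eq_lintegral_mul _ hW hmf.ennreal_ofReal]
  have h3 : ∫⁻ M, (jacobiWeight n a b * fun M : HermMatrix n => ENNReal.ofReal
      (∏ i, f ((hermEigenvalue M i + 1) * N)) : HermMatrix n → ℝ≥0∞) M ∂hermLebesgue n =
      K * ENNReal.ofReal (jacobiHankel n a b (2 * N) f).det := by
    rw [← hfK.1]
    refine lintegral_congr fun M => ?_
    rw [Pi.mul_apply, ENNReal.ofReal_prod_of_nonneg fun i _ => hf0 _, mul_comm]
  rw [h3, hone.1, smul_eq_mul, ENNReal.toReal_mul, ENNReal.toReal_inv, ENNReal.toReal_mul,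
    ENNReal.toReal_mul, ENNReal.toReal_ofReal hfK.2, ENNReal.toReal_ofReal hpos.le]
  have hKr : K.toReal ≠ 0 := ENNReal.toReal_ne_zero.2 ⟨hK0, hK1⟩
  field_simp

/-! ### Jacobi polynomials -/

section Functional

variable {a X : ℝ}

theorem continuous_jacobiFunctional_weight (ha : 0 ≤ a) (b : ℕ) (X : ℝ) :
    Continuous fun y : ℝ => y ^ b * (1 - y / X) ^ a := by
  have h : Continuous fun y : ℝ => (1 - y / X) ^ a :=
    (continuous_const.sub (continuous_id.div_const X)).rpow_const fun x => Or.inr ha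
  fun_prop

theorem intervalIntegrable_jacobiFunctional (ha : 0 ≤ a) (b : ℕ) (X : ℝ) {g : ℝ → ℝ}
    (hg : Continuous g) :
    IntervalIntegrable (fun y => y ^ b * (1 - y / X) ^ a * g y) volume 0 X :=
  ((continuous_jacobiFunctional_weight ha b X).mul hg).intervalIntegrable _ _

theorem jacobiFunctional_const_mul (b : ℕ) (c : ℝ) (g : ℝ → ℝ) :
    jacobiFunctional a b X (fun y => c * g y) = c * jacobiFunctional a b X g := by
  rw [jacobiFunctional, jacobiFunctional, ← intervalIntegral.integral_const_mul]
  exact intervalIntegral.integral_congr fun y _ => by ring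

theorem jacobiFunctional_add (ha : 0 ≤ a) (b : ℕ) {g h : ℝ → ℝ} (hg : Continuous g)
    (hh : Continuous h) :
    jacobiFunctional a b X (fun y => g y + h y) =
      jacobiFunctional a b X g + jacobiFunctional a b X h := by
  rw [jacobiFunctional, jacobiFunctional, jacobiFunctional,
    ← intervalIntegral.integral_add (intervalIntegrable_jacobiFunctional ha b X hg)
      (intervalIntegrable_jacobiFunctional ha b X hh)]
  exact intervalIntegral.integral_congr fun y _ => by ring

theorem jacobiFunctional_sum (ha : 0 ≤ a) (b : ℕ) {ι : Type*} (s : Finset ι) {g : ι → ℝ → ℝ}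
    (hg : ∀ i ∈ s, Continuous (g i)) :
    jacobiFunctional a b X (fun y => ∑ i ∈ s, g i y) = ∑ i ∈ s, jacobiFunctional a b X (g i) := by
  simp only [jacobiFunctional]
  rw [← intervalIntegral.integral_finsetSum fun i hi =>
    intervalIntegrable_jacobiFunctional ha b X (hg i hi)]
  exact intervalIntegral.integral_congr fun y _ => by simp [Finset.mul_sum]

theorem jacobiFunctional_weight_nonneg (b : ℕ) (hX : 0 < X) {y : ℝ} (hy : y ∈ Set.Icc 0 X) :
    0 ≤ y ^ b * (1 - y / X) ^ a := by
  have h : y / X ≤ 1 := (div_le_one hX).2 hy.2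
  exact mul_nonneg (pow_nonneg hy.1 _) (Real.rpow_nonneg (by linarith) _)

theorem jacobiFunctional_nonneg (b : ℕ) (hX : 0 < X) {g : ℝ → ℝ}
    (hg : ∀ y ∈ Set.Icc 0 X, 0 ≤ g y) : 0 ≤ jacobiFunctional a b X g :=
  intervalIntegral.integral_nonneg hX.le fun y hy =>
    mul_nonneg (jacobiFunctional_weight_nonneg b hX hy) (hg y hy)

end Functional

/-- The moments of `(1 - y / X) ^ a` on `[0, X]`. -/
noncomputable def jacobiMoment (a X : ℝ) (s : ℕ) : ℝ := ∫ y in (0 : ℝ)..X, y ^ s * (1 - y / X) ^ a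

theorem jacobiFunctional_pow (a : ℝ) (b : ℕ) (X : ℝ) (k : ℕ) :
    jacobiFunctional a b X (fun y => y ^ k) = jacobiMoment a X (k + b) := by
  rw [jacobiFunctional, jacobiMoment]
  exact intervalIntegral.integral_congr fun y _ => by ring

section Moments

variable {a X : ℝ}

/-- Integration by parts, in the form `∫ (y ^ (s + 1) * (1 - y / X) ^ (a + 1))' = 0`. -/
theorem jacobiMoment_add_one_mul (ha : 0 ≤ a) (hX : 0 < X) (s : ℕ) :
    jacobiMoment (a + 1) X s * (s + 1) = (a + 1) / X * jacobiMoment a X (s + 1) := by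
  have hd : ∀ y ∈ Set.uIcc 0 X, HasDerivAt (fun y : ℝ => y ^ (s + 1) * (1 - y / X) ^ (a + 1))
      (((s + 1 : ℕ) : ℝ) * y ^ s * (1 - y / X) ^ (a + 1) +
        y ^ (s + 1) * (-(1 / X) * (a + 1) * (1 - y / X) ^ a)) y := by
    intro y _
    have h1 : HasDerivAt (fun y : ℝ => 1 - y / X) (-(1 / X)) y := by
      simpa using ((hasDerivAt_id y).div_const X).const_sub 1
    have h2 := h1.rpow_const (p := a + 1) (Or.inr (by linarith))
    rw [add_sub_cancel_right] at h2
    exact (hasDerivAt_pow (s + 1) y).mul h2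
  have hc : ∀ s : ℕ, ∀ a : ℝ, 0 ≤ a → Continuous fun y : ℝ => y ^ s * (1 - y / X) ^ a :=
    fun s a ha => continuous_jacobiFunctional_weight ha s X
  have hi := intervalIntegral.integral_eq_sub_of_hasDerivAt hd (by
    refine ContinuousOn.intervalIntegrable (Continuous.continuousOn ?_)
    have h1 := hc s (a + 1) (by linarith)
    have h2 := hc (s + 1) a ha
    have h3 := (h1.const_mul ((s + 1 : ℕ) : ℝ)).add (h2.const_mul (-(1 / X) * (a + 1)))
    refine h3.congr fun y => ?_
    simp only [Pi.add_apply]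
    ring)
  rw [div_self hX.ne', sub_self, Real.zero_rpow (by linarith), mul_zero, pow_succ (0 : ℝ), mul_zero,
    zero_mul, sub_zero] at hi
  have hsplit : (∫ y in (0 : ℝ)..X, ((s + 1 : ℕ) : ℝ) * y ^ s * (1 - y / X) ^ (a + 1) +
        y ^ (s + 1) * (-(1 / X) * (a + 1) * (1 - y / X) ^ a)) =
      (s + 1) * jacobiMoment (a + 1) X s - (a + 1) / X * jacobiMoment a X (s + 1) := by
    rw [jacobiMoment, jacobiMoment, ← intervalIntegral.integral_const_mul,
      ← intervalIntegral.integral_const_mul, ← intervalIntegral.integral_sub]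
    · refine intervalIntegral.integral_congr fun y _ => ?_
      push_cast
      ring
    · exact ((hc s (a + 1) (by linarith)).const_mul _).intervalIntegrable _ _
    · exact ((hc (s + 1) a ha).const_mul _).intervalIntegrable _ _
  rw [hsplit] at hi
  linarith

theorem jacobiMoment_sub (ha : 0 ≤ a) (hX : 0 < X) (s : ℕ) :
    jacobiMoment a X s - jacobiMoment a X (s + 1) / X = jacobiMoment (a + 1) X s := by
  have hc := fun s : ℕ => (continuous_jacobiFunctional_weight ha s X).intervalIntegrable
    (μ := volume) 0 X
  simp only [jacobiMoment]
  rw [← intervalIntegral.integral_div, ← intervalIntegral.integral_sub (hc s) ((hc _).div_const _)]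
  refine intervalIntegral.integral_congr fun y hy => ?_
  rw [Set.uIcc_of_le hX.le] at hy
  have h : 0 ≤ 1 - y / X := by linarith [(div_le_one hX).2 hy.2]
  rw [Real.rpow_add_of_nonneg h ha zero_le_one, Real.rpow_one]
  ring

theorem jacobiMoment_succ (ha : 0 ≤ a) (hX : 0 < X) (s : ℕ) :
    jacobiMoment a X (s + 1) * (s + a + 2) = X * (s + 1) * jacobiMoment a X s := by
  have h1 := jacobiMoment_add_one_mul ha hX s
  rw [← jacobiMoment_sub ha hX s] at h1
  field_simp at h1
  linarith

theorem jacobiMoment_zero (ha : 0 ≤ a) (hX : 0 < X) : jacobiMoment a X 0 * (a + 1) = X := by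
  have hd : ∀ y ∈ Set.uIcc 0 X, HasDerivAt (fun y : ℝ => (1 - y / X) ^ (a + 1))
      (-(1 / X) * (a + 1) * (1 - y / X) ^ a) y := by
    intro y _
    have h1 : HasDerivAt (fun y : ℝ => 1 - y / X) (-(1 / X)) y := by
      simpa using ((hasDerivAt_id y).div_const X).const_sub 1
    have h2 := h1.rpow_const (p := a + 1) (Or.inr (by linarith))
    rwa [add_sub_cancel_right] at h2
  have hc : Continuous fun y : ℝ => (1 - y / X) ^ a :=
    (continuous_const.sub (continuous_id.div_const X)).rpow_const fun x => Or.inr ha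
  have hi := intervalIntegral.integral_eq_sub_of_hasDerivAt hd
    ((hc.const_mul _).intervalIntegrable _ _)
  rw [div_self hX.ne', sub_self, Real.zero_rpow (by linarith), zero_div, sub_zero, Real.one_rpow,
    intervalIntegral.integral_const_mul] at hi
  have hm : jacobiMoment a X 0 = ∫ y in (0 : ℝ)..X, (1 - y / X) ^ a := by simp [jacobiMoment]
  rw [← hm] at hi
  field_simp at hi
  linarith

end Moments

/-- The eigenvalues of the Jacobi differential operator of parameters `(a, b)`. -/
noncomputable def jacobiEig (a : ℝ) (b j : ℕ) : ℝ := j * (j + a + b + 1)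

/-- The coefficient of `y ^ k` in the Jacobi polynomial of degree `j` of the weight
`y ^ b * (1 - y / X) ^ a` on `[0, X]`, normalized by the value `1` at the origin. -/
noncomputable def jacobiCoeff (a : ℝ) (b : ℕ) (X : ℝ) (j k : ℕ) : ℝ :=
  ∏ i ∈ Finset.range k,
    (jacobiEig a b i - jacobiEig a b j) / (X * ((i : ℝ) + 1) * ((i : ℝ) + 1 + b))

/-- The Jacobi polynomial of degree `j` of the weight `y ^ b * (1 - y / X) ^ a` on `[0, X]`,
normalized by the value `1` at the origin. -/
noncomputable def jacobiPoly (a : ℝ) (b : ℕ) (X : ℝ) (j : ℕ) (y : ℝ) : ℝ :=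
  ∑ k ∈ Finset.range (j + 1), jacobiCoeff a b X j k * y ^ k

/-- The inverse of the squared norm of `jacobiPoly a b X j`. -/
noncomputable def jacobiInvNorm (a : ℝ) (b : ℕ) (X : ℝ) (j : ℕ) : ℝ :=
  (2 * j + a + b + 1) * (∏ i ∈ Finset.range b, (jacobiEig a b j + (i + 1) * (a + b - i))) /
    ((b.factorial : ℝ) ^ 2 * X ^ (b + 1))

section Polynomials

variable {a X : ℝ} {b : ℕ}

theorem jacobiEig_strictMono (ha : 0 ≤ a) (b : ℕ) : StrictMono (jacobiEig a b) := by
  refine strictMono_nat_of_lt_succ fun j => ?_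
  simp only [jacobiEig]
  push_cast
  nlinarith [(Nat.cast_nonneg j : (0 : ℝ) ≤ j), (Nat.cast_nonneg b : (0 : ℝ) ≤ b)]

theorem jacobiEig_nonneg (ha : 0 ≤ a) (b j : ℕ) : 0 ≤ jacobiEig a b j := by
  unfold jacobiEig; positivity

theorem jacobiCoeff_zero (a : ℝ) (b : ℕ) (X : ℝ) (j : ℕ) : jacobiCoeff a b X j 0 = 1 := by
  simp [jacobiCoeff]

theorem jacobiCoeff_eq_zero (a : ℝ) (b : ℕ) (X : ℝ) {j k : ℕ} (h : j < k) :
    jacobiCoeff a b X j k = 0 :=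
  Finset.prod_eq_zero (Finset.mem_range.2 h) (by simp)

theorem jacobiCoeff_succ (a : ℝ) (b : ℕ) (hX : 0 < X) (j k : ℕ) :
    jacobiCoeff a b X j (k + 1) * (X * ((k : ℝ) + 1) * ((k : ℝ) + 1 + b)) =
      jacobiCoeff a b X j k * (jacobiEig a b k - jacobiEig a b j) := by
  rw [jacobiCoeff, Finset.prod_range_succ, ← jacobiCoeff]
  field_simp

/-- The derivative of a Jacobi polynomial is a multiple of a Jacobi polynomial with both parameters
raised by one. -/
theorem jacobiCoeff_succ_succ (a : ℝ) (b : ℕ) (hX : 0 < X) (j k : ℕ) :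
    ((k : ℝ) + 1) * jacobiCoeff a b X (j + 1) (k + 1) =
      -(jacobiEig a b (j + 1) / (X * (b + 1))) * jacobiCoeff (a + 1) (b + 1) X j k := by
  induction k with
  | zero =>
    simp [jacobiCoeff, jacobiEig]
    field_simp
    ring
  | succ k ih =>
    have h1 := jacobiCoeff_succ a b hX (j + 1) (k + 1)
    have h2 := jacobiCoeff_succ (a + 1) (b + 1) hX j k
    have hpos : X * ((k : ℝ) + 1) * ((k : ℝ) + 1 + (b + 1 : ℕ)) ≠ 0 := by positivity
    have hth : jacobiEig a b (k + 1) - jacobiEig a b (j + 1) =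
        jacobiEig (a + 1) (b + 1) k - jacobiEig (a + 1) (b + 1) j := by
      simp only [jacobiEig]; push_cast; ring
    refine mul_right_cancel₀ hpos ?_
    rw [mul_assoc _ (jacobiCoeff (a + 1) (b + 1) X j (k + 1)), h2]
    push_cast at h1 ⊢
    linear_combination ((k : ℝ) + 1) * h1 +
      (jacobiEig a b (k + 1) - jacobiEig a b (j + 1)) * ih -
      jacobiEig a b (j + 1) / (X * (b + 1)) * jacobiCoeff (a + 1) (b + 1) X j k * hth

theorem continuous_jacobiPoly (a : ℝ) (b : ℕ) (X : ℝ) (j : ℕ) : Continuous (jacobiPoly a b X j) := by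
  unfold jacobiPoly; fun_prop

theorem jacobiPoly_eq_sum (a : ℝ) (b : ℕ) (X : ℝ) {j n : ℕ} (h : j < n) (y : ℝ) :
    jacobiPoly a b X j y = ∑ k ∈ Finset.range n, jacobiCoeff a b X j k * y ^ k := by
  rw [jacobiPoly]
  refine Finset.sum_subset (Finset.range_mono h) fun k _ hk => ?_
  rw [jacobiCoeff_eq_zero a b X (by simpa using hk), zero_mul]

theorem jacobiFunctional_poly_mul (ha : 0 ≤ a) {i j n : ℕ} (hi : i < n) (hj : j < n)
    {f : ℝ → ℝ} (hf : Continuous f) :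
    jacobiFunctional a b X (fun y => jacobiPoly a b X i y * jacobiPoly a b X j y * f y) =
      ∑ k ∈ Finset.range n, ∑ l ∈ Finset.range n, jacobiCoeff a b X i k * jacobiCoeff a b X j l *
        jacobiFunctional a b X (fun y => y ^ (k + l) * f y) := by
  have h : (fun y => jacobiPoly a b X i y * jacobiPoly a b X j y * f y) = fun y =>
      ∑ k ∈ Finset.range n, ∑ l ∈ Finset.range n,
        jacobiCoeff a b X i k * jacobiCoeff a b X j l * (y ^ (k + l) * f y) := by
    funext y
    rw [jacobiPoly_eq_sum a b X hi, jacobiPoly_eq_sum a b X hj, Finset.sum_mul_sum, Finset.sum_mul]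
    refine Finset.sum_congr rfl fun k _ => ?_
    rw [Finset.sum_mul]
    exact Finset.sum_congr rfl fun l _ => by ring
  rw [h, jacobiFunctional_sum ha b _ fun k _ => by fun_prop]
  refine Finset.sum_congr rfl fun k _ => ?_
  rw [jacobiFunctional_sum ha b _ fun l _ => by fun_prop]
  exact Finset.sum_congr rfl fun l _ => jacobiFunctional_const_mul b _ _

/-- The Dirichlet form of the Jacobi operator on monomials, `∫ (y ^ k)' (y ^ l)' y ^ (b + 1) *
(1 - y / X) ^ (a + 1)`, written through a moment of the original weight. The quotient by
`k + l + b` has the value `0` at `k = l = b = 0`, as the form has. -/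
noncomputable def jacobiEnergy (a : ℝ) (b : ℕ) (X : ℝ) (k l : ℕ) : ℝ :=
  k * l * ((a + 1) / (k + l + b) * jacobiMoment a X (k + l + b) / X)

theorem jacobiEnergy_comm (a : ℝ) (b : ℕ) (X : ℝ) (k l : ℕ) :
    jacobiEnergy a b X k l = jacobiEnergy a b X l k := by
  rw [jacobiEnergy, jacobiEnergy, add_comm k l, add_comm (k : ℝ) l, mul_comm (k : ℝ) l]

theorem jacobiEnergy_zero (a : ℝ) (b : ℕ) (X : ℝ) (l : ℕ) : jacobiEnergy a b X 0 l = 0 := by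
  simp [jacobiEnergy]

/-- Integration by parts: the Jacobi operator maps `y ^ (k + 1)` to a combination of `y ^ (k + 1)`
and `y ^ k`, with leading coefficient the eigenvalue of index `k + 1`. -/
theorem jacobiEnergy_succ (ha : 0 ≤ a) (b : ℕ) (hX : 0 < X) (k l : ℕ) :
    jacobiEnergy a b X (k + 1) l = jacobiEig a b (k + 1) / X * jacobiMoment a X (k + 1 + l + b) -
      ((k : ℝ) + 1) * (k + 1 + b) * jacobiMoment a X (k + l + b) := by
  have h := jacobiMoment_succ ha hX (k + l + b)
  have h2 : k + 1 + l + b = k + l + b + 1 := by ring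
  have h3 : ((k : ℝ) + 1 + l + b) ≠ 0 := by positivity
  rw [jacobiEnergy, h2, jacobiEig]
  push_cast at h ⊢
  have h4 : jacobiMoment a X (k + l + b) =
      jacobiMoment a X (k + l + b + 1) * (k + l + b + a + 2) / (X * ((k : ℝ) + 1 + l + b)) := by
    rw [h]
    field_simp
    ring
  rw [h4]
  field_simp
  ring

/-- The Dirichlet form is the inner product of the derivatives for the weight with both parameters
raised by one. -/
theorem jacobiEnergy_succ_succ (ha : 0 ≤ a) (b : ℕ) (hX : 0 < X) (k l : ℕ) :
    jacobiEnergy a b X (k + 1) (l + 1) =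
      ((k : ℝ) + 1) * (l + 1) * jacobiMoment (a + 1) X (k + l + (b + 1)) := by
  have h := jacobiMoment_add_one_mul ha hX (k + l + (b + 1))
  rw [jacobiEnergy, show k + 1 + (l + 1) + b = k + l + (b + 1) + 1 by ring]
  have h3 : ((k : ℝ) + 1 + (l + 1) + b) ≠ 0 := by positivity
  push_cast at h ⊢
  have h4 : jacobiMoment (a + 1) X (k + l + (b + 1)) = (a + 1) / X *
      jacobiMoment a X (k + l + (b + 1) + 1) / ((k : ℝ) + 1 + (l + 1) + b) := by
    rw [← h]
    field_simp
    ring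
  rw [h4]
  ring

/-- The Jacobi polynomials are eigenvectors of the Dirichlet form: the recursion of their
coefficients makes the sum telescope. -/
theorem sum_jacobiCoeff_mul_energy (ha : 0 ≤ a) (b : ℕ) (hX : 0 < X) {j n : ℕ} (hj : j < n)
    (l : ℕ) :
    ∑ k ∈ Finset.range n, jacobiCoeff a b X j k * jacobiEnergy a b X k l =
      jacobiEig a b j / X *
        ∑ k ∈ Finset.range n, jacobiCoeff a b X j k * jacobiMoment a X (k + l + b) := by
  obtain ⟨m, rfl⟩ : ∃ m, n = m + 1 := ⟨n - 1, by omega⟩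
  have hstep : ∀ k, jacobiCoeff a b X j (k + 1) * jacobiEnergy a b X (k + 1) l =
      jacobiEig a b (k + 1) / X * (jacobiCoeff a b X j (k + 1) *
        jacobiMoment a X (k + 1 + l + b)) -
      (jacobiEig a b k - jacobiEig a b j) / X *
        (jacobiCoeff a b X j k * jacobiMoment a X (k + l + b)) := by
    intro k
    have h1 : (jacobiEig a b k - jacobiEig a b j) / X * jacobiCoeff a b X j k =
        jacobiCoeff a b X j (k + 1) * (((k : ℝ) + 1) * ((k : ℝ) + 1 + b)) := by
      have := jacobiCoeff_succ a b hX j k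
      field_simp
      linarith
    rw [jacobiEnergy_succ ha b hX, ← mul_assoc ((jacobiEig a b k - _) / X), h1]
    ring
  rw [Finset.sum_range_succ' , jacobiEnergy_zero, mul_zero, add_zero]
  simp_rw [hstep]
  rw [Finset.sum_sub_distrib]
  set u : ℕ → ℝ := fun k => jacobiCoeff a b X j k * jacobiMoment a X (k + l + b) with hu
  have e1 : ∑ k ∈ Finset.range m, jacobiEig a b (k + 1) / X * u (k + 1) =
      ∑ k ∈ Finset.range (m + 1), jacobiEig a b k / X * u k := by
    rw [Finset.sum_range_succ']
    simp [jacobiEig]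
  have e2 : ∑ k ∈ Finset.range m, (jacobiEig a b k - jacobiEig a b j) / X * u k =
      ∑ k ∈ Finset.range (m + 1), (jacobiEig a b k - jacobiEig a b j) / X * u k := by
    rw [Finset.sum_range_succ]
    rcases Nat.lt_succ_iff_lt_or_eq.1 hj with h | h
    · simp [hu, jacobiCoeff_eq_zero a b X h]
    · simp [h]
  rw [e1, e2, ← Finset.sum_sub_distrib, Finset.mul_sum]
  exact Finset.sum_congr rfl fun k _ => by ring

theorem sum_sum_jacobiCoeff_mul_energy (ha : 0 ≤ a) (hX : 0 < X) {i j n : ℕ} (hi : i < n)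
    (hj : j < n) :
    ∑ k ∈ Finset.range n, ∑ l ∈ Finset.range n,
      jacobiCoeff a b X i k * jacobiCoeff a b X j l * jacobiEnergy a b X k l =
      jacobiEig a b i / X * jacobiFunctional a b X
        (fun y => jacobiPoly a b X i y * jacobiPoly a b X j y) := by
  have h := jacobiFunctional_poly_mul (b := b) (X := X) ha hi hj (f := fun _ => 1) continuous_const
  simp only [mul_one, jacobiFunctional_pow] at h
  rw [h, Finset.sum_comm, Finset.sum_comm (s := Finset.range n) (t := Finset.range n)
    (f := fun k l => jacobiCoeff a b X i k * jacobiCoeff a b X j l * jacobiMoment a X (k + l + b)),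
    Finset.mul_sum]
  refine Finset.sum_congr rfl fun l _ => ?_
  have := sum_jacobiCoeff_mul_energy ha b hX hi l
  calc _ = jacobiCoeff a b X j l * ∑ k ∈ Finset.range n, jacobiCoeff a b X i k *
        jacobiEnergy a b X k l := by
        rw [Finset.mul_sum]; exact Finset.sum_congr rfl fun k _ => by ring
    _ = _ := by
        rw [this, Finset.mul_sum, Finset.mul_sum, Finset.mul_sum]
        exact Finset.sum_congr rfl fun k _ => by ring

/-- Eigenvectors of the symmetric Dirichlet form with different eigenvalues are orthogonal. -/
theorem jacobiPoly_orthogonal (ha : 0 ≤ a) (hX : 0 < X) {i j : ℕ} (hij : i ≠ j) :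
    jacobiFunctional a b X (fun y => jacobiPoly a b X i y * jacobiPoly a b X j y) = 0 := by
  have hi : i < i + j + 1 := by omega
  have hj : j < i + j + 1 := by omega
  have h1 := sum_sum_jacobiCoeff_mul_energy (b := b) ha hX hi hj
  have h2 := sum_sum_jacobiCoeff_mul_energy (b := b) ha hX hj hi
  rw [Finset.sum_comm] at h2
  have h3 : (fun y => jacobiPoly a b X j y * jacobiPoly a b X i y) =
      fun y => jacobiPoly a b X i y * jacobiPoly a b X j y := by funext y; ring
  rw [h3] at h2
  have h4 : jacobiEig a b i / X * jacobiFunctional a b X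
        (fun y => jacobiPoly a b X i y * jacobiPoly a b X j y) = jacobiEig a b j / X *
      jacobiFunctional a b X (fun y => jacobiPoly a b X i y * jacobiPoly a b X j y) := by
    rw [← h1, ← h2]
    refine Finset.sum_congr rfl fun k _ => Finset.sum_congr rfl fun l _ => ?_
    rw [jacobiEnergy_comm]
    ring
  have h5 : jacobiEig a b i ≠ jacobiEig a b j := (jacobiEig_strictMono ha b).injective.ne hij
  rcases mul_eq_mul_right_iff.1 h4 with h | h
  · exact absurd ((div_left_inj' hX.ne').1 h) h5
  · exact h

theorem jacobiInvNorm_pos (ha : 0 ≤ a) (b : ℕ) (hX : 0 < X) (j : ℕ) : 0 < jacobiInvNorm a b X j := by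
  refine div_pos (mul_pos (by positivity) (Finset.prod_pos fun i hi => ?_)) (by positivity)
  have hi : (i : ℝ) + 1 ≤ b := by exact_mod_cast Finset.mem_range.1 hi
  have h0 := jacobiEig_nonneg ha b j
  have hi0 : (0 : ℝ) ≤ i := Nat.cast_nonneg i
  have : 0 < (i + 1 : ℝ) * (a + b - i) := mul_pos (by linarith) (by linarith)
  linarith

theorem jacobiMoment_mul_invNorm (ha : 0 ≤ a) (b : ℕ) (hX : 0 < X) :
    jacobiMoment a X b * jacobiInvNorm a b X 0 = 1 := by
  have h : jacobiMoment a X b * (∏ i ∈ Finset.range (b + 1), (a + 1 + i)) =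
      b.factorial * X ^ (b + 1) := by
    induction b with
    | zero => simpa using jacobiMoment_zero ha hX
    | succ b ih =>
      rw [Finset.prod_range_succ, Nat.factorial_succ, pow_succ]
      have h1 := jacobiMoment_succ ha hX b
      push_cast
      calc _ = (∏ i ∈ Finset.range (b + 1), (a + 1 + (i : ℝ))) *
            (jacobiMoment a X (b + 1) * (b + a + 2)) := by ring
        _ = (jacobiMoment a X b * (∏ i ∈ Finset.range (b + 1), (a + 1 + (i : ℝ)))) *
            (X * (b + 1)) := by rw [h1]; ring
        _ = _ := by rw [ih]; ring
  have h2 : ∏ i ∈ Finset.range b, (jacobiEig a b 0 + ((i : ℝ) + 1) * (a + b - i)) =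
      b.factorial * ∏ i ∈ Finset.range b, (a + 1 + (i : ℝ)) := by
    rw [← Finset.prod_range_reflect (fun i : ℕ => a + 1 + (i : ℝ)),
      ← Finset.prod_range_add_one_eq_factorial]
    push_cast
    rw [← Finset.prod_mul_distrib]
    refine Finset.prod_congr rfl fun i hi => ?_
    have hi := Finset.mem_range.1 hi
    rw [show b - 1 - i = b - (i + 1) by omega, Nat.cast_sub (by omega)]
    simp only [jacobiEig]
    push_cast
    ring
  rw [Finset.prod_range_succ] at h
  rw [jacobiInvNorm, h2, Nat.cast_zero]
  have hb : (b.factorial : ℝ) ≠ 0 := by positivity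
  field_simp
  linarith

/-- The derivative of the polynomial of degree `j + 1` is a multiple of the polynomial of degree `j`
for the weight with both parameters raised by one. Comparing Dirichlet form and inner product
reduces the norm to degree zero. -/
theorem jacobiPoly_norm (ha : 0 ≤ a) (hX : 0 < X) (j : ℕ) :
    jacobiFunctional a b X (fun y => jacobiPoly a b X j y * jacobiPoly a b X j y) *
      jacobiInvNorm a b X j = 1 := by
  induction j generalizing a b with
  | zero =>
    have h : (fun y => jacobiPoly a b X 0 y * jacobiPoly a b X 0 y) = fun y => y ^ 0 := by
      funext y; simp [jacobiPoly, jacobiCoeff]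
    rw [h, jacobiFunctional_pow, zero_add]
    exact jacobiMoment_mul_invNorm ha b hX
  | succ j ih =>
    have ih := ih (a := a + 1) (b := b + 1) (by linarith)
    have h1 := sum_sum_jacobiCoeff_mul_energy (b := b) ha hX (Nat.lt_succ_self (j + 1))
      (Nat.lt_succ_self (j + 1))
    have h2 := jacobiFunctional_poly_mul (a := a + 1) (b := b + 1) (X := X) (by linarith)
      (Nat.lt_succ_self j) (Nat.lt_succ_self j) (f := fun _ => 1) continuous_const
    simp only [mul_one, jacobiFunctional_pow] at h2
    set L := jacobiFunctional a b X
      (fun y => jacobiPoly a b X (j + 1) y * jacobiPoly a b X (j + 1) y) with hL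
    set L' := jacobiFunctional (a + 1) (b + 1) X
      (fun y => jacobiPoly (a + 1) (b + 1) X j y * jacobiPoly (a + 1) (b + 1) X j y) with hL'
    have hθ : 0 < jacobiEig a b (j + 1) := by unfold jacobiEig; positivity
    have h3 : jacobiEig a b (j + 1) / X * L =
        (jacobiEig a b (j + 1) / (X * (b + 1))) ^ 2 * L' := by
      rw [← h1, h2, Finset.sum_range_succ', Finset.mul_sum]
      simp only [jacobiEnergy_zero, mul_zero, Finset.sum_const_zero, add_zero]
      refine Finset.sum_congr rfl fun k _ => ?_
      rw [Finset.sum_range_succ', jacobiEnergy_comm a b X (k + 1) 0, jacobiEnergy_zero, mul_zero,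
        add_zero, Finset.mul_sum]
      refine Finset.sum_congr rfl fun l _ => ?_
      rw [jacobiEnergy_succ_succ ha b hX]
      calc _ = (((k : ℝ) + 1) * jacobiCoeff a b X (j + 1) (k + 1)) *
            (((l : ℝ) + 1) * jacobiCoeff a b X (j + 1) (l + 1)) *
              jacobiMoment (a + 1) X (k + l + (b + 1)) := by ring
        _ = _ := by rw [jacobiCoeff_succ_succ a b hX, jacobiCoeff_succ_succ a b hX]; ring
    have h4 : L = jacobiEig a b (j + 1) / (X * (b + 1) ^ 2) * L' := by
      have : L = (jacobiEig a b (j + 1) / X * L) * (X / jacobiEig a b (j + 1)) := by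
        field_simp
      rw [this, h3]
      field_simp
    have h5 : jacobiEig a b (j + 1) / (X * (b + 1) ^ 2) * jacobiInvNorm a b X (j + 1) =
        jacobiInvNorm (a + 1) (b + 1) X j := by
      have hp : ∏ i ∈ Finset.range (b + 1), (jacobiEig (a + 1) (b + 1) j +
          ((i : ℝ) + 1) * (a + 1 + ((b + 1 : ℕ) : ℝ) - i)) = jacobiEig a b (j + 1) *
          ∏ i ∈ Finset.range b, (jacobiEig a b (j + 1) + ((i : ℝ) + 1) * (a + b - i)) := by
        rw [Finset.prod_range_succ', mul_comm]
        congr 1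
        · simp only [jacobiEig]; push_cast; ring
        · refine Finset.prod_congr rfl fun i _ => ?_
          simp only [jacobiEig]; push_cast; ring
      rw [jacobiInvNorm, jacobiInvNorm, hp, Nat.factorial_succ]
      push_cast
      field_simp
      ring
    rw [h4, mul_right_comm, h5, mul_comm]
    exact ih

end Polynomials

/-! ### Determinants against the Jacobi kernel -/

/-- The inequality `x ≤ exp (x - 1)`, applied to each eigenvalue. -/
theorem Matrix.PosSemidef.det_le_exp_trace_sub {n : ℕ} {A : Matrix (Fin n) (Fin n) ℝ}
    (hA : A.PosSemidef) : A.det ≤ Real.exp (A.trace - n) := by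
  have h1 : A.det = ∏ i, hA.isHermitian.eigenvalues i := by
    simpa using hA.isHermitian.det_eq_prod_eigenvalues
  have h2 : A.trace = ∑ i, hA.isHermitian.eigenvalues i := by
    simpa using hA.isHermitian.trace_eq_sum_eigenvalues
  have h3 : A.trace - n = ∑ i, (hA.isHermitian.eigenvalues i - 1) := by
    rw [h2, Finset.sum_sub_distrib]; simp
  rw [h1, h3, Real.exp_sum]
  refine Finset.prod_le_prod (fun i _ => hA.eigenvalues_nonneg i) fun i _ => ?_
  have := Real.add_one_le_exp (hA.isHermitian.eigenvalues i - 1)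
  linarith

/-- The coefficient of `x ^ p * y ^ q` in the reproducing kernel of the polynomials of degree less
than `n` for the weight `y ^ b * (1 - y / X) ^ a` on `[0, X]`. -/
noncomputable def jacobiKernel (n : ℕ) (a : ℝ) (b : ℕ) (X : ℝ) (p q : ℕ) : ℝ :=
  ∑ j ∈ Finset.range n, jacobiInvNorm a b X j * (jacobiCoeff a b X j p * jacobiCoeff a b X j q)

/-- The integral of a test function against the reproducing kernel on the diagonal: the mean of the
linear statistic of `g` over the ensemble. -/
noncomputable def jacobiMean (n : ℕ) (a : ℝ) (b : ℕ) (X : ℝ) (g : ℝ → ℝ) : ℝ :=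
  ∑ j ∈ Finset.range n, jacobiInvNorm a b X j *
    jacobiFunctional a b X fun y => jacobiPoly a b X j y ^ 2 * g y

section Hankel

variable {n : ℕ} {a X : ℝ} {b : ℕ}

/-- Change of basis from monomials to Jacobi polynomials in the Hankel matrix. -/
theorem jacobiCoeff_conj_hankel (ha : 0 ≤ a) {f : ℝ → ℝ} (hf : Continuous f) :
    (Matrix.of fun j k : Fin n => jacobiCoeff a b X j k) * jacobiHankel n a b X f *
      (Matrix.of fun j k : Fin n => jacobiCoeff a b X j k).transpose =
    Matrix.of fun i j : Fin n => jacobiFunctional a b X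
      fun y => jacobiPoly a b X i y * jacobiPoly a b X j y * f y := by
  ext i j
  rw [Matrix.of_apply, jacobiFunctional_poly_mul ha i.2 j.2 hf, Matrix.mul_apply]
  rw [Finset.sum_comm, ← Fin.sum_univ_eq_sum_range (fun l => ∑ k ∈ Finset.range n,
    jacobiCoeff a b X i k * jacobiCoeff a b X j l *
        jacobiFunctional a b X (fun y => y ^ (k + l) * f y))]
  refine Finset.sum_congr rfl fun l _ => ?_
  rw [← Fin.sum_univ_eq_sum_range (fun k => jacobiCoeff a b X i k * jacobiCoeff a b X j l *
        jacobiFunctional a b X (fun y => y ^ (k + (l : ℕ)) * f y)), Matrix.mul_apply,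
    Finset.sum_mul]
  refine Finset.sum_congr rfl fun k _ => ?_
  simp only [Matrix.of_apply, Matrix.transpose_apply, jacobiHankel]
  ring

theorem jacobiCoeff_conj_hankel_one (ha : 0 ≤ a) (hX : 0 < X) :
    Matrix.diagonal (fun j : Fin n => jacobiInvNorm a b X j) *
      ((Matrix.of fun j k : Fin n => jacobiCoeff a b X j k) * jacobiHankel n a b X (fun _ => 1) *
      (Matrix.of fun j k : Fin n => jacobiCoeff a b X j k).transpose) = 1 := by
  rw [jacobiCoeff_conj_hankel ha continuous_const]
  ext i j
  rw [Matrix.diagonal_mul, Matrix.of_apply]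
  simp only [mul_one]
  by_cases h : i = j
  · subst h
    rw [mul_comm, jacobiPoly_norm ha hX, Matrix.one_apply_eq]
  · rw [jacobiPoly_orthogonal ha hX fun h' => h (Fin.ext h'), mul_zero, Matrix.one_apply_ne h]

/-- The base change cancels in the ratio, where the denominator becomes the diagonal matrix of
squared norms. -/
theorem jacobiHankel_ratio (ha : 0 ≤ a) (hX : 0 < X) {f : ℝ → ℝ} (hf : Continuous f) :
    (jacobiHankel n a b X f).det / (jacobiHankel n a b X fun _ => 1).det =
      (Matrix.diagonal (fun j : Fin n => jacobiInvNorm a b X j) *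
        Matrix.of fun i j : Fin n => jacobiFunctional a b X
          fun y => jacobiPoly a b X i y * jacobiPoly a b X j y * f y).det := by
  have h := congrArg Matrix.det (jacobiCoeff_conj_hankel_one (n := n) (b := b) ha hX)
  rw [← jacobiCoeff_conj_hankel ha hf]
  simp only [Matrix.det_mul, Matrix.det_one] at h ⊢
  have h0 : (jacobiHankel n a b X fun _ => 1).det ≠ 0 := by
    intro h0
    rw [h0] at h
    simp at h
  rw [div_eq_iff h0]
  linear_combination -(jacobiHankel n a b X f).det * h

/-- Expectations of products as finite Fredholm determinants. -/
theorem jacobiHankel_ratio_eq_det (ha : 0 ≤ a) (hX : 0 < X) {g : ℝ → ℝ} (hg : Continuous g) :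
    (jacobiHankel n a b X fun y => 1 + g y).det / (jacobiHankel n a b X fun _ => 1).det =
      (1 + (Matrix.of fun p q : Fin n => jacobiKernel n a b X p q) * jacobiHankel n a b X g).det := by
  have hadd : (jacobiHankel n a b X fun y => 1 + g y) =
      jacobiHankel n a b X (fun _ => 1) + jacobiHankel n a b X g := by
    ext i j
    simp only [jacobiHankel, Matrix.of_apply, Matrix.add_apply]
    rw [← jacobiFunctional_add ha b (by fun_prop) (by fun_prop)]
    congr 1
    funext y
    ring
  rw [jacobiHankel_ratio ha hX (by fun_prop), ← jacobiCoeff_conj_hankel ha (by fun_prop), hadd,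
    mul_add, add_mul, mul_add, jacobiCoeff_conj_hankel_one ha hX, ← mul_assoc,
    Matrix.det_one_add_mul_comm]
  congr 2
  rw [← mul_assoc, ← mul_assoc]
  congr 1
  ext p q
  rw [Matrix.mul_apply, Matrix.of_apply, jacobiKernel, ← Fin.sum_univ_eq_sum_range
    (fun j => jacobiInvNorm a b X j * (jacobiCoeff a b X j p * jacobiCoeff a b X j q))]
  refine Finset.sum_congr rfl fun j _ => ?_
  rw [Matrix.mul_diagonal]
  simp only [Matrix.transpose_apply, Matrix.of_apply]
  ring

/-- The ratio is the determinant of a positive semidefinite matrix with trace `n + jacobiMean`, and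
`x ≤ exp (x - 1)` for each of its eigenvalues. -/
theorem jacobiHankel_ratio_le (ha : 0 ≤ a) (hX : 0 < X) {g : ℝ → ℝ} (hg : Continuous g)
    (hg1 : ∀ y, -1 ≤ g y) :
    (jacobiHankel n a b X fun y => 1 + g y).det / (jacobiHankel n a b X fun _ => 1).det ≤
      Real.exp (jacobiMean n a b X g) := by
  set S : Matrix (Fin n) (Fin n) ℝ := Matrix.of fun i j : Fin n => jacobiFunctional a b X
      fun y => jacobiPoly a b X i y * jacobiPoly a b X j y * (1 + g y) with hS
  set d : Fin n → ℝ := fun j => jacobiInvNorm a b X j with hd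
  have hd0 : ∀ j, 0 ≤ d j := fun j => (jacobiInvNorm_pos ha b hX j).le
  have hcP := fun i => continuous_jacobiPoly a b X i
  have hpsd : S.PosSemidef := by
    refine Matrix.PosSemidef.of_dotProduct_mulVec_nonneg ?_ fun x => ?_
    · ext i j
      simp only [hS, Matrix.conjTranspose_apply, Matrix.of_apply, star_trivial]
      congr 1
      funext y
      ring
    · have h : star x ⬝ᵥ S.mulVec x = jacobiFunctional a b X
          fun y => (∑ i : Fin n, x i * jacobiPoly a b X i y) ^ 2 * (1 + g y) := by
        have h1 : (fun y => (∑ i : Fin n, x i * jacobiPoly a b X i y) ^ 2 * (1 + g y)) = fun y =>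
            ∑ i : Fin n, ∑ j : Fin n, x i * x j *
              (jacobiPoly a b X i y * jacobiPoly a b X j y * (1 + g y)) := by
          funext y
          rw [pow_two, Finset.sum_mul_sum, Finset.sum_mul]
          refine Finset.sum_congr rfl fun i _ => ?_
          rw [Finset.sum_mul]
          exact Finset.sum_congr rfl fun j _ => by ring
        rw [h1, jacobiFunctional_sum ha b _ fun i _ => by fun_prop]
        refine Finset.sum_congr rfl fun i _ => ?_
        rw [jacobiFunctional_sum ha b _ fun j _ => by fun_prop, Matrix.mulVec, dotProduct,
          Finset.mul_sum]
        refine Finset.sum_congr rfl fun j _ => ?_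
        rw [jacobiFunctional_const_mul, hS, Matrix.of_apply, star_trivial]
        ring
      rw [h]
      refine jacobiFunctional_nonneg b hX fun y _ => mul_nonneg (sq_nonneg _) ?_
      linarith [hg1 y]
  set D : Matrix (Fin n) (Fin n) ℝ := Matrix.diagonal fun j => √(d j) with hD
  have hDD : D * D = Matrix.diagonal d := by
    rw [hD, Matrix.diagonal_mul_diagonal]
    congr 1
    funext j
    exact Real.mul_self_sqrt (hd0 j)
  have hA : (D * S * D).PosSemidef := by
    have := hpsd.mul_mul_conjTranspose_same D
    rwa [hD, Matrix.diagonal_conjTranspose, star_trivial, ← hD] at this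
  have hdet : (Matrix.diagonal d * S).det = (D * S * D).det := by
    rw [← hDD, Matrix.det_mul, Matrix.det_mul, Matrix.det_mul, Matrix.det_mul]
    ring
  have htr : (D * S * D).trace - n = jacobiMean n a b X g := by
    rw [Matrix.trace_mul_comm, ← mul_assoc, hDD, jacobiMean, ← Fin.sum_univ_eq_sum_range
      (fun j => jacobiInvNorm a b X j *
        jacobiFunctional a b X fun y => jacobiPoly a b X j y ^ 2 * g y)]
    have hn : (n : ℝ) = ∑ _j : Fin n, 1 := by simp
    rw [Matrix.trace, hn, ← Finset.sum_sub_distrib]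
    refine Finset.sum_congr rfl fun j _ => ?_
    rw [Matrix.diag_apply, Matrix.diagonal_mul, hS, Matrix.of_apply]
    have h1 : (fun y => jacobiPoly a b X j y * jacobiPoly a b X j y * (1 + g y)) = fun y =>
        jacobiPoly a b X j y * jacobiPoly a b X j y + jacobiPoly a b X j y ^ 2 * g y := by
      funext y; ring
    rw [h1, jacobiFunctional_add ha b (by fun_prop) (by fun_prop), mul_add]
    have h2 := jacobiPoly_norm (b := b) ha hX j
    rw [mul_comm] at h2
    rw [hd, h2]
    ring
  rw [jacobiHankel_ratio ha hX (by fun_prop), ← htr]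
  exact hdet ▸ hA.det_le_exp_trace_sub

end Hankel

/-! ### The Jacobi kernel at the hard edge -/

theorem pow_succ_sub_pow_succ_mem {x y : ℝ} (hx : 0 ≤ x) (hxy : x ≤ y) (k : ℕ) :
    (k + 1) * (x ^ k * (y - x)) ≤ y ^ (k + 1) - x ^ (k + 1) ∧
      y ^ (k + 1) - x ^ (k + 1) ≤ (k + 1) * (y ^ k * (y - x)) := by
  induction k with
  | zero => simp
  | succ k ih =>
    have hp : x ^ (k + 1) ≤ y ^ (k + 1) := pow_le_pow_left₀ hx hxy _
    have h1 := mul_le_mul_of_nonneg_left ih.1 hx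
    have h2 := mul_le_mul_of_nonneg_left ih.2 (hx.trans hxy)
    have h3 := mul_le_mul_of_nonneg_right hp (sub_nonneg.2 hxy)
    push_cast
    constructor
    · have : y ^ (k + 1 + 1) - x ^ (k + 1 + 1) =
          x * (y ^ (k + 1) - x ^ (k + 1)) + y ^ (k + 1) * (y - x) := by ring
      rw [this]
      calc ((k : ℝ) + 1 + 1) * (x ^ (k + 1) * (y - x)) =
          x * ((k + 1) * (x ^ k * (y - x))) + x ^ (k + 1) * (y - x) := by ring
        _ ≤ _ := add_le_add h1 h3
    · have : y ^ (k + 1 + 1) - x ^ (k + 1 + 1) =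
          y * (y ^ (k + 1) - x ^ (k + 1)) + x ^ (k + 1) * (y - x) := by ring
      rw [this]
      calc _ ≤ y * ((k + 1) * (y ^ k * (y - x))) + y ^ (k + 1) * (y - x) := add_le_add h2 h3
        _ = _ := by ring

/-- The right end point of the support of the eigenvalues on the scale `n ^ 2 * (1 + a / n)` of the
hard edge. -/
noncomputable def hardEdgeScale (a : ℕ → ℝ) (n : ℕ) : ℝ := 2 * (n * (n + a n))

section Asymptotics

variable {a : ℕ → ℝ}

theorem hardEdgeScale_pos (ha : ∀ n, 0 ≤ a n) {n : ℕ} (hn : 0 < n) : 0 < hardEdgeScale a n := by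
  have := ha n
  have : (0 : ℝ) < n := Nat.cast_pos.2 hn
  unfold hardEdgeScale; positivity

theorem le_hardEdgeScale (ha : ∀ n, 0 ≤ a n) {n : ℕ} (hn : 0 < n) : (n : ℝ) ≤ hardEdgeScale a n := by
  have h1 := ha n
  have h2 : (1 : ℝ) ≤ n := Nat.one_le_cast.2 hn
  unfold hardEdgeScale; nlinarith

theorem tendsto_hardEdgeScale (ha : ∀ n, 0 ≤ a n) : Tendsto (hardEdgeScale a) atTop atTop :=
  tendsto_atTop_mono' _ ((eventually_gt_atTop 0).mono fun _ hn => le_hardEdgeScale ha hn)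
    tendsto_natCast_atTop_atTop

/-- A quantity growing at most linearly in `n + a n` is negligible on the hard edge scale. -/
theorem tendsto_div_hardEdgeScale (ha : ∀ n, 0 ≤ a n) (c d : ℝ) (hc : 0 ≤ c) (hd : 0 ≤ d)
    {u : ℕ → ℝ} (hu : ∀ n, 0 ≤ u n) (hu' : ∀ n, u n ≤ c * (n + a n) + d) :
    Tendsto (fun n => u n / hardEdgeScale a n) atTop (𝓝 0) := by
  have h0 : Tendsto (fun n : ℕ => (c + d) / (n : ℝ)) atTop (𝓝 0) :=
    tendsto_const_div_atTop_nhds_zero_nat _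
  refine tendsto_of_tendsto_of_tendsto_of_le_of_le' tendsto_const_nhds h0 ?_ ?_
  · filter_upwards [eventually_gt_atTop 0] with n hn
    exact div_nonneg (hu n) (hardEdgeScale_pos ha hn).le
  · filter_upwards [eventually_gt_atTop 0] with n hn
    rw [div_le_div_iff₀ (hardEdgeScale_pos ha hn) (Nat.cast_pos.2 hn)]
    have h1 : (1 : ℝ) ≤ n := Nat.one_le_cast.2 hn
    have h2 := ha n
    have h3 : u n ≤ (c + d) * (n + a n) := by
      refine (hu' n).trans ?_
      nlinarith
    have h4 : 0 ≤ (c + d) * (n + a n) * n := by positivity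
    unfold hardEdgeScale
    nlinarith [mul_le_mul_of_nonneg_right h3 (Nat.cast_nonneg n)]

/-- The ratio of the eigenvalues to the hard edge scale is bounded uniformly in `n` and in `a n`. -/
theorem jacobiEig_le_mul_hardEdgeScale (ha : ∀ n, 0 ≤ a n) (b : ℕ) {j n : ℕ} (hj : j ≤ n) :
    jacobiEig (a n) b j ≤ (b + 1) * hardEdgeScale a n := by
  have h1 : (j : ℝ) ≤ n := Nat.cast_le.2 hj
  have h2 := ha n
  rcases Nat.eq_zero_or_pos n with hn | hn
  · subst hn
    have : j = 0 := by omega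
    subst this
    simp [jacobiEig, hardEdgeScale]
  have h3 : (1 : ℝ) ≤ n := Nat.one_le_cast.2 hn
  unfold jacobiEig hardEdgeScale
  have hb : (0 : ℝ) ≤ b := Nat.cast_nonneg b
  calc (j : ℝ) * (j + a n + b + 1) ≤ n * (n + a n + b + 1) := by gcongr
    _ ≤ n * ((b + 1) * 2 * (n + a n)) := by
        gcongr
        nlinarith [mul_nonneg hb h2, mul_le_mul_of_nonneg_left h3 hb]
    _ = _ := by ring

theorem tendsto_jacobiEig_div (ha : ∀ n, 0 ≤ a n) (b j : ℕ) :
    Tendsto (fun n => jacobiEig (a n) b j / hardEdgeScale a n) atTop (𝓝 0) := by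
  refine tendsto_div_hardEdgeScale ha j (j * (j + b + 1)) (by positivity) (by positivity)
    (fun n => jacobiEig_nonneg (ha n) b j) fun n => ?_
  have := ha n
  unfold jacobiEig
  have h1 : (0 : ℝ) ≤ j * n := by positivity
  nlinarith

theorem tendsto_jacobiEig_self_div (ha : ∀ n, 0 ≤ a n) (b : ℕ) :
    Tendsto (fun n => jacobiEig (a n) b n / hardEdgeScale a n) atTop (𝓝 (1 / 2)) := by
  have h := tendsto_div_hardEdgeScale ha (b + 1) 0 (by positivity) le_rfl
    (u := fun n => n * (b + 1)) (fun n => by positivity) fun n => by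
      have := ha n
      have hb : (0 : ℝ) ≤ (b + 1) * a n := by positivity
      nlinarith
  have h2 := h.const_add (1 / 2)
  rw [add_zero] at h2
  refine h2.congr' ?_
  filter_upwards [eventually_gt_atTop 0] with n hn
  have hX := hardEdgeScale_pos ha hn
  field_simp
  unfold hardEdgeScale jacobiEig
  ring

/-- Riemann sums: the weighted power sums of the eigenvalues of the Jacobi operator converge. -/
theorem tendsto_sum_jacobiEig_pow (ha : ∀ n, 0 ≤ a n) (b k : ℕ) :
    Tendsto (fun n => ∑ j ∈ Finset.range n, (2 * j + a n + b + 1) / hardEdgeScale a n *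
      (jacobiEig (a n) b j / hardEdgeScale a n) ^ k) atTop
      (𝓝 ((1 / 2) ^ (k + 1) / (k + 1))) := by
  set X := hardEdgeScale a with hX
  set τ : ℕ → ℕ → ℝ := fun n j => jacobiEig (a n) b j / X n with hτ
  have hΔ : ∀ n j, τ n (j + 1) - τ n j = (2 * j + a n + b + 1) / X n + 1 / X n := by
    intro n j
    simp only [hτ, jacobiEig]
    push_cast
    ring
  have hτ0 : ∀ n, 0 < n → ∀ j, 0 ≤ τ n j := fun n hn j =>
    div_nonneg (jacobiEig_nonneg (ha n) b j) (hardEdgeScale_pos ha hn).le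
  have hτm : ∀ n, 0 < n → ∀ i j, i ≤ j → τ n i ≤ τ n j := fun n hn i j hij =>
    div_le_div_of_nonneg_right ((jacobiEig_strictMono (ha n) b).monotone hij)
      (hardEdgeScale_pos ha hn).le
  set mesh : ℕ → ℝ := fun n => (2 * n + a n + b + 2) / X n with hmesh
  have hmesh0 : Tendsto mesh atTop (𝓝 0) :=
    tendsto_div_hardEdgeScale ha 2 (b + 2) (by positivity) (by positivity)
      (fun n => by have := ha n; positivity) fun n => by linarith [ha n]
  have hnX : Tendsto (fun n : ℕ => (n : ℝ) / X n) atTop (𝓝 0) :=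
    tendsto_div_hardEdgeScale ha 1 0 zero_le_one le_rfl (fun n => Nat.cast_nonneg n)
      fun n => by linarith [ha n]
  have hτn : Tendsto (fun n => τ n n) atTop (𝓝 (1 / 2)) := tendsto_jacobiEig_self_div ha b
  have hmain : Tendsto (fun n => τ n n ^ (k + 1) / (k + 1)) atTop (𝓝 ((1 / 2) ^ (k + 1) / (k + 1))) :=
    (hτn.pow _).div_const _
  -- the first term bounds the error of the Riemann sum, the second one the defect `1 / X n` in `hΔ`
  have herr : Tendsto (fun n => mesh n * τ n n ^ k + n / X n * τ n n ^ k) atTop (𝓝 0) := by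
    simpa using (hmesh0.mul (hτn.pow k)).add (hnX.mul (hτn.pow k))
  have hlow := hmain.sub herr
  rw [sub_zero] at hlow
  refine tendsto_of_tendsto_of_tendsto_of_le_of_le' hlow hmain ?_ ?_
  · filter_upwards [eventually_gt_atTop 0] with n hn
    have hXn : 0 < X n := hardEdgeScale_pos ha hn
    have h1 : τ n n ^ (k + 1) / (k + 1) ≤
        ∑ j ∈ Finset.range n, τ n (j + 1) ^ k * (τ n (j + 1) - τ n j) := by
      rw [div_le_iff₀ (by positivity), Finset.sum_mul]
      have : τ n n ^ (k + 1) = ∑ j ∈ Finset.range n, (τ n (j + 1) ^ (k + 1) - τ n j ^ (k + 1)) := by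
        rw [Finset.sum_range_sub (fun j => τ n j ^ (k + 1))]
        simp [hτ, jacobiEig]
      rw [this]
      refine Finset.sum_le_sum fun j _ => ?_
      have := (pow_succ_sub_pow_succ_mem (hτ0 n hn j) (hτm n hn j (j + 1) (Nat.le_succ j)) k).2
      linarith
    have h2 : ∑ j ∈ Finset.range n, (τ n (j + 1) ^ k - τ n j ^ k) * (τ n (j + 1) - τ n j) ≤
        mesh n * τ n n ^ k := by
      have : ∀ j ∈ Finset.range n, (τ n (j + 1) ^ k - τ n j ^ k) * (τ n (j + 1) - τ n j) ≤
          (τ n (j + 1) ^ k - τ n j ^ k) * mesh n := by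
        intro j hj
        have hj : (j : ℝ) ≤ n := Nat.cast_le.2 (Finset.mem_range.1 hj).le
        refine mul_le_mul_of_nonneg_left ?_ (sub_nonneg.2 (pow_le_pow_left₀ (hτ0 n hn j)
          (hτm n hn j (j + 1) (Nat.le_succ j)) k))
        rw [hΔ, ← add_div]
        exact div_le_div_of_nonneg_right (by linarith) hXn.le
      refine (Finset.sum_le_sum this).trans ?_
      have hmn : 0 ≤ mesh n := div_nonneg (by have := ha n; positivity) hXn.le
      rw [← Finset.sum_mul, Finset.sum_range_sub (fun j => τ n j ^ k), mul_comm]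
      refine mul_le_mul_of_nonneg_left ?_ hmn
      linarith [pow_nonneg (hτ0 n hn 0) k]
    have h3 : ∑ j ∈ Finset.range n, τ n j ^ k * (1 / X n) ≤ n / X n * τ n n ^ k := by
      have : ∀ j ∈ Finset.range n, τ n j ^ k * (1 / X n) ≤ τ n n ^ k * (1 / X n) := fun j hj =>
        mul_le_mul_of_nonneg_right (pow_le_pow_left₀ (hτ0 n hn j)
          (hτm n hn j n (Finset.mem_range.1 hj).le) k) (by positivity)
      refine (Finset.sum_le_sum this).trans (le_of_eq ?_)
      rw [Finset.sum_const, Finset.card_range, nsmul_eq_mul]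
      ring
    have h4 : ∑ j ∈ Finset.range n, (2 * j + a n + b + 1) / X n * τ n j ^ k =
        ∑ j ∈ Finset.range n, τ n (j + 1) ^ k * (τ n (j + 1) - τ n j) -
        ∑ j ∈ Finset.range n, (τ n (j + 1) ^ k - τ n j ^ k) * (τ n (j + 1) - τ n j) -
        ∑ j ∈ Finset.range n, τ n j ^ k * (1 / X n) := by
      rw [← Finset.sum_sub_distrib, ← Finset.sum_sub_distrib]
      refine Finset.sum_congr rfl fun j _ => ?_
      rw [hΔ]
      ring
    rw [h4]
    linarith
  · filter_upwards [eventually_gt_atTop 0] with n hn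
    have hXn : 0 < X n := hardEdgeScale_pos ha hn
    rw [le_div_iff₀ (by positivity), Finset.sum_mul]
    have : τ n n ^ (k + 1) = ∑ j ∈ Finset.range n, (τ n (j + 1) ^ (k + 1) - τ n j ^ (k + 1)) := by
      rw [Finset.sum_range_sub (fun j => τ n j ^ (k + 1))]
      simp [hτ, jacobiEig]
    rw [this]
    refine Finset.sum_le_sum fun j _ => ?_
    have h1 := (pow_succ_sub_pow_succ_mem (hτ0 n hn j) (hτm n hn j (j + 1) (Nat.le_succ j)) k).1
    rw [hΔ] at h1
    have h2 : 0 ≤ ((k : ℝ) + 1) * (τ n j ^ k * (1 / X n)) := by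
      have := hτ0 n hn j
      positivity
    calc _ = ((k : ℝ) + 1) * (τ n j ^ k * ((2 * j + a n + b + 1) / X n + 1 / X n)) -
          ((k : ℝ) + 1) * (τ n j ^ k * (1 / X n)) := by ring
      _ ≤ _ := by linarith

/-- Convergence of the weighted sums of `h n j` against all powers of the rescaled eigenvalues of
the Jacobi operator. -/
def ConvergesAgainstPowers (a : ℕ → ℝ) (b : ℕ) (h : ℕ → ℕ → ℝ) : Prop :=
  ∀ k : ℕ, ∃ L : ℝ, Tendsto (fun n => ∑ j ∈ Finset.range n,
    (2 * j + a n + b + 1) / hardEdgeScale a n *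
      ((jacobiEig (a n) b j / hardEdgeScale a n) ^ k * h n j)) atTop (𝓝 L)

theorem convergesAgainstPowers_one (ha : ∀ n, 0 ≤ a n) (b : ℕ) :
    ConvergesAgainstPowers a b fun _ _ => 1 := fun k =>
  ⟨_, by simpa using tendsto_sum_jacobiEig_pow ha b k⟩

theorem ConvergesAgainstPowers.mul_add {b : ℕ} {h : ℕ → ℕ → ℝ} (hh : ConvergesAgainstPowers a b h)
    {e : ℕ → ℝ} {e' : ℝ} (he : Tendsto e atTop (𝓝 e')) (c : ℝ) :
    ConvergesAgainstPowers a b fun n j =>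
      h n j * (e n + c * (jacobiEig (a n) b j / hardEdgeScale a n)) := by
  intro k
  obtain ⟨L₁, hL₁⟩ := hh k
  obtain ⟨L₂, hL₂⟩ := hh (k + 1)
  refine ⟨_, ((he.mul hL₁).add (hL₂.const_mul c)).congr fun n => ?_⟩
  rw [Finset.mul_sum, Finset.mul_sum, ← Finset.sum_add_distrib]
  exact Finset.sum_congr rfl fun j _ => by ring

theorem ConvergesAgainstPowers.mul_prod {b : ℕ} {h : ℕ → ℕ → ℝ}
    (hh : ConvergesAgainstPowers a b h) {e : ℕ → ℕ → ℝ} {e' : ℕ → ℝ}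
    (he : ∀ i, Tendsto (e i) atTop (𝓝 (e' i))) (c : ℕ → ℝ) (m : ℕ) :
    ConvergesAgainstPowers a b fun n j =>
      h n j * ∏ i ∈ Finset.range m,
        (e i n + c i * (jacobiEig (a n) b j / hardEdgeScale a n)) := by
  induction m with
  | zero => simpa using hh
  | succ m ih =>
    have := ih.mul_add (he m) (c m)
    simpa only [Finset.prod_range_succ, mul_assoc] using this

/-- The entries of the reproducing kernel in the monomial basis converge at the hard edge. -/
theorem exists_tendsto_jacobiKernel (ha : ∀ n, 0 ≤ a n) (b p q : ℕ) :
    ∃ L : ℝ, Tendsto (fun n => jacobiKernel n (a n) b (hardEdgeScale a n) p q) atTop (𝓝 L) := by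
  have hθ : ∀ i : ℕ, Tendsto (fun n => jacobiEig (a n) b i / hardEdgeScale a n /
      (((i : ℝ) + 1) * ((i : ℝ) + 1 + b))) atTop (𝓝 (0 / (((i : ℝ) + 1) * ((i : ℝ) + 1 + b)))) :=
    fun i => (tendsto_jacobiEig_div ha b i).div_const _
  have hδ : ∀ i : ℕ, Tendsto (fun n => ((i : ℝ) + 1) * (a n + b - i) / hardEdgeScale a n) atTop
      (𝓝 0) := by
    intro i
    have h1 := tendsto_div_hardEdgeScale ha (i + 1) ((i + 1) * b) (by positivity) (by positivity)
      (u := fun n => ((i : ℝ) + 1) * (a n + b)) (fun n => by have := ha n; positivity) fun n => by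
        have : (0 : ℝ) ≤ (i + 1) * n := by positivity
        linarith
    have h2 : Tendsto (fun n => ((i : ℝ) + 1) * i / hardEdgeScale a n) atTop (𝓝 0) :=
      (tendsto_hardEdgeScale ha).const_div_atTop _
    have h3 := h1.sub h2
    rw [sub_zero] at h3
    exact h3.congr fun n => by ring
  have hc := (((convergesAgainstPowers_one ha b).mul_prod hδ (fun _ => 1) b).mul_prod hθ
    (fun i => -(1 / (((i : ℝ) + 1) * ((i : ℝ) + 1 + b)))) p).mul_prod hθ
    (fun i => -(1 / (((i : ℝ) + 1) * ((i : ℝ) + 1 + b)))) q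
  obtain ⟨L, hL⟩ := hc 0
  refine ⟨_, (hL.const_mul (1 / (b.factorial : ℝ) ^ 2)).congr' ?_⟩
  filter_upwards [eventually_gt_atTop 0] with n hn
  have hX := hardEdgeScale_pos ha hn
  set X := hardEdgeScale a n
  rw [jacobiKernel, Finset.mul_sum]
  refine Finset.sum_congr rfl fun j _ => ?_
  have hcoeff : ∀ p, ∏ i ∈ Finset.range p, (jacobiEig (a n) b i / X /
      (((i : ℝ) + 1) * ((i : ℝ) + 1 + b)) +
      -(1 / (((i : ℝ) + 1) * ((i : ℝ) + 1 + b))) * (jacobiEig (a n) b j / X)) =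
      jacobiCoeff (a n) b X j p := by
    intro p
    refine Finset.prod_congr rfl fun i _ => ?_
    field_simp
    ring
  have hnorm : (∏ i ∈ Finset.range b, (((i : ℝ) + 1) * (a n + b - i) / X +
      1 * (jacobiEig (a n) b j / X))) =
      (∏ i ∈ Finset.range b, (jacobiEig (a n) b j + (i + 1) * (a n + b - i))) / X ^ b := by
    rw [← Finset.card_range b, ← Finset.prod_const, Finset.card_range, ← Finset.prod_div_distrib]
    exact Finset.prod_congr rfl fun i _ => by ring
  rw [hcoeff, hcoeff, hnorm, jacobiInvNorm]
  have hb : (b.factorial : ℝ) ≠ 0 := by positivity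
  field_simp
  ring

end Asymptotics

section Bounds

/-- Uniform factorial decay of the coefficients of Jacobi polynomials. -/
theorem abs_jacobiCoeff_le {a X R : ℝ} {b j : ℕ} (ha : 0 ≤ a) (hX : 0 < X)
    (hR : jacobiEig a b j ≤ R * X) (k : ℕ) : |jacobiCoeff a b X j k| ≤ R ^ k / k.factorial := by
  have hR0 : 0 ≤ R := nonneg_of_mul_nonneg_left ((jacobiEig_nonneg ha b j).trans hR) hX
  rcases lt_or_ge j k with hjk | hjk
  · rw [jacobiCoeff_eq_zero a b X hjk, abs_zero]; positivity
  rw [jacobiCoeff, Finset.abs_prod, ← Finset.prod_range_add_one_eq_factorial]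
  push_cast
  nth_rewrite 2 [← Finset.card_range k]
  rw [← Finset.prod_const, ← Finset.prod_div_distrib]
  refine Finset.prod_le_prod (fun i _ => abs_nonneg _) fun i hi => ?_
  have hij : jacobiEig a b i ≤ jacobiEig a b j :=
    (jacobiEig_strictMono ha b).monotone (by have := Finset.mem_range.1 hi; omega)
  have hi0 := jacobiEig_nonneg ha b i
  rw [abs_div, abs_of_nonpos (by linarith), abs_of_pos (by positivity),
    div_le_div_iff₀ (by positivity) (by positivity)]
  have h1 : -(jacobiEig a b i - jacobiEig a b j) ≤ R * X := by linarith
  have h2 : (1 : ℝ) ≤ (i : ℝ) + 1 + b := by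
    have : (0 : ℝ) ≤ i := Nat.cast_nonneg i
    have : (0 : ℝ) ≤ b := Nat.cast_nonneg b
    linarith
  calc _ ≤ R * X * ((i : ℝ) + 1) := by gcongr
    _ ≤ R * X * ((i : ℝ) + 1) * ((i : ℝ) + 1 + b) := le_mul_of_one_le_right (by positivity) h2
    _ = _ := by ring

end Bounds

/-! ### Convergence of Fredholm determinants -/

theorem Matrix.det_one_add_eq_sum_minors {m R : Type*} [Fintype m] [DecidableEq m] [CommRing R]
    (A : Matrix m m R) :
    (1 + A).det = ∑ s : Finset m, (A.submatrix ((↑) : s → m) ((↑) : s → m)).det := by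
  rw [add_comm]
  have h := (Matrix.detRowAlternating (n := m) (R := R)).map_add_univ A (1 : Matrix m m R)
  refine Eq.trans h (Finset.sum_congr rfl fun s _ => ?_)
  exact Matrix.det_piecewise_one_eq_submatrix_det A s

/-- The principal minor of an infinite matrix on a finite set of indices. -/
noncomputable def principalMinor (A : ℕ → ℕ → ℝ) (S : Finset ℕ) : ℝ :=
  (Matrix.of fun p q : S => A p q).det

/-- The determinant of a finite section is a sum of principal minors over an index set that does not
depend on its size. -/
theorem det_one_add_eq_tsum_principalMinor {n : ℕ} {A : ℕ → ℕ → ℝ} (hA : ∀ p q, n ≤ p → A p q = 0) :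
    (1 + Matrix.of fun p q : Fin n => A p q).det = ∑' S, principalMinor A S := by
  rw [Matrix.det_one_add_eq_sum_minors]
  have hinj : Function.Injective fun s : Finset (Fin n) => s.map Fin.valEmbedding :=
    Finset.map_injective _
  rw [← hinj.tsum_eq, tsum_fintype]
  · refine Finset.sum_congr rfl fun s _ => ?_
    rw [principalMinor, ← Matrix.det_submatrix_equiv_self (s.equivMap Fin.valEmbedding)]
    rfl
  · intro S hS
    have hSn : ∀ p ∈ S, p < n := by
      intro p hp
      by_contra hpn
      exact hS (Matrix.det_eq_zero_of_row_eq_zero ⟨p, hp⟩ fun q => hA p q (not_lt.1 hpn))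
    refine ⟨Finset.univ.filter fun i : Fin n => (i : ℕ) ∈ S, ?_⟩
    ext p
    simp only [Finset.mem_map, Finset.mem_filter, Finset.mem_univ, true_and,
      Fin.valEmbedding_apply]
    exact ⟨fun ⟨i, hi, hip⟩ => hip ▸ hi, fun hp => ⟨⟨p, hSn p hp⟩, hp, rfl⟩⟩

/-- The factorial in the Leibniz bound for a minor is spread over the indices, so that the bound
becomes a product and is summable over all finite sets. -/
theorem factorial_card_le_prod_succ (S : Finset ℕ) :
    (S.card.factorial : ℝ) ≤ ∏ p ∈ S, ((p : ℝ) + 1) := by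
  induction S using Finset.induction_on_max with
  | empty => simp
  | insert m S hm ih =>
    have hmS : m ∉ S := fun h => lt_irrefl _ (hm m h)
    have hcard : S.card ≤ m := by
      calc S.card ≤ (Finset.range m).card :=
            Finset.card_le_card fun p hp => Finset.mem_range.2 (hm p hp)
        _ = m := Finset.card_range m
    rw [Finset.card_insert_of_notMem hmS, Finset.prod_insert hmS, Nat.factorial_succ]
    push_cast
    have : (S.card : ℝ) ≤ m := Nat.cast_le.2 hcard
    gcongr

/-- Leibniz bound for principal minors of a matrix dominated by a rank one matrix. -/
theorem abs_principalMinor_le {A : ℕ → ℕ → ℝ} {u v : ℕ → ℝ} (hA : ∀ p q, |A p q| ≤ u p * v q)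
    (S : Finset ℕ) : |principalMinor A S| ≤ ∏ p ∈ S, (((p : ℝ) + 1) * (u p * v p)) := by
  have huv : ∀ p, 0 ≤ u p * v p := fun p => (abs_nonneg _).trans (hA p p)
  have hterm : ∀ σ : Equiv.Perm S,
      |((Equiv.Perm.sign σ : ℤ) : ℝ) * ∏ p : S, A (σ p) p| ≤ ∏ p ∈ S, (u p * v p) := by
    intro σ
    have hsign : |((Equiv.Perm.sign σ : ℤ) : ℝ)| = 1 := by
      rcases Int.units_eq_one_or (Equiv.Perm.sign σ) with h | h <;> simp [h]
    rw [abs_mul, hsign, one_mul, Finset.abs_prod]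
    calc ∏ p : S, |A (σ p) p| ≤ ∏ p : S, (u (σ p) * v p) :=
          Finset.prod_le_prod (fun _ _ => abs_nonneg _) fun p _ => hA _ _
      _ = ∏ p : S, (u p * v p) := by
          rw [Finset.prod_mul_distrib, Finset.prod_mul_distrib,
            Equiv.prod_comp σ fun p : S => u p]
      _ = ∏ p ∈ S, (u p * v p) := Finset.prod_coe_sort S fun p => u p * v p
  rw [principalMinor, Matrix.det_apply']
  calc _ ≤ ∑ σ : Equiv.Perm S, |((Equiv.Perm.sign σ : ℤ) : ℝ) * ∏ p : S, A (σ p) p| :=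
        Finset.abs_sum_le_sum_abs _ _
    _ ≤ ∑ _σ : Equiv.Perm S, ∏ p ∈ S, (u p * v p) := Finset.sum_le_sum fun σ _ => hterm σ
    _ = S.card.factorial * ∏ p ∈ S, (u p * v p) := by
        rw [Finset.sum_const, Finset.card_univ, Fintype.card_perm, Fintype.card_coe, nsmul_eq_mul]
    _ ≤ (∏ p ∈ S, ((p : ℝ) + 1)) * ∏ p ∈ S, (u p * v p) :=
        mul_le_mul_of_nonneg_right (factorial_card_le_prod_succ S)
          (Finset.prod_nonneg fun p _ => huv p)
    _ = _ := Finset.prod_mul_distrib.symm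

/-- Finite Fredholm determinants converge if the entries do and are dominated by a suitable rank one
matrix. -/
theorem exists_tendsto_det_one_add {A : ℕ → ℕ → ℕ → ℝ} {u v : ℕ → ℝ}
    (h0 : ∀ n p q, n ≤ p → A n p q = 0) (hA : ∀ᶠ n in atTop, ∀ p q, |A n p q| ≤ u p * v q)
    (hs : Summable fun p : ℕ => ((p : ℝ) + 1) * (u p * v p))
    (hlim : ∀ p q, ∃ L : ℝ, Tendsto (fun n => A n p q) atTop (𝓝 L)) :
    ∃ L : ℝ, Tendsto (fun n => (1 + Matrix.of fun p q : Fin n => A n p q).det) atTop (𝓝 L) := by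
  choose L hL using hlim
  obtain ⟨n₀, hn₀⟩ := hA.exists
  have huv : ∀ p : ℕ, 0 ≤ ((p : ℝ) + 1) * (u p * v p) := fun p =>
    mul_nonneg (by positivity) ((abs_nonneg _).trans (hn₀ p p))
  refine ⟨∑' S, principalMinor L S, ?_⟩
  have := tendsto_tsum_of_dominated_convergence (𝓕 := atTop)
    (f := fun n S => principalMinor (A n) S) (g := principalMinor L)
    (summable_finsetProd_of_summable_nonneg huv hs) (fun S => ?_) ?_
  · exact this.congr fun n => (det_one_add_eq_tsum_principalMinor (h0 n)).symm
  · have hc : Continuous fun B : Matrix S S ℝ => B.det := continuous_id.matrix_det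
    have ht : Tendsto (fun n => Matrix.of fun p q : S => A n p q) atTop
        (𝓝 (Matrix.of fun p q : S => L p q)) :=
      tendsto_pi_nhds.2 fun p => tendsto_pi_nhds.2 fun q => hL p q
    exact (hc.tendsto _).comp ht
  · filter_upwards [hA] with n hn S
    exact abs_principalMinor_le hn S

/-! ### Statistics of the eigenvalues at the hard edge -/

theorem one_sub_two_mul_le_rpow {a u : ℝ} (ha : 0 ≤ a) (h0 : 0 ≤ u) (hu : u ≤ 1 / 2) :
    1 - 2 * a * u ≤ (1 - u) ^ a := by
  have h1 : 0 < 1 - u := by linarith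
  have h2 : -(2 * u) ≤ Real.log (1 - u) := by
    refine le_trans ?_ (Real.one_sub_inv_le_log_of_pos h1)
    rw [neg_le_sub_iff_le_add, inv_eq_one_div, div_le_iff₀ h1]
    nlinarith
  rw [Real.rpow_def_of_pos h1]
  refine le_trans ?_ (Real.add_one_le_exp _)
  nlinarith [mul_le_mul_of_nonneg_left h2 ha]

section Functional

variable {a X T : ℝ} {b : ℕ} {g : ℝ → ℝ}

theorem jacobiFunctional_weight_le (ha : 0 ≤ a) (b : ℕ) (hX : 0 < X) {y : ℝ}
    (hy : y ∈ Set.Icc 0 X) : y ^ b * (1 - y / X) ^ a ≤ y ^ b := by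
  have h : y / X ≤ 1 := (div_le_one hX).2 hy.2
  have h2 : 0 ≤ y / X := div_nonneg hy.1 hX.le
  exact mul_le_of_le_one_right (pow_nonneg hy.1 _)
    (Real.rpow_le_one (by linarith) (by linarith) ha)

theorem jacobiFunctional_eq_of_support (ha : 0 ≤ a) (hTX : T ≤ X) (hg : Continuous g)
    (hgT : ∀ y, T ≤ y → g y = 0) :
    jacobiFunctional a b X g = ∫ y in (0 : ℝ)..T, y ^ b * (1 - y / X) ^ a * g y := by
  have hc : Continuous fun y => y ^ b * (1 - y / X) ^ a * g y :=
    (continuous_jacobiFunctional_weight ha b X).mul hg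
  rw [jacobiFunctional, ← intervalIntegral.integral_add_adjacent_intervals
    (hc.intervalIntegrable 0 T) (hc.intervalIntegrable T X), add_eq_left]
  refine intervalIntegral.integral_zero_ae (Eventually.of_forall fun y hy => ?_)
  rw [Set.uIoc_of_le hTX] at hy
  rw [hgT y hy.1.le, mul_zero]

theorem abs_jacobiFunctional_le {C : ℝ} (ha : 0 ≤ a) (hX : 0 < X) (hT : 0 ≤ T)
    (hg : Continuous g) (hgT : ∀ y, T ≤ y → g y = 0) (hC : ∀ y ∈ Set.Icc 0 T, |g y| ≤ C) :
    |jacobiFunctional a b X g| ≤ C * T ^ (b + 1) := by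
  have hC0 : 0 ≤ C := (abs_nonneg _).trans (hC 0 ⟨le_rfl, hT⟩)
  have key : ∀ Y, 0 ≤ Y → Y ≤ X → Y ≤ T →
      |∫ y in (0 : ℝ)..Y, y ^ b * (1 - y / X) ^ a * g y| ≤ C * T ^ (b + 1) := by
    intro Y hY0 hYX hYT
    have h := intervalIntegral.norm_integral_le_of_norm_le_const (a := 0) (b := Y)
      (f := fun y => y ^ b * (1 - y / X) ^ a * g y) (C := T ^ b * C) fun y hy => by
        rw [Set.uIoc_of_le hY0] at hy
        have hyX : y ∈ Set.Icc 0 X := ⟨hy.1.le, hy.2.trans hYX⟩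
        rw [Real.norm_eq_abs, abs_mul, abs_of_nonneg (jacobiFunctional_weight_nonneg b hX hyX)]
        refine mul_le_mul ((jacobiFunctional_weight_le ha b hX hyX).trans
          (pow_le_pow_left₀ hy.1.le (hy.2.trans hYT) b)) (hC y ⟨hy.1.le, hy.2.trans hYT⟩)
          (abs_nonneg _) (by positivity)
    rw [Real.norm_eq_abs, sub_zero, abs_of_nonneg hY0] at h
    calc _ ≤ T ^ b * C * Y := h
      _ ≤ T ^ b * C * T := by gcongr
      _ = _ := by ring
  rcases le_total T X with h | h
  · rw [jacobiFunctional_eq_of_support ha h hg hgT]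
    exact key T hT h le_rfl
  · exact key X hX.le le_rfl h

theorem abs_jacobiPoly_le {R : ℝ} (ha : 0 ≤ a) (hX : 0 < X) {j : ℕ}
    (hR : jacobiEig a b j ≤ R * X) {y : ℝ} (hy : 0 ≤ y) (hyT : y ≤ T) :
    |jacobiPoly a b X j y| ≤ Real.exp (R * T) := by
  have hR0 : 0 ≤ R := nonneg_of_mul_nonneg_left ((jacobiEig_nonneg ha b j).trans hR) hX
  refine (Finset.abs_sum_le_sum_abs _ _).trans
    (le_trans ?_ (Real.sum_le_exp_of_nonneg (mul_nonneg hR0 (hy.trans hyT)) (j + 1)))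
  refine Finset.sum_le_sum fun k _ => ?_
  rw [abs_mul, abs_of_nonneg (pow_nonneg hy k), mul_pow, mul_div_right_comm]
  exact mul_le_mul (abs_jacobiCoeff_le ha hX hR k) (pow_le_pow_left₀ hy hyT k) (by positivity)
    (by positivity)

theorem jacobiKernel_eq_zero (a : ℝ) (b : ℕ) (X : ℝ) {n p : ℕ} (hp : n ≤ p) (q : ℕ) :
    jacobiKernel n a b X p q = 0 := by
  refine Finset.sum_eq_zero fun j hj => ?_
  rw [jacobiCoeff_eq_zero a b X (lt_of_lt_of_le (Finset.mem_range.1 hj) hp)]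
  ring

theorem jacobiKernel_comm (n : ℕ) (a : ℝ) (b : ℕ) (X : ℝ) (p q : ℕ) :
    jacobiKernel n a b X p q = jacobiKernel n a b X q p :=
  Finset.sum_congr rfl fun j _ => by ring

theorem jacobiKernel_zero (n : ℕ) (a : ℝ) (b : ℕ) (X : ℝ) :
    jacobiKernel n a b X 0 0 = ∑ j ∈ Finset.range n, jacobiInvNorm a b X j := by
  simp [jacobiKernel, jacobiCoeff_zero]

theorem abs_jacobiKernel_le {R : ℝ} (ha : 0 ≤ a) (hX : 0 < X) {n : ℕ}
    (hR : ∀ j < n, jacobiEig a b j ≤ R * X) (p q : ℕ) :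
    |jacobiKernel n a b X p q| ≤
      jacobiKernel n a b X 0 0 * (R ^ p / p.factorial * (R ^ q / q.factorial)) := by
  rw [jacobiKernel_zero, Finset.sum_mul]
  refine (Finset.abs_sum_le_sum_abs _ _).trans (Finset.sum_le_sum fun j hj => ?_)
  have hRj := hR j (Finset.mem_range.1 hj)
  rw [abs_mul, abs_mul, abs_of_pos (jacobiInvNorm_pos ha b hX j)]
  have h := abs_jacobiCoeff_le ha hX hRj
  exact mul_le_mul_of_nonneg_left (mul_le_mul (h p) (h q) (abs_nonneg _)
    ((abs_nonneg _).trans (h p))) (jacobiInvNorm_pos ha b hX j).le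

end Functional

section Limits

variable {a : ℕ → ℝ} {b : ℕ} {g : ℝ → ℝ} {T : ℝ}

/-- On a bounded interval the factor `(1 - y / X) ^ a` of the weight tends to `1`, since `a n` is
negligible compared with the hard edge scale. -/
theorem tendsto_jacobiFunctional (ha : ∀ n, 0 ≤ a n) (hT : 0 ≤ T) (hg : Continuous g)
    (hgT : ∀ y, T ≤ y → g y = 0) :
    Tendsto (fun n => jacobiFunctional (a n) b (hardEdgeScale a n) g) atTop
      (𝓝 (∫ y in (0 : ℝ)..T, y ^ b * g y)) := by
  have hX := tendsto_hardEdgeScale ha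
  have h := intervalIntegral.tendsto_integral_filter_of_dominated_convergence (μ := volume)
    (a := 0) (b := T) (l := atTop)
    (F := fun n y => y ^ b * (1 - y / hardEdgeScale a n) ^ a n * g y) (f := fun y => y ^ b * g y)
    (fun y => |y ^ b * g y|) ?_ ?_ ?_ ?_
  · refine h.congr' ?_
    filter_upwards [hX.eventually_ge_atTop T] with n hn
    exact (jacobiFunctional_eq_of_support (ha n) hn hg hgT).symm
  · exact Eventually.of_forall fun n => ((continuous_jacobiFunctional_weight (ha n) b _).mul
      hg).aestronglyMeasurable
  · filter_upwards [hX.eventually_ge_atTop T, hX.eventually_gt_atTop 0] with n hn hn0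
    refine Eventually.of_forall fun y hy => ?_
    rw [Set.uIoc_of_le hT] at hy
    have hyX : y ∈ Set.Icc 0 (hardEdgeScale a n) := ⟨hy.1.le, hy.2.trans hn⟩
    rw [norm_mul, abs_mul, Real.norm_eq_abs, Real.norm_eq_abs,
      abs_of_nonneg (jacobiFunctional_weight_nonneg b hn0 hyX), abs_of_nonneg (pow_nonneg hy.1.le b)]
    exact mul_le_mul_of_nonneg_right (jacobiFunctional_weight_le (ha n) b hn0 hyX) (abs_nonneg _)
  · exact Continuous.intervalIntegrable (by fun_prop) _ _
  · refine Eventually.of_forall fun y hy => ?_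
    rw [Set.uIoc_of_le hT] at hy
    refine Tendsto.mul_const _ ?_
    have h1 : Tendsto (fun n => (1 - y / hardEdgeScale a n) ^ a n) atTop (𝓝 1) := by
      have h2 : Tendsto (fun n => 1 - 2 * y * (a n / hardEdgeScale a n)) atTop (𝓝 1) := by
        have := tendsto_div_hardEdgeScale ha 1 0 zero_le_one le_rfl ha fun n => by
          linarith [(Nat.cast_nonneg n : (0 : ℝ) ≤ n)]
        simpa using (this.const_mul (2 * y)).const_sub 1
      have h3 : Tendsto (fun n => y / hardEdgeScale a n) atTop (𝓝 0) := hX.const_div_atTop y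
      refine tendsto_of_tendsto_of_tendsto_of_le_of_le' h2 tendsto_const_nhds ?_ ?_
      · filter_upwards [h3.eventually_le_const (show (0 : ℝ) < 1 / 2 by norm_num),
          hX.eventually_gt_atTop 0] with n hn hn0
        exact le_trans (le_of_eq (by ring))
          (one_sub_two_mul_le_rpow (ha n) (div_nonneg hy.1.le hn0.le) hn)
      · filter_upwards [h3.eventually_le_const (show (0 : ℝ) < 1 / 2 by norm_num),
          hX.eventually_gt_atTop 0] with n hn hn0
        have : 0 ≤ y / hardEdgeScale a n := div_nonneg hy.1.le hn0.le
        exact Real.rpow_le_one (by linarith) (by linarith) (ha n)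
    simpa using h1.const_mul (y ^ b)

theorem exists_jacobiKernel_zero_le (ha : ∀ n, 0 ≤ a n) (b : ℕ) : ∃ K : ℝ, 0 ≤ K ∧
    ∀ᶠ n in atTop, jacobiKernel n (a n) b (hardEdgeScale a n) 0 0 ≤ K := by
  obtain ⟨L, hL⟩ := exists_tendsto_jacobiKernel ha b 0 0
  refine ⟨max (L + 1) 0, le_max_right _ _, ?_⟩
  filter_upwards [hL.eventually_le_const (lt_add_one L)] with n hn
  exact hn.trans (le_max_left _ _)

theorem summable_succ_mul_pow_div_factorial (x : ℝ) (hx : 0 ≤ x) :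
    Summable fun p : ℕ => ((p : ℝ) + 1) * (x ^ p / p.factorial) := by
  refine Summable.of_nonneg_of_le (fun p => by positivity) (fun p => ?_)
    (Real.summable_pow_div_factorial (2 * x))
  have h : ((p : ℝ) + 1) ≤ 2 ^ p := by exact_mod_cast Nat.lt_two_pow_self
  calc _ ≤ 2 ^ p * (x ^ p / p.factorial) := by gcongr
    _ = _ := by rw [mul_pow]; ring

/-- Convergence of the expectations of products over the rescaled eigenvalues. -/
theorem exists_tendsto_hankel_ratio (ha : ∀ n, 0 ≤ a n) (b : ℕ) (hT : 0 ≤ T) (hg : Continuous g)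
    (hgT : ∀ y, T ≤ y → g y = 0) {C : ℝ} (hC : ∀ y, |g y| ≤ C) :
    ∃ L : ℝ, Tendsto (fun n => (jacobiHankel n (a n) b (hardEdgeScale a n) fun y => 1 + g y).det /
      (jacobiHankel n (a n) b (hardEdgeScale a n) fun _ => 1).det) atTop (𝓝 L) := by
  have hC0 : 0 ≤ C := (abs_nonneg _).trans (hC 0)
  obtain ⟨K, hK0, hK⟩ := exists_jacobiKernel_zero_le ha b
  set X := hardEdgeScale a with hX
  set R : ℝ := b + 1 with hR
  have hR0 : 0 ≤ R := by positivity
  set G : ℕ → ℕ → ℝ := fun n k => jacobiFunctional (a n) b (X n) fun y => y ^ k * g y with hG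
  set A : ℕ → ℕ → ℕ → ℝ := fun n p r =>
    ∑ q ∈ Finset.range n, jacobiKernel n (a n) b (X n) p q * G n (q + r) with hA
  have hGb : ∀ n, 0 < n → ∀ q r, |G n (q + r)| ≤ C * T ^ (b + 1) * T ^ r * T ^ q := by
    intro n hn q r
    have := abs_jacobiFunctional_le (b := b) (g := fun y => y ^ (q + r) * g y)
      (C := T ^ (q + r) * C) (ha n) (hardEdgeScale_pos ha hn) hT (by fun_prop)
      (fun y hy => by rw [hgT y hy, mul_zero]) fun y hy => by
        rw [abs_mul, abs_of_nonneg (pow_nonneg hy.1 _)]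
        exact mul_le_mul (pow_le_pow_left₀ hy.1 hy.2 _) (hC y) (abs_nonneg _)
          (pow_nonneg hT _)
    refine this.trans (le_of_eq ?_)
    rw [pow_add]
    ring
  have hQb : ∀ᶠ n in atTop, ∀ p q, |jacobiKernel n (a n) b (X n) p q| ≤
      K * (R ^ p / p.factorial * (R ^ q / q.factorial)) := by
    filter_upwards [hK, eventually_gt_atTop 0] with n hn hn0 p q
    refine (abs_jacobiKernel_le (ha n) (hardEdgeScale_pos ha hn0)
      (fun j hj => jacobiEig_le_mul_hardEdgeScale ha b hj.le) p q).trans ?_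
    exact mul_le_mul_of_nonneg_right hn (by positivity)
  have hprod : ∀ᶠ n in atTop, ∀ p r q, |jacobiKernel n (a n) b (X n) p q * G n (q + r)| ≤
      K * C * T ^ (b + 1) * (R ^ p / p.factorial) * T ^ r * ((R * T) ^ q / q.factorial) := by
    filter_upwards [hQb, eventually_gt_atTop 0] with n hn hn0 p r q
    rw [abs_mul]
    refine (mul_le_mul (hn p q) (hGb n hn0 q r) (abs_nonneg _) (by positivity)).trans
      (le_of_eq ?_)
    rw [mul_pow]
    ring
  have hdet : ∀ n, 0 < n → (jacobiHankel n (a n) b (X n) fun y => 1 + g y).det /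
      (jacobiHankel n (a n) b (X n) fun _ => 1).det =
      (1 + Matrix.of fun p q : Fin n => A n p q).det := by
    intro n hn
    rw [jacobiHankel_ratio_eq_det (ha n) (hardEdgeScale_pos ha hn) hg]
    congr 2
    ext p r
    rw [Matrix.mul_apply, Matrix.of_apply, hA]
    exact Fin.sum_univ_eq_sum_range
      (fun q => jacobiKernel n (a n) b (X n) p q * G n (q + r)) n
  suffices h : ∃ L : ℝ, Tendsto (fun n => (1 + Matrix.of fun p q : Fin n => A n p q).det) atTop
      (𝓝 L) by
    obtain ⟨L, hL⟩ := h
    exact ⟨L, hL.congr' ((eventually_gt_atTop 0).mono fun n hn => (hdet n hn).symm)⟩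
  refine exists_tendsto_det_one_add
    (u := fun p => K * C * T ^ (b + 1) * Real.exp (R * T) * (R ^ p / p.factorial))
    (v := fun r => T ^ r) ?_ ?_ ?_ ?_
  · intro n p r hp
    exact Finset.sum_eq_zero fun q _ => by rw [jacobiKernel_eq_zero _ _ _ hp, zero_mul]
  · filter_upwards [hprod] with n hn p r
    refine (Finset.abs_sum_le_sum_abs _ _).trans
      ((Finset.sum_le_sum fun q _ => hn p r q).trans ?_)
    rw [← Finset.mul_sum]
    calc _ ≤ K * C * T ^ (b + 1) * (R ^ p / p.factorial) * T ^ r * Real.exp (R * T) :=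
          mul_le_mul_of_nonneg_left (Real.sum_le_exp_of_nonneg (by positivity) n) (by positivity)
      _ = _ := by ring
  · have h := (summable_succ_mul_pow_div_factorial (R * T) (by positivity)).mul_left
      (K * C * T ^ (b + 1) * Real.exp (R * T))
    refine h.congr fun p => ?_
    rw [mul_pow]
    ring
  · intro p r
    choose Q hQ using fun q => exists_tendsto_jacobiKernel ha b p q
    refine ⟨∑' q, Q q * ∫ y in (0 : ℝ)..T, y ^ b * (y ^ (q + r) * g y), ?_⟩
    have ht := tendsto_tsum_of_dominated_convergence (𝓕 := atTop)
      (f := fun n q => jacobiKernel n (a n) b (X n) p q * G n (q + r))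
      (g := fun q => Q q * ∫ y in (0 : ℝ)..T, y ^ b * (y ^ (q + r) * g y))
      ((Real.summable_pow_div_factorial (R * T)).mul_left
        (K * C * T ^ (b + 1) * (R ^ p / p.factorial) * T ^ r)) (fun q => ?_) ?_
    · refine ht.congr fun n => ?_
      refine tsum_eq_sum fun q hq => ?_
      rw [jacobiKernel_comm, jacobiKernel_eq_zero _ _ _ (by simpa using hq), zero_mul]
    · exact (hQ q).mul (tendsto_jacobiFunctional ha hT (by fun_prop)
        fun y hy => by rw [hgT y hy, mul_zero])
    · filter_upwards [hprod] with n hn q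
      exact hn p r q

/-- The mean number of rescaled eigenvalues in a bounded interval stays bounded. -/
theorem exists_jacobiMean_le (ha : ∀ n, 0 ≤ a n) (b : ℕ) (hT : 0 ≤ T) (hg : Continuous g)
    (hgT : ∀ y, T ≤ y → g y = 0) {C : ℝ} (hC : ∀ y, |g y| ≤ C) :
    ∃ K : ℝ, ∀ᶠ n in atTop, jacobiMean n (a n) b (hardEdgeScale a n) g ≤ K := by
  have hC0 : 0 ≤ C := (abs_nonneg _).trans (hC 0)
  obtain ⟨K, hK0, hK⟩ := exists_jacobiKernel_zero_le ha b
  refine ⟨K * (Real.exp ((b + 1) * T) ^ 2 * C * T ^ (b + 1)), ?_⟩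
  filter_upwards [hK, eventually_gt_atTop 0] with n hn hn0
  have hX := hardEdgeScale_pos ha hn0
  rw [jacobiKernel_zero] at hn
  refine le_trans ?_ (mul_le_mul_of_nonneg_right hn (by positivity))
  rw [jacobiMean, Finset.sum_mul]
  refine Finset.sum_le_sum fun j hj => mul_le_mul_of_nonneg_left ?_
    (jacobiInvNorm_pos (ha n) b hX j).le
  have hcP := continuous_jacobiPoly (a n) b (hardEdgeScale a n) j
  refine (le_abs_self _).trans (abs_jacobiFunctional_le (ha n) hX hT (by fun_prop)
    (fun y hy => by rw [hgT y hy, mul_zero]) fun y hy => ?_)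
  rw [abs_mul, abs_pow]
  exact mul_le_mul (pow_le_pow_left₀ (abs_nonneg _) (abs_jacobiPoly_le (ha n) hX
    (jacobiEig_le_mul_hardEdgeScale ha b (Finset.mem_range.1 hj).le) hy.1 hy.2) 2) (hC y)
    (abs_nonneg _) (by positivity)

end Limits

section LowerBound

/-- The Jacobi polynomial of degree `j` stays close to its value `1` at the origin on the scale
`X / θ j`. -/
theorem jacobiPoly_ge_half {a X : ℝ} {b j : ℕ} (ha : 0 ≤ a) (hX : 0 < X) {y : ℝ} (hy : 0 ≤ y)
    (hyj : jacobiEig a b j * y ≤ X / 4) : 1 / 2 ≤ jacobiPoly a b X j y := by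
  rw [jacobiPoly, Finset.sum_range_succ', jacobiCoeff_zero, pow_zero, one_mul]
  have h0 : ∀ m : ℕ, ∑ k ∈ Finset.range m, (1 / 4 : ℝ) ^ (k + 1) = (1 - (1 / 4) ^ m) / 3 := by
    intro m
    induction m with
    | zero => simp
    | succ m ih => rw [Finset.sum_range_succ, ih]; ring
  have hR : jacobiEig a b j ≤ jacobiEig a b j / X * X := by rw [div_mul_cancel₀ _ hX.ne']
  have hx : jacobiEig a b j / X * y ≤ 1 / 4 := by
    rw [div_mul_eq_mul_div, div_le_iff₀ hX]
    linarith
  have hx0 : 0 ≤ jacobiEig a b j / X * y :=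
    mul_nonneg (div_nonneg (jacobiEig_nonneg ha b j) hX.le) hy
  have h1 : |∑ k ∈ Finset.range j, jacobiCoeff a b X j (k + 1) * y ^ (k + 1)| ≤
      ∑ k ∈ Finset.range j, (1 / 4 : ℝ) ^ (k + 1) := by
    refine (Finset.abs_sum_le_sum_abs _ _).trans (Finset.sum_le_sum fun k _ => ?_)
    rw [abs_mul, abs_of_nonneg (pow_nonneg hy _)]
    have hfac : (1 : ℝ) ≤ (k + 1).factorial := by exact_mod_cast Nat.factorial_pos _
    have hnn : 0 ≤ (jacobiEig a b j / X) ^ (k + 1) :=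
      pow_nonneg (div_nonneg (jacobiEig_nonneg ha b j) hX.le) _
    calc _ ≤ (jacobiEig a b j / X) ^ (k + 1) * y ^ (k + 1) := by
          refine mul_le_mul_of_nonneg_right ?_ (pow_nonneg hy _)
          exact (abs_jacobiCoeff_le ha hX hR (k + 1)).trans (div_le_self hnn hfac)
      _ = (jacobiEig a b j / X * y) ^ (k + 1) := by rw [mul_pow]
      _ ≤ _ := pow_le_pow_left₀ hx0 hx _
  rw [h0] at h1
  have h2 : (0 : ℝ) ≤ (1 / 4) ^ j := by positivity
  linarith [neg_abs_le (∑ k ∈ Finset.range j, jacobiCoeff a b X j (k + 1) * y ^ (k + 1))]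

/-- A single Jacobi polynomial of degree `j` carries mass of order at least `1 / j` below
`X / (4 * θ j)`, where it is still close to `1`. -/
theorem div_le_jacobiInvNorm_mul {a X : ℝ} {b j : ℕ} (ha : 0 ≤ a) (hX : 0 < X) (hj : 0 < j)
    {g : ℝ → ℝ} (hg : Continuous g) (hg0 : ∀ y, 0 ≤ g y)
    (hg1 : ∀ y ∈ Set.Icc 0 (X / (4 * jacobiEig a b j)), 1 ≤ g y) :
    1 / (8 * (b + 1) * (b.factorial : ℝ) ^ 2 * 4 ^ (b + 1)) * (1 / j) ≤
      jacobiInvNorm a b X j * jacobiFunctional a b X fun y => jacobiPoly a b X j y ^ 2 * g y := by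
  set θ := jacobiEig a b j with hθ
  have hj1 : (1 : ℝ) ≤ j := Nat.one_le_cast.2 hj
  have hb : (0 : ℝ) ≤ b := Nat.cast_nonneg b
  have hθa : 1 + a ≤ θ := by
    rw [hθ, jacobiEig]
    nlinarith [mul_nonneg (sub_nonneg.2 hj1) (by positivity : (0 : ℝ) ≤ j + a + b + 1)]
  have hθ0 : 0 < θ := by linarith
  set Y := X / (4 * θ) with hY
  have hY0 : 0 < Y := by positivity
  have hYX : Y ≤ X := div_le_self hX.le (by linarith)
  have hint : 1 / 8 * (Y ^ (b + 1) / (b + 1)) ≤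
      jacobiFunctional a b X fun y => jacobiPoly a b X j y ^ 2 * g y := by
    have hcP := continuous_jacobiPoly a b X j
    have h1 : ∫ y in (0 : ℝ)..Y, 1 / 8 * y ^ b = 1 / 8 * (Y ^ (b + 1) / (b + 1)) := by
      rw [intervalIntegral.integral_const_mul, integral_pow]
      simp
    have hI := fun Z => ((continuous_jacobiFunctional_weight ha b X).mul
      ((hcP.pow 2).mul hg)).intervalIntegrable (μ := volume) 0 Z
    rw [← h1]
    refine le_trans (intervalIntegral.integral_mono_on hY0.le
      ((continuous_const.mul (continuous_pow b)).intervalIntegrable _ _) (hI Y) fun y hy => ?_)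
      (intervalIntegral.integral_mono_interval le_rfl hY0.le hYX ?_ (hI X))
    · have hyθ : θ * y ≤ X / 4 := by
        have := mul_le_mul_of_nonneg_left hy.2 hθ0.le
        rw [hY] at this
        calc _ ≤ _ := this
          _ = _ := by field_simp
      have hP := jacobiPoly_ge_half ha hX hy.1 hyθ
      have hu : y / X ≤ 1 / 2 := by
        rw [div_le_iff₀ hX]; nlinarith [hy.1]
      have hw : 1 / 2 ≤ (1 - y / X) ^ a := by
        refine le_trans ?_ (one_sub_two_mul_le_rpow ha (div_nonneg hy.1 hX.le) hu)
        have : a * (y / X) ≤ 1 / 4 := by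
          rw [← mul_div_assoc, div_le_iff₀ hX]
          nlinarith [hy.1]
        linarith
      have hP2 : 1 / 4 ≤ jacobiPoly a b X j y ^ 2 := by nlinarith
      have hg1y := hg1 y hy
      have h3 : 1 / 8 ≤ (1 - y / X) ^ a * (jacobiPoly a b X j y ^ 2 * g y) := by
        calc (1 / 8 : ℝ) = 1 / 2 * (1 / 4 * 1) := by norm_num
          _ ≤ _ := by gcongr
      calc 1 / 8 * y ^ b ≤ ((1 - y / X) ^ a * (jacobiPoly a b X j y ^ 2 * g y)) * y ^ b :=
            mul_le_mul_of_nonneg_right h3 (pow_nonneg hy.1 b)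
        _ = _ := by simp only [Pi.mul_apply, Pi.pow_apply]; ring
    · refine (ae_restrict_iff' measurableSet_Ioc).2 (Eventually.of_forall fun y hy => ?_)
      exact mul_nonneg (jacobiFunctional_weight_nonneg b hX ⟨hy.1.le, hy.2⟩)
        (mul_nonneg (sq_nonneg _) (hg0 y))
  have hnorm : (2 * j + a + b + 1) * θ ^ b / ((b.factorial : ℝ) ^ 2 * X ^ (b + 1)) ≤
      jacobiInvNorm a b X j := by
    rw [jacobiInvNorm]
    refine div_le_div_of_nonneg_right (mul_le_mul_of_nonneg_left ?_ (by positivity)) (by positivity)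
    rw [← hθ]
    nth_rewrite 1 [← Finset.card_range b]
    rw [← Finset.prod_const]
    refine Finset.prod_le_prod (fun _ _ => hθ0.le) fun i hi => ?_
    have hi : (i : ℝ) + 1 ≤ b := by exact_mod_cast Finset.mem_range.1 hi
    have hi0 : (0 : ℝ) ≤ i := Nat.cast_nonneg i
    have : 0 ≤ (i + 1 : ℝ) * (a + b - i) := mul_nonneg (by linarith) (by linarith)
    linarith
  refine le_trans ?_ (mul_le_mul hnorm hint (by positivity) (jacobiInvNorm_pos ha b hX j).le)
  have h4 : (2 * j + a + b + 1) * θ ^ b / ((b.factorial : ℝ) ^ 2 * X ^ (b + 1)) *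
      (1 / 8 * (Y ^ (b + 1) / (b + 1))) =
      1 / (8 * (b + 1) * (b.factorial : ℝ) ^ 2 * 4 ^ (b + 1)) * ((2 * j + a + b + 1) / θ) := by
    rw [hY, div_pow, mul_pow, pow_succ θ]
    have : (b.factorial : ℝ) ≠ 0 := by positivity
    field_simp
  rw [h4]
  refine mul_le_mul_of_nonneg_left ?_ (by positivity)
  rw [div_le_div_iff₀ (by linarith) hθ0, hθ, jacobiEig]
  nlinarith

theorem log_sub_log_le_sum_inv {m n : ℕ} (hm : 0 < m) (hmn : m ≤ n) :
    Real.log n - Real.log m ≤ ∑ j ∈ Finset.Ico m n, (1 / (j : ℝ)) := by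
  induction n, hmn using Nat.le_induction with
  | base => simp
  | succ n hmn ih =>
    rw [Finset.sum_Ico_succ_top hmn]
    have hn : (0 : ℝ) < n := Nat.cast_pos.2 (by omega)
    have h := Real.log_le_sub_one_of_pos (show 0 < ((n + 1 : ℕ) : ℝ) / n by positivity)
    rw [Real.log_div (by positivity) hn.ne'] at h
    have h2 : ((n + 1 : ℕ) : ℝ) / n - 1 = 1 / n := by push_cast; field_simp; ring
    linarith

/-- The mean number of rescaled eigenvalues in a large interval is large. -/
theorem exists_le_jacobiMean {a : ℕ → ℝ} (ha : ∀ n, 0 ≤ a n) (b : ℕ) (L : ℝ) :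
    ∃ Y : ℝ, 0 < Y ∧ ∀ g : ℝ → ℝ, Continuous g → (∀ y, 0 ≤ g y) →
      (∀ y ∈ Set.Icc 0 Y, 1 ≤ g y) →
      ∀ᶠ n in atTop, L ≤ jacobiMean n (a n) b (hardEdgeScale a n) g := by
  set c : ℝ := 1 / (8 * (b + 1) * (b.factorial : ℝ) ^ 2 * 4 ^ (b + 1)) with hc
  have hc0 : 0 < c := by positivity
  obtain ⟨κ, hκL, hκ2⟩ : ∃ κ : ℕ, L ≤ c * (Real.log κ - Real.log 2) ∧ 2 ≤ κ := by
    have h1 : Tendsto (fun κ : ℕ => c * (Real.log κ - Real.log 2)) atTop atTop :=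
      (tendsto_atTop_add_const_right _ _
        (Real.tendsto_log_atTop.comp tendsto_natCast_atTop_atTop)).const_mul_atTop hc0
    exact ((h1.eventually_ge_atTop L).and (eventually_ge_atTop 2)).exists
  have hκ : (2 : ℝ) ≤ κ := by exact_mod_cast hκ2
  refine ⟨(κ : ℝ) ^ 2 / 2, by positivity, fun g hg hg0 hg1 => ?_⟩
  filter_upwards [eventually_ge_atTop κ] with n hn
  have hn0 : 0 < n := by omega
  have hn0' : (0 : ℝ) < n := Nat.cast_pos.2 hn0
  have hX := hardEdgeScale_pos ha hn0
  have han := ha n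
  -- the degrees `j` from about `n / κ` to `n` contribute `c / j` each, about `c * log κ` in total
  set m := n / κ + 1 with hm
  have hmn : m ≤ n := by
    have : n / κ ≤ n / 2 := Nat.div_le_div_left hκ2 (by norm_num)
    omega
  have hmlow : (n : ℝ) / κ ≤ m := by
    rw [hm]; push_cast
    exact (Nat.lt_floor_add_one _).le.trans (by rw [Nat.floor_div_eq_div])
  have hmup : (m : ℝ) ≤ 2 * n / κ := by
    have h1 : ((n / κ : ℕ) : ℝ) ≤ n / κ := Nat.cast_div_le
    have h2 : (1 : ℝ) ≤ n / κ := (one_le_div (by linarith)).2 (by exact_mod_cast hn)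
    rw [hm]; push_cast
    calc _ ≤ (n : ℝ) / κ + n / κ := add_le_add h1 h2
      _ = _ := by ring
  have hterm : ∀ j ∈ Finset.Ico m n, c * (1 / (j : ℝ)) ≤ jacobiInvNorm (a n) b (hardEdgeScale a n) j *
      jacobiFunctional (a n) b (hardEdgeScale a n)
        fun y => jacobiPoly (a n) b (hardEdgeScale a n) j y ^ 2 * g y := by
    intro j hj
    have hjm : m ≤ j := (Finset.mem_Ico.1 hj).1
    have hj0 : 0 < j := lt_of_lt_of_le (Nat.succ_pos _) hjm
    refine div_le_jacobiInvNorm_mul han hX hj0 hg hg0 fun y hy => hg1 y ⟨hy.1, hy.2.trans ?_⟩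
    have hjn : (n : ℝ) / κ ≤ j := hmlow.trans (by exact_mod_cast hjm)
    have hθ : (n : ℝ) * (n + a n) / κ ^ 2 ≤ jacobiEig (a n) b j := by
      have h1 : ((n : ℝ) + a n) / κ ≤ j + a n + b + 1 := by
        rw [add_div]
        have : a n / κ ≤ a n := div_le_self han (by linarith)
        have : (0 : ℝ) ≤ b := Nat.cast_nonneg b
        linarith
      calc (n : ℝ) * (n + a n) / κ ^ 2 = n / κ * ((n + a n) / κ) := by field_simp
        _ ≤ j * (j + a n + b + 1) := by gcongr
        _ = _ := rfl
    have hθ0 : 0 < jacobiEig (a n) b j := lt_of_lt_of_le (by positivity) hθ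
    rw [div_le_div_iff₀ (by linarith) two_pos]
    rw [div_le_iff₀ (by positivity)] at hθ
    unfold hardEdgeScale
    linarith
  have hlog := log_sub_log_le_sum_inv (Nat.succ_pos _) hmn
  have hm0 : (0 : ℝ) < m := by positivity
  have hlogm : Real.log m ≤ Real.log 2 + Real.log n - Real.log κ := by
    rw [← Real.log_mul two_ne_zero hn0'.ne', ← Real.log_div (by positivity) (by linarith)]
    exact Real.log_le_log hm0 hmup
  calc L ≤ c * (Real.log κ - Real.log 2) := hκL
    _ ≤ c * ∑ j ∈ Finset.Ico m n, (1 / (j : ℝ)) :=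
        mul_le_mul_of_nonneg_left (by linarith) hc0.le
    _ ≤ ∑ j ∈ Finset.Ico m n, jacobiInvNorm (a n) b (hardEdgeScale a n) j *
        jacobiFunctional (a n) b (hardEdgeScale a n)
          fun y => jacobiPoly (a n) b (hardEdgeScale a n) j y ^ 2 * g y := by
        rw [Finset.mul_sum]; exact Finset.sum_le_sum hterm
    _ ≤ _ := by
        refine Finset.sum_le_sum_of_subset_of_nonneg (fun j hj => ?_) fun j _ _ => ?_
        · exact Finset.mem_range.2 (Finset.mem_Ico.1 hj).2
        · exact mul_nonneg (jacobiInvNorm_pos han b hX j).le (jacobiFunctional_nonneg b hX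
            fun y _ => mul_nonneg (sq_nonneg _) (hg0 y))

end LowerBound

/-! ### Convergence in law from product functionals -/

/-- Test functions with values in `[0, 1]` that equal `1` outside a set bounded above. -/
structure IsEdgeTest (f : ℝ → ℝ) : Prop where
  continuous : Continuous f
  nonneg : ∀ y, 0 ≤ f y
  le_one : ∀ y, f y ≤ 1
  eq_one : ∃ T : ℝ, 0 < T ∧ ∀ y, T ≤ y → f y = 1

/-- The infinite product of `f` over the entries of a sequence, for `f` with values in `[0, 1]`. -/
noncomputable def edgeProduct (f : ℝ → ℝ) (y : ℕ → ℝ) : ℝ := ⨅ K : ℕ, ∏ i ∈ Finset.range K, f (y i)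

namespace IsEdgeTest

variable {f g : ℝ → ℝ}

theorem one : IsEdgeTest fun _ => 1 :=
  ⟨continuous_const, fun _ => zero_le_one, fun _ => le_rfl, 1, one_pos, fun _ _ => rfl⟩

theorem mul (hf : IsEdgeTest f) (hg : IsEdgeTest g) : IsEdgeTest fun y => f y * g y := by
  obtain ⟨T, hT, hfT⟩ := hf.eq_one
  obtain ⟨S, hS, hgS⟩ := hg.eq_one
  refine ⟨hf.continuous.mul hg.continuous, fun y => mul_nonneg (hf.nonneg y) (hg.nonneg y),
    fun y => mul_le_one₀ (hf.le_one y) (hg.nonneg y) (hg.le_one y), max T S,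
    lt_max_of_lt_left hT, fun y hy => ?_⟩
  rw [hfT y ((le_max_left _ _).trans hy), hgS y ((le_max_right _ _).trans hy), one_mul]

/-- A ramp bounded by `1 / 2` is subtracted, so that the test function stays positive and its
products count the entries below `q`. -/
theorem ramp (q : ℝ) (j : ℕ) : IsEdgeTest fun y => 1 - ramp q j y / 2 := by
  refine ⟨by have := continuous_ramp q j; fun_prop, fun y => ?_, fun y => ?_, max q 1,
    lt_max_of_lt_right one_pos, fun y hy => ?_⟩
  · linarith [ramp_le_one q j y]
  · linarith [ramp_nonneg q j y]
  · rw [ramp_eq_zero j ((le_max_left _ _).trans hy)]; norm_num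

theorem prod_nonneg (hf : IsEdgeTest f) (s : Finset ℕ) (y : ℕ → ℝ) : 0 ≤ ∏ i ∈ s, f (y i) :=
  Finset.prod_nonneg fun _ _ => hf.nonneg _

theorem prod_le_one (hf : IsEdgeTest f) (s : Finset ℕ) (y : ℕ → ℝ) : ∏ i ∈ s, f (y i) ≤ 1 :=
  Finset.prod_le_one (fun _ _ => hf.nonneg _) fun _ _ => hf.le_one _

theorem bddBelow (hf : IsEdgeTest f) (y : ℕ → ℝ) :
    BddBelow (Set.range fun K : ℕ => ∏ i ∈ Finset.range K, f (y i)) :=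
  ⟨0, by rintro _ ⟨K, rfl⟩; exact hf.prod_nonneg _ y⟩

theorem tendsto_edgeProduct (hf : IsEdgeTest f) (y : ℕ → ℝ) :
    Tendsto (fun K : ℕ => ∏ i ∈ Finset.range K, f (y i)) atTop (𝓝 (edgeProduct f y)) := by
  refine tendsto_atTop_ciInf (antitone_nat_of_succ_le fun K => ?_) (hf.bddBelow y)
  rw [Finset.prod_range_succ]
  exact mul_le_of_le_one_right (hf.prod_nonneg _ y) (hf.le_one _)

theorem edgeProduct_mem (hf : IsEdgeTest f) (y : ℕ → ℝ) : edgeProduct f y ∈ Set.Icc (0 : ℝ) 1 :=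
  ⟨le_ciInf fun _ => hf.prod_nonneg _ y, (ciInf_le (hf.bddBelow y) 0).trans (hf.prod_le_one _ y)⟩

theorem edgeProduct_mul (hf : IsEdgeTest f) (hg : IsEdgeTest g) (y : ℕ → ℝ) :
    edgeProduct (fun x => f x * g x) y = edgeProduct f y * edgeProduct g y := by
  refine tendsto_nhds_unique ((hf.mul hg).tendsto_edgeProduct y) ?_
  simp_rw [Finset.prod_mul_distrib]
  exact (hf.tendsto_edgeProduct y).mul (hg.tendsto_edgeProduct y)

theorem continuous_prod (hf : IsEdgeTest f) (K : ℕ) :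
    Continuous fun y : ℕ → ℝ => ∏ i ∈ Finset.range K, f (y i) :=
  continuous_finsetProd _ fun i _ => hf.continuous.comp (continuous_apply i)

theorem measurable_edgeProduct (hf : IsEdgeTest f) : Measurable (edgeProduct f) :=
  measurable_of_tendsto_metrizable (fun K => (hf.continuous_prod K).measurable)
    (tendsto_pi_nhds.2 fun y => hf.tendsto_edgeProduct y)

end IsEdgeTest

theorem edgeProduct_one (y : ℕ → ℝ) : edgeProduct (fun _ => 1) y = 1 := by
  simp [edgeProduct]

/-- The entries of a nondecreasing sequence are recovered from product functionals: `y k < q` means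
that at least `k + 1` entries lie below `q`. -/
theorem forall_half_pow_le_edgeProduct_iff {y : ℕ → ℝ} (hy : Monotone y) (q : ℝ) (k : ℕ) :
    (∀ j, (1 / 2 : ℝ) ^ k ≤ edgeProduct (fun x => 1 - ramp q j x / 2) y) ↔ q ≤ y k := by
  constructor
  · intro h
    by_contra! hlt
    have hev : ∀ᶠ j : ℕ in atTop, ∀ i ∈ Finset.range (k + 1), ramp q j (y i) = 1 := by
      refine (eventually_all_finset _).2 fun i hi => eventually_ramp_eq_one ?_
      exact (hy (Nat.lt_succ_iff.1 (Finset.mem_range.1 hi))).trans_lt hlt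
    obtain ⟨j, hj⟩ := hev.exists
    have h1 := (h j).trans (ciInf_le ((IsEdgeTest.ramp q j).bddBelow y) (k + 1))
    rw [Finset.prod_congr rfl fun i hi => by rw [hj i hi], Finset.prod_const, Finset.card_range,
      pow_succ] at h1
    have h2 : (0 : ℝ) < (1 / 2) ^ k := by positivity
    linarith
  · intro h j
    refine le_ciInf fun K => ?_
    have h1 : ∏ i ∈ Finset.range K, (if i < k then (1 / 2 : ℝ) else 1) ≤
        ∏ i ∈ Finset.range K, (1 - ramp q j (y i) / 2) := by
      refine Finset.prod_le_prod (fun i _ => by split_ifs <;> norm_num) fun i _ => ?_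
      split_ifs with hi
      · linarith [ramp_le_one q j (y i)]
      · rw [ramp_eq_zero j (h.trans (hy (not_lt.1 hi)))]; norm_num
    refine le_trans ?_ h1
    rw [Finset.prod_ite, Finset.prod_const, Finset.prod_const_one, mul_one]
    refine pow_le_pow_of_le_one (by norm_num) (by norm_num) ?_
    calc _ ≤ (Finset.range k).card :=
          Finset.card_le_card fun i hi => Finset.mem_range.2 (Finset.mem_filter.1 hi).2
      _ = k := Finset.card_range k

/-- The countable family of product functionals that determines a nondecreasing sequence. -/
noncomputable def edgeCode (y : ℕ → ℝ) : ℚ × ℕ → Set.Icc (0 : ℝ) 1 := fun p =>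
  ⟨edgeProduct (fun x => 1 - ramp p.1 p.2 x / 2) y, (IsEdgeTest.ramp p.1 p.2).edgeProduct_mem y⟩

theorem measurable_edgeCode : Measurable edgeCode :=
  measurable_pi_lambda _ fun p => (IsEdgeTest.ramp p.1 p.2).measurable_edgeProduct.subtype_mk

open Classical in
/-- A measurable left inverse of `edgeCode` on nondecreasing sequences: the `k`-th entry is
the supremum of the rationals below it, taken in `EReal` so that it needs no boundedness. -/
noncomputable def edgeDecode (z : ℚ × ℕ → Set.Icc (0 : ℝ) 1) : ℕ → ℝ := fun k =>
  (⨆ q : ℚ, if ∀ j, (1 / 2 : ℝ) ^ k ≤ z (q, j) then (((q : ℚ) : ℝ) : EReal) else ⊥).toReal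

theorem measurable_edgeDecode : Measurable edgeDecode := by
  refine measurable_pi_lambda _ fun k => measurable_ereal_toReal.comp (Measurable.iSup fun q => ?_)
  refine Measurable.ite ?_ measurable_const measurable_const
  simp only [Set.ofPred_forall]
  exact MeasurableSet.iInter fun j => measurableSet_le measurable_const
    (measurable_subtype_coe.comp (measurable_pi_apply (q, j)))

theorem edgeDecode_edgeCode {y : ℕ → ℝ} (hy : Monotone y) : edgeDecode (edgeCode y) = y := by
  funext k
  simp only [edgeDecode, edgeCode, forall_half_pow_le_edgeProduct_iff hy]
  have : (⨆ q : ℚ, if (q : ℝ) ≤ y k then (((q : ℚ) : ℝ) : EReal) else ⊥) = (y k : EReal) := by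
    refine le_antisymm (iSup_le fun q => ?_) (le_of_forall_lt fun c hc => ?_)
    · split_ifs with h
      · exact EReal.coe_le_coe_iff.2 h
      · exact bot_le
    · obtain ⟨q, hcq, hqy⟩ := EReal.lt_iff_exists_rat_btwn.1 hc
      refine lt_of_lt_of_le hcq (le_iSup_of_le q ?_)
      rw [if_pos (by exact_mod_cast hqy.le)]
  rw [this, EReal.toReal_coe]

/-- Laws of nondecreasing sequences are determined by the expectations of product functionals. -/
theorem ext_of_integral_edgeProduct {μ₁ μ₂ : Measure (ℕ → ℝ)} [IsProbabilityMeasure μ₁]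
    [IsProbabilityMeasure μ₂] (h₁ : ∀ᵐ y ∂μ₁, Monotone y) (h₂ : ∀ᵐ y ∂μ₂, Monotone y)
    (h : ∀ f, IsEdgeTest f → ∫ y, edgeProduct f y ∂μ₁ = ∫ y, edgeProduct f y ∂μ₂) : μ₁ = μ₂ := by
  set E := ℚ × ℕ → Set.Icc (0 : ℝ) 1
  have hback : ∀ μ : Measure (ℕ → ℝ), (∀ᵐ y ∂μ, Monotone y) →
      (μ.map edgeCode).map edgeDecode = μ := by
    intro μ hμ
    rw [Measure.map_map measurable_edgeDecode measurable_edgeCode]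
    have : edgeDecode ∘ edgeCode =ᵐ[μ] id := hμ.mono fun y hy => edgeDecode_edgeCode hy
    rw [Measure.map_congr this, Measure.map_id]
  suffices hcode : μ₁.map edgeCode = μ₂.map edgeCode by
    rw [← hback μ₁ h₁, ← hback μ₂ h₂, hcode]
  have : IsProbabilityMeasure (μ₁.map edgeCode) :=
    Measure.isProbabilityMeasure_map measurable_edgeCode.aemeasurable
  have : IsProbabilityMeasure (μ₂.map edgeCode) :=
    Measure.isProbabilityMeasure_map measurable_edgeCode.aemeasurable
  -- the algebra generated by the coordinates is spanned by codes of product functionals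
  let coord : ℚ × ℕ → BoundedContinuousFunction E ℝ := fun p =>
    BoundedContinuousFunction.mkOfCompact ⟨fun z => (z p : ℝ), by fun_prop⟩
  let A : StarSubalgebra ℝ (BoundedContinuousFunction E ℝ) :=
    { Algebra.adjoin ℝ (Set.range coord) with
      star_mem' := fun {g} hg => by
        have : star g = g := by ext z; simp
        rwa [this] }
  have hcoord : ∀ p, coord p ∈ A := fun p => Algebra.subset_adjoin ⟨p, rfl⟩
  refine ext_of_forall_mem_subalgebra_integral_eq_of_polish (𝕜 := ℝ) (A := A) ?_ ?_
  · intro z z' hz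
    obtain ⟨p, hp⟩ := Function.ne_iff.1 hz
    refine ⟨fun z => (z p : ℝ), ⟨_, ⟨coord p, hcoord p, rfl⟩, rfl⟩, ?_⟩
    exact fun h => hp (Subtype.ext h)
  · intro g hg
    have hclosure : ∀ g ∈ Submonoid.closure (Set.range coord), ∃ f, IsEdgeTest f ∧
        ∀ y, g (edgeCode y) = edgeProduct f y := by
      intro g hg
      induction hg using Submonoid.closure_induction with
      | mem g hg =>
        obtain ⟨p, rfl⟩ := hg
        exact ⟨_, IsEdgeTest.ramp p.1 p.2, fun y => rfl⟩
      | one => exact ⟨_, IsEdgeTest.one, fun y => (edgeProduct_one y).symm⟩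
      | mul g g' _ _ ihg ihg' =>
        obtain ⟨f, hf, hfg⟩ := ihg
        obtain ⟨f', hf', hfg'⟩ := ihg'
        refine ⟨_, hf.mul hf', fun y => ?_⟩
        rw [hf.edgeProduct_mul hf', ← hfg, ← hfg']
        rfl
    have hspan : g ∈ Submodule.span ℝ (Submonoid.closure (Set.range coord) :
        Set (BoundedContinuousFunction E ℝ)) := by
      rw [← Algebra.adjoin_eq_span]
      exact hg
    clear hg
    induction hspan using Submodule.span_induction with
    | mem g hg' =>
      obtain ⟨f, hf, hfg⟩ := hclosure g hg'
      rw [integral_map measurable_edgeCode.aemeasurable g.continuous.aestronglyMeasurable,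
        integral_map measurable_edgeCode.aemeasurable g.continuous.aestronglyMeasurable]
      simp_rw [hfg]
      exact h f hf
    | zero => simp
    | add g g' _ _ ihg ihg' =>
      simp only [BoundedContinuousFunction.coe_add, Pi.add_apply]
      rw [integral_add (g.integrable _) (g'.integrable _),
        integral_add (g.integrable _) (g'.integrable _), ihg, ihg']
    | smul c g _ ihg =>
      simp only [BoundedContinuousFunction.coe_smul, smul_eq_mul]
      rw [integral_const_mul, integral_const_mul, ihg]

section Limit

variable {ν : ℕ → ProbabilityMeasure (ℕ → ℝ)}

/-- Marginal tightness implies tightness of random sequences. -/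
theorem isTightMeasureSet_range_of_marginals
    (h : ∀ k : ℕ, ∀ ε : ℝ, 0 < ε → ∃ T : ℝ, ∀ᶠ n in atTop,
      (ν n : Measure (ℕ → ℝ)).real {y | T < |y k|} ≤ ε) :
    IsTightMeasureSet (Set.range fun n => (ν n : Measure (ℕ → ℝ))) := by
  have hmarg : ∀ k : ℕ, IsTightMeasureSet
      (Set.range fun n => (ν n : Measure (ℕ → ℝ)).map fun y => y k) := by
    intro k
    refine isTightMeasureSet_range_of_tendsto_limsup_measure_norm_gt ?_
    rw [ENNReal.tendsto_atTop_zero]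
    intro ε hε
    obtain ⟨δ, hδ0, hδ⟩ : ∃ δ : ℝ, 0 < δ ∧ ENNReal.ofReal δ ≤ ε := by
      rcases eq_or_ne ε ∞ with rfl | hε'
      · exact ⟨1, one_pos, le_top⟩
      · exact ⟨ε.toReal, ENNReal.toReal_pos hε.ne' hε', (ENNReal.ofReal_toReal hε').le⟩
    obtain ⟨T, hT⟩ := h k δ hδ0
    refine ⟨T, fun r hr => limsup_le_of_le ?_ ?_⟩
    · exact isCobounded_le_of_bot
    · filter_upwards [hT] with n hn
      have hm : MeasurableSet {x : ℝ | r < ‖x‖} := measurableSet_lt measurable_const measurable_norm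
      rw [Measure.map_apply (measurable_pi_apply k) hm]
      refine le_trans (measure_mono fun y hy => ?_) ((ofReal_measureReal
        (μ := (ν n : Measure (ℕ → ℝ))) (s := {y | T < |y k|})).symm.le.trans
          ((ENNReal.ofReal_le_ofReal hn).trans hδ))
      exact lt_of_le_of_lt hr hy
  rw [isTightMeasureSet_iff_exists_isCompact_measure_compl_le]
  intro ε hε
  obtain ⟨δ, hδ0, hδ⟩ := ENNReal.exists_pos_sum_of_countable' hε.ne' ℕ
  have hK := fun k => isTightMeasureSet_iff_exists_isCompact_measure_compl_le.1 (hmarg k) (δ k)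
    (hδ0 k)
  choose K hKc hK using hK
  refine ⟨Set.univ.pi K, isCompact_univ_pi hKc, ?_⟩
  rintro _ ⟨n, rfl⟩
  have hsub : (Set.univ.pi K)ᶜ ⊆ ⋃ k, (fun y : ℕ → ℝ => y k) ⁻¹' (K k)ᶜ := by
    intro y hy
    simpa [Set.mem_pi] using hy
  refine (measure_mono hsub).trans ((measure_iUnion_le _).trans ((ENNReal.tsum_le_tsum fun k => ?_).trans
    hδ.le))
  rw [← Measure.map_apply (measurable_pi_apply k) (hKc k).isClosed.measurableSet.compl]
  exact hK k _ ⟨n, rfl⟩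

/-- Along any filter finer than `atTop`, the limit law is concentrated on nondecreasing sequences.
-/
theorem ae_monotone_of_tendsto {U : Filter ℕ} [NeBot U] (hU : U ≤ atTop)
    {μ : ProbabilityMeasure (ℕ → ℝ)} (hμ : Tendsto ν U (𝓝 μ))
    (hsort : ∀ n, ∀ᵐ y ∂(ν n : Measure (ℕ → ℝ)), ∀ i j, i ≤ j → j < n → y i ≤ y j) :
    ∀ᵐ y ∂(μ : Measure (ℕ → ℝ)), Monotone y := by
  have h : ∀ i j : ℕ, i ≤ j → ∀ᵐ y ∂(μ : Measure (ℕ → ℝ)), y i ≤ y j := by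
    intro i j hij
    have hF : IsClosed {y : ℕ → ℝ | y i ≤ y j} :=
      isClosed_le (continuous_apply i) (continuous_apply j)
    have h1 := ProbabilityMeasure.limsup_measure_closed_le_of_tendsto hμ hF
    have h2 : ∀ᶠ n in U, (ν n : Measure (ℕ → ℝ)) {y | y i ≤ y j} = 1 := by
      filter_upwards [hU (eventually_gt_atTop j)] with n hn
      refine (prob_compl_eq_zero_iff hF.measurableSet).1 ?_
      exact (hsort n).mono fun y hy => hy i j hij hn
    rw [limsup_congr h2, limsup_const] at h1
    exact (prob_compl_eq_zero_iff hF.measurableSet).2 (le_antisymm prob_le_one h1)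
  have h' := ae_all_iff.2 fun i => ae_all_iff.2 fun j => ae_all_iff.2 fun hij => h i j hij
  exact h'.mono fun y hy i j hij => hy i j hij

/-- Along any filter finer than `atTop`, expectations of product functionals pass to the limit: the
factors beyond the `K`-th one differ from `1` only with probability exponentially small in `K`. -/
theorem integral_edgeProduct_of_tendsto {U : Filter ℕ} [NeBot U] (hU : U ≤ atTop)
    {μ : ProbabilityMeasure (ℕ → ℝ)} (hμ : Tendsto ν U (𝓝 μ))
    (hsort : ∀ n, ∀ᵐ y ∂(ν n : Measure (ℕ → ℝ)), ∀ i j, i ≤ j → j < n → y i ≤ y j)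
    (hup : ∀ T : ℝ, 0 < T → ∃ C : ℝ, ∀ᶠ n in atTop, ∀ k < n,
      (ν n : Measure (ℕ → ℝ)).real {y | y k ≤ T} ≤ C * (1 / 2) ^ k)
    {f : ℝ → ℝ} (hf : IsEdgeTest f) {L : ℝ}
    (hL : Tendsto (fun n => ∫ y, ∏ i ∈ Finset.range n, f (y i) ∂(ν n : Measure (ℕ → ℝ))) atTop
      (𝓝 L)) :
    ∫ y, edgeProduct f y ∂(μ : Measure (ℕ → ℝ)) = L := by
  obtain ⟨T, hT, hfT⟩ := hf.eq_one
  obtain ⟨C, hC⟩ := hup T hT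
  have hint : ∀ (m : Measure (ℕ → ℝ)) [IsProbabilityMeasure m] (K : ℕ),
      Integrable (fun y : ℕ → ℝ => ∏ i ∈ Finset.range K, f (y i)) m := fun m _ K =>
    Integrable.of_bound (hf.continuous_prod K).aestronglyMeasurable 1 (Eventually.of_forall
      fun y => by rw [Real.norm_eq_abs, abs_of_nonneg (hf.prod_nonneg _ y)]; exact hf.prod_le_one _ y)
  have hstep : ∀ n K, K < n →
      |∫ y, ∏ i ∈ Finset.range n, f (y i) ∂(ν n : Measure (ℕ → ℝ)) -
        ∫ y, ∏ i ∈ Finset.range K, f (y i) ∂(ν n : Measure (ℕ → ℝ))| ≤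
      (ν n : Measure (ℕ → ℝ)).real {y | y K ≤ T} := by
    intro n K hKn
    have hms : MeasurableSet {y : ℕ → ℝ | y K ≤ T} :=
      measurableSet_le (measurable_pi_apply K) measurable_const
    rw [← integral_sub (hint _ n) (hint _ K), ← Real.norm_eq_abs, ← integral_indicator_one hms]
    refine norm_integral_le_of_norm_le ((integrable_const 1).indicator hms) ?_
    filter_upwards [hsort n] with y hy
    rw [Real.norm_eq_abs]
    by_cases h : y K ≤ T
    · rw [Set.indicator_of_mem (show y ∈ {y : ℕ → ℝ | y K ≤ T} from h), abs_le]
      have h1 := hf.prod_nonneg (Finset.range n) y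
      have h2 := hf.prod_nonneg (Finset.range K) y
      have h3 := hf.prod_le_one (Finset.range n) y
      have h4 := hf.prod_le_one (Finset.range K) y
      constructor <;> simp <;> linarith
    · rw [Set.indicator_of_notMem (show y ∉ {y : ℕ → ℝ | y K ≤ T} from h)]
      have : ∏ i ∈ Finset.range K, f (y i) = ∏ i ∈ Finset.range n, f (y i) := by
        refine Finset.prod_subset (Finset.range_mono hKn.le) fun i hi hiK => ?_
        refine hfT _ ((not_le.1 h).le.trans (hy K i ?_ (Finset.mem_range.1 hi)))
        exact not_lt.1 fun h' => hiK (Finset.mem_range.2 h')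
      rw [this, sub_self, abs_zero]
  have hK : ∀ K : ℕ, |L - ∫ y, ∏ i ∈ Finset.range K, f (y i) ∂(μ : Measure (ℕ → ℝ))| ≤
      C * (1 / 2) ^ K := by
    intro K
    let F : BoundedContinuousFunction (ℕ → ℝ) ℝ := BoundedContinuousFunction.ofNormedAddCommGroup
      (fun y => ∏ i ∈ Finset.range K, f (y i)) (hf.continuous_prod K) 1 fun y => by
        rw [Real.norm_eq_abs, abs_of_nonneg (hf.prod_nonneg _ y)]; exact hf.prod_le_one _ y
    have hF := (ProbabilityMeasure.tendsto_iff_forall_integral_tendsto.1 hμ) F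
    refine le_of_tendsto (((hL.mono_left hU).sub hF).abs) ?_
    filter_upwards [hU hC, hU (eventually_gt_atTop K)] with n hn hKn
    exact (hstep n K hKn).trans (hn K hKn)
  have h1 : Tendsto (fun K : ℕ => ∫ y, ∏ i ∈ Finset.range K, f (y i) ∂(μ : Measure (ℕ → ℝ))) atTop
      (𝓝 (∫ y, edgeProduct f y ∂(μ : Measure (ℕ → ℝ)))) := by
    refine tendsto_integral_of_dominated_convergence (fun _ => 1)
      (fun K => (hf.continuous_prod K).aestronglyMeasurable) (integrable_const 1)
      (fun K => Eventually.of_forall fun y => ?_)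
      (Eventually.of_forall fun y => hf.tendsto_edgeProduct y)
    rw [Real.norm_eq_abs, abs_of_nonneg (hf.prod_nonneg _ y)]
    exact hf.prod_le_one _ y
  have h2 : Tendsto (fun K : ℕ => ∫ y, ∏ i ∈ Finset.range K, f (y i) ∂(μ : Measure (ℕ → ℝ))) atTop
      (𝓝 L) := by
    have h0 : Tendsto (fun K : ℕ => C * (1 / 2 : ℝ) ^ K) atTop (𝓝 0) := by
      simpa using (tendsto_pow_atTop_nhds_zero_of_lt_one (by norm_num)
        (by norm_num : (1 / 2 : ℝ) < 1)).const_mul C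
    rw [tendsto_iff_dist_tendsto_zero]
    refine squeeze_zero (fun _ => dist_nonneg) (fun K => ?_) h0
    rw [dist_comm, Real.dist_eq]
    exact hK K
  exact tendsto_nhds_unique h1 h2

/-- A sequence of laws of finite nondecreasing sequences, completed to infinite ones, converges
weakly once it is tight, has few small entries, and its product functionals converge. -/
theorem exists_tendsto_of_edgeProduct
    (hsort : ∀ n, ∀ᵐ y ∂(ν n : Measure (ℕ → ℝ)), ∀ i j, i ≤ j → j < n → y i ≤ y j)
    (hup : ∀ T : ℝ, 0 < T → ∃ C : ℝ, ∀ᶠ n in atTop, ∀ k < n,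
      (ν n : Measure (ℕ → ℝ)).real {y | y k ≤ T} ≤ C * (1 / 2) ^ k)
    (hlow : ∀ k : ℕ, ∀ ε : ℝ, 0 < ε → ∃ T : ℝ, ∀ᶠ n in atTop,
      (ν n : Measure (ℕ → ℝ)).real {y | T < |y k|} ≤ ε)
    (hprod : ∀ f, IsEdgeTest f → ∃ L : ℝ, Tendsto
      (fun n => ∫ y, ∏ i ∈ Finset.range n, f (y i) ∂(ν n : Measure (ℕ → ℝ))) atTop (𝓝 L)) :
    ∃ μ : ProbabilityMeasure (ℕ → ℝ), Tendsto ν atTop (𝓝 μ) := by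
  have hcompact : IsCompact (closure (Set.range ν)) := by
    refine isCompact_closure_of_isTightMeasureSet ?_
    have : {((μ : ProbabilityMeasure (ℕ → ℝ)) : Measure (ℕ → ℝ)) | μ ∈ Set.range ν} =
        Set.range fun n => (ν n : Measure (ℕ → ℝ)) := by
      ext m
      constructor
      · rintro ⟨_, ⟨n, rfl⟩, rfl⟩
        exact ⟨n, rfl⟩
      · rintro ⟨n, rfl⟩
        exact ⟨ν n, ⟨n, rfl⟩, rfl⟩
    rw [this]
    exact isTightMeasureSet_range_of_marginals hlow
  have hlim : ∀ U : Ultrafilter ℕ, ∃ μ, Tendsto ν U (𝓝 μ) := by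
    intro U
    obtain ⟨μ, -, hμ⟩ := hcompact.ultrafilter_le_nhds (U.map ν)
      (le_principal_iff.2 (mem_map.2 (univ_mem' fun n => subset_closure ⟨n, rfl⟩)))
    exact ⟨μ, hμ⟩
  -- the limits along all ultrafilters coincide, because the product functionals determine them
  obtain ⟨U₀, hU₀⟩ := Ultrafilter.exists_le (atTop : Filter ℕ)
  obtain ⟨μ, hμ⟩ := hlim U₀
  refine ⟨μ, (tendsto_iff_ultrafilter _ _ _).2 fun U hU => ?_⟩
  obtain ⟨μ', hμ'⟩ := hlim U
  have : (μ' : Measure (ℕ → ℝ)) = μ := by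
    refine ext_of_integral_edgeProduct (ae_monotone_of_tendsto hU hμ' hsort)
      (ae_monotone_of_tendsto hU₀ hμ hsort) fun f hf => ?_
    obtain ⟨L, hL⟩ := hprod f hf
    rw [integral_edgeProduct_of_tendsto hU hμ' hsort hup hf hL,
      integral_edgeProduct_of_tendsto hU₀ hμ hsort hup hf hL]
  rwa [← Subtype.ext this]

end Limit

/-! ### The rescaled Jacobi ensemble -/

theorem measurable_hardEdgeVector (n : ℕ) (a : ℝ) : Measurable (hardEdgeVector n a) := by
  refine measurable_pi_lambda _ fun i => ?_
  by_cases h : i < n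
  · simp only [hardEdgeVector, dif_pos h]
    exact (((measurable_hermEigenvalue _).add_const 1).mul_const _).mul_const _
  · simp only [hardEdgeVector, dif_neg h]
    exact measurable_const

theorem hardEdgeVector_eq {n : ℕ} (a : ℝ) (M : HermMatrix n) (i : Fin n) :
    hardEdgeVector n a M i = (hermEigenvalue M i + 1) * (n * (n + a)) := by
  have hn : (n : ℝ) ≠ 0 := Nat.cast_ne_zero.2 (Fin.pos i).ne'
  rw [hardEdgeVector, dif_pos i.2]
  field_simp

theorem hardEdgeVector_le_of_le {n : ℕ} {a : ℝ} (ha : 0 ≤ a) (M : HermMatrix n) {i j : ℕ}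
    (hij : i ≤ j) (hj : j < n) : hardEdgeVector n a M i ≤ hardEdgeVector n a M j := by
  have h1 := hardEdgeVector_eq a M ⟨i, hij.trans_lt hj⟩
  have h2 := hardEdgeVector_eq a M ⟨j, hj⟩
  simp only at h1 h2
  rw [h1, h2]
  have := hermEigenvalue_monotone M (show (⟨i, hij.trans_lt hj⟩ : Fin n) ≤ ⟨j, hj⟩ from hij)
  gcongr

theorem ae_hardEdgeVector_nonneg {n : ℕ} {a : ℝ} (ha : 0 ≤ a) (b : ℕ) :
    ∀ᵐ M ∂jacobiUnitaryEnsemble n a b, ∀ i, 0 ≤ hardEdgeVector n a M i := by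
  refine Measure.ae_smul_measure ?_ _
  rw [ae_withDensity_iff (measurable_jacobiWeight n ha b)]
  refine Eventually.of_forall fun M hM i => ?_
  by_cases h : i < n
  · have h1 := hardEdgeVector_eq a M ⟨i, h⟩
    simp only at h1
    rw [h1]
    rw [jacobiWeight_eq, Finset.prod_ne_zero_iff] at hM
    have h2 := hM ⟨i, h⟩ (Finset.mem_univ _)
    have h3 : -1 ≤ hermEigenvalue M ⟨i, h⟩ := by
      by_contra h3
      exact h2 (if_neg fun h4 => h3 h4.1)
    exact mul_nonneg (by linarith) (by positivity)
  · rw [hardEdgeVector, dif_neg h]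

theorem prod_range_ite_lt {k n : ℕ} (hkn : k ≤ n) (c : ℝ) :
    ∏ i ∈ Finset.range n, (if i < k then c else 1) = c ^ k := by
  rw [Finset.prod_ite, Finset.prod_const, Finset.prod_const_one, mul_one]
  congr 1
  have : (Finset.range n).filter (fun i => i < k) = Finset.range k := by
    ext i
    simp only [Finset.mem_filter, Finset.mem_range]
    omega
  rw [this, Finset.card_range]

section Law

variable {n : ℕ} {a : ℝ} {b : ℕ}

/-- Expectations of products over the entries of the rescaled vector of eigenvalues. -/
theorem integral_prod_hardEdgeVector (hn : 0 < n) (ha : 0 ≤ a)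
    [IsProbabilityMeasure (jacobiUnitaryEnsemble n a b)] {f : ℝ → ℝ} (hf : Continuous f)
    (hf0 : ∀ y, 0 ≤ f y) :
    ∫ M, ∏ i ∈ Finset.range n, f (hardEdgeVector n a M i) ∂jacobiUnitaryEnsemble n a b =
      (jacobiHankel n a b (2 * (n * (n + a))) f).det /
        (jacobiHankel n a b (2 * (n * (n + a))) fun _ => 1).det := by
  have hN : (0 : ℝ) < n * (n + a) := by positivity
  rw [← (integral_prod_jacobiUnitaryEnsemble n ha b hN).2 f hf hf0]
  congr 1
  funext M
  rw [Finset.prod_range]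
  exact Finset.prod_congr rfl fun i _ => by rw [hardEdgeVector_eq]

theorem integral_prod_hardEdgeVector_le (hn : 0 < n) (ha : 0 ≤ a)
    [IsProbabilityMeasure (jacobiUnitaryEnsemble n a b)] {g : ℝ → ℝ} (hg : Continuous g)
    (hg1 : ∀ y, -1 ≤ g y) :
    ∫ M, ∏ i ∈ Finset.range n, (1 + g (hardEdgeVector n a M i)) ∂jacobiUnitaryEnsemble n a b ≤
      Real.exp (jacobiMean n a b (2 * (n * (n + a))) g) := by
  rw [integral_prod_hardEdgeVector (f := fun y => 1 + g y) hn ha (by fun_prop)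
    fun y => by linarith [hg1 y]]
  exact jacobiHankel_ratio_le ha (by positivity) hg hg1

theorem integrable_prod_hardEdgeVector [IsProbabilityMeasure (jacobiUnitaryEnsemble n a b)]
    {f : ℝ → ℝ} (hf : Continuous f) (hf0 : ∀ y, 0 ≤ f y) (hf2 : ∀ y, f y ≤ 2) :
    Integrable (fun M => ∏ i ∈ Finset.range n, f (hardEdgeVector n a M i))
      (jacobiUnitaryEnsemble n a b) := by
  refine Integrable.of_bound (Measurable.aestronglyMeasurable ?_) (2 ^ n)
    (Eventually.of_forall fun M => ?_)
  · exact Finset.measurable_fun_prod _ fun i _ => hf.measurable.comp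
      ((measurable_pi_apply i).comp (measurable_hardEdgeVector n a))
  · rw [Real.norm_eq_abs, abs_of_nonneg (Finset.prod_nonneg fun i _ => hf0 _)]
    calc _ ≤ ∏ _i ∈ Finset.range n, (2 : ℝ) := Finset.prod_le_prod (fun i _ => hf0 _) fun i _ => hf2 _
      _ = _ := by simp

/-- An exponential Chebyshev bound on the probability that the `k`-th entry is small: then the
product of `1 + ramp` is at least `2 ^ k`. -/
theorem measureReal_hardEdgeVector_le (ha : 0 ≤ a)
    [IsProbabilityMeasure (jacobiUnitaryEnsemble n a b)] (T : ℝ) {k : ℕ} (hk : k < n) :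
    (jacobiUnitaryEnsemble n a b).real {M | hardEdgeVector n a M k ≤ T} ≤
      Real.exp (jacobiMean n a b (2 * (n * (n + a))) (ramp (T + 1) 1)) * (1 / 2) ^ k := by
  have hc := continuous_ramp (T + 1) 1
  have h0 := ramp_nonneg (T + 1) 1
  have h1 := ramp_le_one (T + 1) 1
  have hE := integral_prod_hardEdgeVector_le (b := b) (Nat.zero_lt_of_lt hk) ha hc fun y => by
    linarith [h0 y]
  have hM := mul_meas_ge_le_integral_of_nonneg (μ := jacobiUnitaryEnsemble n a b)
    (Eventually.of_forall fun M => Finset.prod_nonneg fun i _ => by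
      have := h0 (hardEdgeVector n a M i)
      positivity)
    (integrable_prod_hardEdgeVector (n := n) (a := a) (b := b) (f := fun y => 1 + ramp (T + 1) 1 y)
      (by fun_prop) (fun y => by linarith [h0 y]) fun y => by linarith [h1 y]) (2 ^ k)
  have hsub : (jacobiUnitaryEnsemble n a b).real {M | hardEdgeVector n a M k ≤ T} ≤
      (jacobiUnitaryEnsemble n a b).real {M | (2 : ℝ) ^ k ≤
        ∏ i ∈ Finset.range n, (1 + ramp (T + 1) 1 (hardEdgeVector n a M i))} := by
    refine measureReal_mono fun M hMk => ?_
    refine (prod_range_ite_lt hk.le 2).symm.le.trans (Finset.prod_le_prod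
      (fun i _ => by split_ifs <;> norm_num) fun i _ => ?_)
    split_ifs with hik
    · have h2 : hardEdgeVector n a M i ≤ T := (hardEdgeVector_le_of_le ha M hik.le hk).trans hMk
      rw [ramp_eq_one (by push_cast; linarith)]
      norm_num
    · linarith [h0 (hardEdgeVector n a M i)]
  have h2k : (0 : ℝ) < 2 ^ k := by positivity
  have h3 := (mul_le_mul_of_nonneg_left hsub h2k.le).trans (hM.trans hE)
  rw [one_div, inv_pow, ← div_eq_mul_inv, le_div_iff₀ h2k, mul_comm]
  exact h3

/-- An exponential Chebyshev bound on the probability that the `k`-th entry is large: then the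
product of `1 - ramp / 2` is at least `2 ^ (-k)`. -/
theorem measureReal_lt_hardEdgeVector (ha : 0 ≤ a)
    [IsProbabilityMeasure (jacobiUnitaryEnsemble n a b)] (T : ℝ) {k : ℕ} (hk : k < n) :
    (jacobiUnitaryEnsemble n a b).real {M | T < |hardEdgeVector n a M k|} ≤
      2 ^ k * Real.exp (-(1 / 2) * jacobiMean n a b (2 * (n * (n + a))) (ramp T 1)) := by
  have hc := continuous_ramp T 1
  have h0 := ramp_nonneg T 1
  have h1 := ramp_le_one T 1
  have hmean : jacobiMean n a b (2 * (n * (n + a))) (fun y => -(1 / 2) * ramp T 1 y) =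
      -(1 / 2) * jacobiMean n a b (2 * (n * (n + a))) (ramp T 1) := by
    rw [jacobiMean, jacobiMean, Finset.mul_sum]
    refine Finset.sum_congr rfl fun j _ => ?_
    rw [mul_left_comm (-(1 / 2) : ℝ), ← jacobiFunctional_const_mul b (-(1 / 2))]
    congr 2
    funext y
    ring
  have hE := integral_prod_hardEdgeVector_le (b := b) (n := n) (g := fun y => -(1 / 2) * ramp T 1 y)
    (Nat.zero_lt_of_lt hk) ha (by fun_prop) fun y => by linarith [h1 y]
  rw [hmean] at hE
  have hM := mul_meas_ge_le_integral_of_nonneg (μ := jacobiUnitaryEnsemble n a b)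
    (Eventually.of_forall fun M => Finset.prod_nonneg fun i _ => by
      show (0 : ℝ) ≤ 1 + -(1 / 2) * ramp T 1 (hardEdgeVector n a M i)
      linarith [h1 (hardEdgeVector n a M i)])
    (integrable_prod_hardEdgeVector (n := n) (a := a) (b := b)
      (f := fun y => 1 + -(1 / 2) * ramp T 1 y)
      (by fun_prop) (fun y => by linarith [h1 y]) fun y => by linarith [h0 y]) ((1 / 2) ^ k)
  have hsub : (jacobiUnitaryEnsemble n a b).real {M | T < |hardEdgeVector n a M k|} ≤
      (jacobiUnitaryEnsemble n a b).real {M | (1 / 2 : ℝ) ^ k ≤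
        ∏ i ∈ Finset.range n, (1 + -(1 / 2) * ramp T 1 (hardEdgeVector n a M i))} := by
    refine ENNReal.toReal_mono (measure_ne_top _ _) (measure_mono_ae ?_)
    filter_upwards [ae_hardEdgeVector_nonneg ha b] with M hM0 hMk
    have hMk : T < |hardEdgeVector n a M k| := hMk
    rw [abs_of_nonneg (hM0 k)] at hMk
    refine (prod_range_ite_lt hk.le (1 / 2)).symm.le.trans (Finset.prod_le_prod
      (fun i _ => by split_ifs <;> norm_num) fun i hi => ?_)
    split_ifs with hik
    · linarith [h1 (hardEdgeVector n a M i)]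
    · have h2 : T ≤ hardEdgeVector n a M i :=
        hMk.le.trans (hardEdgeVector_le_of_le ha M (not_lt.1 hik) (Finset.mem_range.1 hi))
      rw [ramp_eq_zero 1 h2]
      norm_num
  have h2k : (0 : ℝ) < (1 / 2) ^ k := by positivity
  have h3 := (mul_le_mul_of_nonneg_left hsub h2k.le).trans (hM.trans hE)
  have h4 : (2 : ℝ) ^ k * (1 / 2) ^ k = 1 := by rw [← mul_pow]; norm_num
  calc _ = 2 ^ k * ((1 / 2) ^ k *
        (jacobiUnitaryEnsemble n a b).real {M | T < |hardEdgeVector n a M k|}) := by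
        rw [← mul_assoc, h4, one_mul]
    _ ≤ _ := by gcongr

end Law

theorem proposition3p12 (b : ℕ) (a : ℕ → ℝ) (ha : ∀ n, 0 ≤ a n)
    (hliminf : 0 ≤ liminf (fun n : ℕ => ((a n / n : ℝ) : EReal)) atTop ∧
      liminf (fun n : ℕ => ((a n / n : ℝ) : EReal)) atTop < ⊤)
    {Ω : ℕ → Type*} [∀ n, MeasurableSpace (Ω n)]
    (P : ∀ n, Measure (Ω n)) [∀ n, IsProbabilityMeasure (P n)]
    (M : ∀ n, Ω n → HermMatrix n)
    (hM : ∀ n, HasLaw (M n) (jacobiUnitaryEnsemble n (a n) b) (P n)) :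
    ∃ μ : ProbabilityMeasure (ℕ → ℝ),
      TendstoInDistribution (fun n ω => hardEdgeVector n (a n) (M n ω)) atTop
        (id : (ℕ → ℝ) → (ℕ → ℝ)) P (μ : Measure (ℕ → ℝ)) := by
  have hJ : ∀ n, IsProbabilityMeasure (jacobiUnitaryEnsemble n (a n) b) := fun n =>
    (hM n).isProbabilityMeasure_iff.1 inferInstance
  have hmeas := fun n => measurable_hardEdgeVector n (a n)
  let ν : ℕ → ProbabilityMeasure (ℕ → ℝ) := fun n =>
    ⟨(jacobiUnitaryEnsemble n (a n) b).map (hardEdgeVector n (a n)),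
      Measure.isProbabilityMeasure_map (hmeas n).aemeasurable⟩
  have hreal : ∀ n (s : Set (ℕ → ℝ)), MeasurableSet s → (ν n : Measure (ℕ → ℝ)).real s =
      (jacobiUnitaryEnsemble n (a n) b).real (hardEdgeVector n (a n) ⁻¹' s) := fun n s hs =>
    map_measureReal_apply (hmeas n) hs
  obtain ⟨μ, hμ⟩ : ∃ μ : ProbabilityMeasure (ℕ → ℝ), Tendsto ν atTop (𝓝 μ) := by
    refine exists_tendsto_of_edgeProduct (fun n => ?_) (fun T hT => ?_) (fun k ε hε => ?_)
      fun f hf => ?_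
    · have hs : MeasurableSet {y : ℕ → ℝ | ∀ i j, i ≤ j → j < n → y i ≤ y j} := by
        simp only [Set.ofPred_forall]
        exact MeasurableSet.iInter fun i => MeasurableSet.iInter fun j => MeasurableSet.iInter
          fun _ => MeasurableSet.iInter fun _ =>
            measurableSet_le (measurable_pi_apply i) (measurable_pi_apply j)
      refine (ae_map_iff (hmeas n).aemeasurable hs).2 (Eventually.of_forall fun M i j hij hj => ?_)
      exact hardEdgeVector_le_of_le (ha n) M hij hj
    · obtain ⟨K, hK⟩ := exists_jacobiMean_le (T := T + 1) ha b (by linarith)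
        (continuous_ramp (T + 1) 1) (fun y hy => ramp_eq_zero 1 hy) (C := 1) fun y => by
          rw [abs_of_nonneg (ramp_nonneg _ _ _)]; exact ramp_le_one _ _ _
      refine ⟨Real.exp K, ?_⟩
      filter_upwards [hK] with n hn k hk
      rw [hreal n _ (measurableSet_le (measurable_pi_apply k) measurable_const)]
      refine (measureReal_hardEdgeVector_le (ha n) T hk).trans ?_
      gcongr
      exact hn
    -- this level of the mean turns the Chebyshev bound `2 ^ k * exp (-mean / 2)` into `ε`
    · obtain ⟨Y, hY, hlow⟩ := exists_le_jacobiMean ha b (-2 * Real.log (ε / 2 ^ k))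
      refine ⟨Y + 1, ?_⟩
      filter_upwards [hlow _ (continuous_ramp (Y + 1) 1) (ramp_nonneg _ _) fun y hy => by
        rw [ramp_eq_one (by push_cast; linarith [hy.2])], eventually_gt_atTop k] with n hn hk
      rw [hreal n _ (measurableSet_lt measurable_const (measurable_pi_apply k).abs)]
      refine (measureReal_lt_hardEdgeVector (ha n) (Y + 1) hk).trans ?_
      have h1 : Real.exp (-(1 / 2) * jacobiMean n (a n) b (2 * (n * (n + a n)))
          (ramp (Y + 1) 1)) ≤ ε / 2 ^ k := by
        rw [← Real.exp_log (show 0 < ε / 2 ^ k by positivity)]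
        refine Real.exp_le_exp.2 ?_
        unfold hardEdgeScale at hn
        linarith
      calc _ ≤ 2 ^ k * (ε / 2 ^ k) := by gcongr
        _ = ε := by field_simp
    · obtain ⟨T, hT, hfT⟩ := hf.eq_one
      have hfc := hf.continuous
      obtain ⟨L, hL⟩ := exists_tendsto_hankel_ratio (g := fun y => f y - 1) ha b hT.le (by fun_prop)
        (fun y hy => by rw [hfT y hy, sub_self]) (C := 1) fun y => by
          rw [abs_le]; constructor <;> linarith [hf.nonneg y, hf.le_one y]
      refine ⟨L, hL.congr' ?_⟩
      filter_upwards [eventually_gt_atTop 0] with n hn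
      simp only [add_sub_cancel]
      rw [show (ν n : Measure (ℕ → ℝ)) =
        (jacobiUnitaryEnsemble n (a n) b).map (hardEdgeVector n (a n)) from rfl,
        integral_map (hmeas n).aemeasurable (hf.continuous_prod n).aestronglyMeasurable,
        integral_prod_hardEdgeVector hn (ha n) hf.continuous hf.nonneg]
      rfl
  refine ⟨μ, fun n => (hmeas n).comp_aemeasurable (hM n).aemeasurable, aemeasurable_id, ?_⟩
  have hν : ∀ n, (P n).map (fun ω => hardEdgeVector n (a n) (M n ω)) =
      (jacobiUnitaryEnsemble n (a n) b).map (hardEdgeVector n (a n)) := by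
    intro n
    rw [← (hM n).map_eq, AEMeasurable.map_map_of_aemeasurable (hmeas n).aemeasurable
      (hM n).aemeasurable]
    rfl
  refine (tendsto_congr (f₂ := ν) fun n => Subtype.ext (hν n)).2 ?_
  exact (congrArg (fun m => Tendsto ν atTop (𝓝 m)) (Subtype.ext Measure.map_id)).mpr hμ
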